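/- Let $T$ be an ideal triangulation of an oriented bordered surface $(S,M)$ with marked points, and let $\gamma^{(p)}$ be a singly notched arc: its underlying plain arc $\gamma$ joins a marked point $q\neq p$ to a puncture $p$, and it is notched at $p$ and plain at $q$. Suppose that $\gamma$ is not in $T$ and that $p$ is not the puncture enclosed by a self-folded triangle of $T$. Direct $\gamma$ towards $p$, let $k\ge 1$ be the number of crossings of $\gamma$ (in minimal position) with $T$, and let $l\ge 2$ be the number of ends of arcs of $T$ at $p$. *Snake graphs.* A curve in minimal position with successive crossings with arcs $\tau_{i_1},\dots,\tau_{i_d}$ of $T$ has a snake graph $(G_1,\dots,G_d)$ in the plane. The tile $G_j$ is a unit square obtained from the two triangles on the two sides of the $j$-th crossing, the one before the crossing forming the lower left half and the one after it the upper right half; the diagonal $\tau_{i_j}$ joins the north-west and south-east vertices and is not an edge of the graph; each edge carries a side of one of the two triangles. (If $\tau_{i_j}$ is the radius of a self-folded triangle, two copies of this triangle are used.) One has $\mathrm{rel}(G_j)=1$ or $-1$ according to whether the orientation of the surface agrees with that of the plane or not, and $\mathrm{rel}(G_{j+1})=-\mathrm{rel}(G_j)$. The North or East edge of $G_j$ is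 glued to the South or West edge of $G_{j+1}$ along the third side of the triangle traversed between the two crossings. A perfect matching is a set of edges such that each vertex is in exactly one of them. A perfect matching $P$ orients each diagonal: travel from the south-west vertex of $G_1$ to the north-east vertex of $G_d$, alternately along edges of $P$ and diagonals. The diagonal of $G_j$ is positive if it is traversed downwards and $\mathrm{rel}(G_j)=1$, or upwards and $\mathrm{rel}(G_j)=-1$. *Monomials.* Let $x_1,\dots,x_n,y_1,\dots,y_n$ be independent variables, indexed by the arcs $\tau_1,\dots,\tau_n$ of $T$. Put $x_{\tau_i}=x_ix_j$ if $\tau_i$ is the outer side of a self-folded triangle with radius $\tau_j$, $x_{\tau_i}=x_i$ otherwise, and $x_\tau=1$ if $\tau$ is a boundary segment. Then $x(P)$ is the product of $x_\tau$ over the edges of $P$, where $\tau$ is carried by the edge, and $y(P)$ is the product over the positive diagonals $\tau_{i}$ of $y_{i}$, or of $y_{i}y_{j}^{-1}$ if $\tau_{i}$ is the radius of a self-folded triangle with outer side $\tau_j$. *Symmetric matchings.* Let $\ell_p$ be the plain arc enclosing $\gamma$ in a monogon with puncture $p$: it follows $\gamma$, goes once around $p$, and follows $\gamma$ backwards. Let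 $\mathcal G_{\ell_p,T}=(G_1,\dots,G_{2k+l})$, $\mathcal G_{\gamma,1}=(G_1,\dots,G_k)$ and $\mathcal G_{\gamma,2}=(G_{k+l+1},\dots,G_{2k+l})$. These two subgraphs are isomorphic by the isomorphism which sends $G_j$ to $G_{2k+l+1-j}$ and preserves the sides carried by the edges. A perfect matching $P$ of $\mathcal G_{\ell_p,T}$ is $\gamma$-symmetric if this isomorphism carries the restriction of $P$ to $\mathcal G_{\gamma,1}$ without the north-east vertex of $G_k$ to the restriction of $P$ to $\mathcal G_{\gamma,2}$ without the south-west vertex of $G_{k+l+1}$ (a vertex is removed together with its incident edges). Then put $$\overline x(P)=\frac{x(P)}{x(P|_{\mathcal G_{\gamma,i}})},\qquad \overline y(P)=\frac{y(P)}{y(P|_{\mathcal G_{\gamma,i}})},$$ where $i\in\{1,2\}$ is such that $P|_{\mathcal G_{\gamma,i}}$ is a perfect matching of $\mathcal G_{\gamma,i}$. *Loop graph.* The hooked arc follows $\gamma$ and then travels around $p$, crossing each end of an arc of $T$ at $p$ once. Let $(G_1,\dots,G_{k+l})$ be its snake graph. Let $c'$ be the North or East edge of $G_k$ that is not glued to $G_{k+1}$,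 and let $c$ be the North or East edge of $G_{k+l}$ that carries the same side of the last triangle of $\gamma$ as $c'$. The loop graph $\mathcal G_{\gamma^{(p)},T}$ is obtained by gluing $c$ to $c'$, such that the north-east vertex of $G_{k+l}$ is glued to the end of $c'$ other than the north-east vertex of $G_k$, and the other end of $c$ is glued to the north-east vertex of $G_k$. A good matching of it is a perfect matching that extends to a perfect matching of $(G_1,\dots,G_{k+l})$; its monomial $x$ is defined as above, and its monomial $y$ is defined through the orientation of the diagonals that this extension induces. **Proposition.** Every $\gamma$-symmetric perfect matching $P$ of $\mathcal G_{\ell_p,T}$ restricts to a perfect matching of $\mathcal G_{\gamma,i}$ for some $i\in\{1,2\}$, and $\overline x(P)$ and $\overline y(P)$ do not depend on the choice of such an $i$. There is a bijection $$\Phi:\{\gamma\text{-symmetric perfect matchings of }\mathcal G_{\ell_p,T}\}\longrightarrow\{\text{good matchings of }\mathcal G_{\gamma^{(p)},T}\}$$ such that $\overline x(P)=x(\Phi(P))$ and $\overline y(P)=y(\Phi(P))$ for all $P$. This holds for each choice of the direction around $p$ and of the relative orientation of the first tile, made independently for the two graphs. -/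

import Mathlib

/-! # Triangulated bordered surfaces

An ideal triangulation of an oriented bordered surface is recorded by the gluing of its triangles.
`D` is the set of *triangle sides*: a pair (triangle, side of it), directed so that the sides of a
triangle go clockwise around it. `next d` is the side that follows `d` clockwise in its triangle;
`glue d` is the side of a triangle that is glued to `d`, with `glue d = d` exactly when `d` is a
boundary segment of the surface. A triangle may be glued to itself (self-folded triangles). -/

/-- An ideal triangulation of an oriented bordered surface, with set of triangle sides `D`. -/
structure IdealTriangulation (D : Type*) where
  next : Equiv.Perm D
  glue : Equiv.Perm D
  next_ne : ∀ d, next d ≠ d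
  next_next_next : ∀ d, next (next (next d)) = d
  glue_glue : ∀ d, glue (glue d) = d

namespace IdealTriangulation

variable {D : Type*} (T : IdealTriangulation D)

/-- The side `d` lies on the boundary of the surface. -/
def IsBoundary (d : D) : Prop := T.glue d = d

/-- The arcs of the triangulation: pairs of distinct sides that are glued to each other. -/
def Arc : Type _ := {s : Sym2 D // ∃ d, ¬ T.IsBoundary d ∧ s = s(d, T.glue d)}

/-- The arc on which an interior side lies. -/
def arc (d : D) (hd : ¬ T.IsBoundary d) : T.Arc := ⟨s(d, T.glue d), d, hd, rfl⟩

/-! ### Marked points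

The side `d` also stands for the corner of its triangle at the head of `d`, between the sides `d`
and `next d`. A marked point is a class of corners. -/

/-- Two corners lie at the same marked point: one gets from one to the other by crossing
arcs that end there. -/
def SameMarkedPoint : D → D → Prop :=
  Relation.EqvGen fun c c' => ¬ T.IsBoundary (T.next c) ∧ c' = T.glue (T.next c)

/-- The marked point of the corner `c` is a puncture: no boundary segment ends there. -/
def IsPuncture (c : D) : Prop :=
  ∀ d, T.SameMarkedPoint c d → ¬ T.IsBoundary d ∧ ¬ T.IsBoundary (T.next d)

/-- The marked point of the corner `c` is the puncture enclosed by a self-folded triangle, that is,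
the common point of the two sides of a triangle that are glued to each other. -/
def IsEnclosedBySelfFolded (c : D) : Prop :=
  ∃ d, T.SameMarkedPoint c d ∧ T.glue d = T.next d

/-- At a puncture, the corner that follows a given corner counterclockwise around the puncture. -/
def rot : Equiv.Perm D := T.glue * T.next

/-- The degree of the puncture of the corner `c`: the number of ends of arcs there, which is the
number of corners there. -/
noncomputable def degree (c : D) : ℕ := Function.minimalPeriod T.rot c

/-! ### Variables -/

/-- The field of rational functions in `2 n` variables: an initial cluster variable (`Sum.inl`)
and an initial coefficient variable (`Sum.inr`) for each of the `n` arcs of the triangulation.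
The arcs of the triangulation `T` index the arcs of the associated tagged triangulation. -/
abbrev Field : Type _ := FractionRing (MvPolynomial (T.Arc ⊕ T.Arc) ℚ)

open Classical in
/-- The initial cluster variable with the index of the arc of `d` (`1` on the boundary). -/
noncomputable def clusterVar (d : D) : T.Field :=
  if hd : T.IsBoundary d then 1
  else algebraMap (MvPolynomial (T.Arc ⊕ T.Arc) ℚ) _ (MvPolynomial.X (Sum.inl (T.arc d hd)))

open Classical in
/-- The coefficient variable with the index of the arc of `d` (`1` on the boundary). -/
noncomputable def coeffVar (d : D) : T.Field :=
  if hd : T.IsBoundary d then 1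
  else algebraMap (MvPolynomial (T.Arc ⊕ T.Arc) ℚ) _ (MvPolynomial.X (Sum.inr (T.arc d hd)))

/-- The triangle of `d` is self-folded with outer side `d`: its other two sides are glued. -/
def IsOuterSide (d : D) : Prop := T.glue (T.next d) = T.next (T.next d)

open Classical in
/-- The element `x_τ` of an arc `τ` of the ideal triangulation, given by a side `d` on it: the
cluster variable of `τ`, times the cluster variable of the radius if `τ` encloses a punctured
monogon of the triangulation. Boundary segments have weight `1`. -/
noncomputable def x (d : D) : T.Field :=
  if T.IsBoundary d then 1
  else T.clusterVar d * (if T.IsOuterSide d then T.clusterVar (T.next d) else 1) *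
    (if T.IsOuterSide (T.glue d) then T.clusterVar (T.next (T.glue d)) else 1)

open Classical in
/-- The contribution of a positive diagonal on the arc `τ` of `d` to a coefficient monomial:
`y_τ`, divided, if `τ` is a radius (it is glued to a neighbouring side of its own triangle), by the
coefficient variable of the notched version of `τ`, which in the tagged triangulation has the index
of the outer side of the self-folded triangle. -/
noncomputable def y (d : D) : T.Field :=
  T.coeffVar d *
    (if T.glue d = T.next d then (T.coeffVar (T.next (T.next d)))⁻¹ else 1) *
    (if T.glue d = T.next (T.next d) then (T.coeffVar (T.next d))⁻¹ else 1)

end IdealTriangulation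

/-! # Snake graphs -/

/-- The edges of a tile. -/
inductive Side
  | N | E | S | W
  deriving DecidableEq

instance : Fintype Side :=
  ⟨{Side.N, Side.E, Side.S, Side.W}, fun s => by cases s <;> decide⟩

/-- The tile with south-west vertex `c` is the unit square `[c.1, c.1 + 1] × [c.2, c.2 + 1]`. -/
abbrev PlanePoint : Type := ℤ × ℤ

namespace Tile

def sw (c : PlanePoint) : PlanePoint := c
def se (c : PlanePoint) : PlanePoint := (c.1 + 1, c.2)
def nw (c : PlanePoint) : PlanePoint := (c.1, c.2 + 1)
def ne (c : PlanePoint) : PlanePoint := (c.1 + 1, c.2 + 1)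

/-- The edges of the tile at `c`, as unordered pairs of vertices. -/
def edge (c : PlanePoint) : Side → Sym2 PlanePoint
  | .N => s(nw c, ne c)
  | .E => s(se c, ne c)
  | .S => s(sw c, se c)
  | .W => s(sw c, nw c)

end Tile

/-- A snake graph: tiles `G_0, …, G_{len - 1}` in the plane, each placed to the right of the
previous one or above it. Only the values `corner i` with `i < len` matter. -/
structure SnakeGraph where
  len : ℕ
  /-- The south-west vertices of the tiles. -/
  corner : ℕ → PlanePoint
  step : ∀ i, i + 1 < len →
    corner (i + 1) = corner i + (1, 0) ∨ corner (i + 1) = corner i + (0, 1)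

namespace SnakeGraph

variable (G : SnakeGraph)

def verts : Finset PlanePoint :=
  (Finset.range G.len).biUnion fun i =>
    {Tile.sw (G.corner i), Tile.se (G.corner i), Tile.nw (G.corner i), Tile.ne (G.corner i)}

def edges : Finset (Sym2 PlanePoint) :=
  (Finset.range G.len).biUnion fun i => Finset.univ.image (Tile.edge (G.corner i))

/-- Perfect matchings: sets of edges such that each vertex is in exactly one of them. -/
def IsPerfectMatching (P : Finset (Sym2 PlanePoint)) : Prop :=
  P ⊆ G.edges ∧ ∀ v ∈ G.verts, ∃! e, e ∈ P ∧ v ∈ e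

/-- `v` lists the vertices of the travel that starts at the south-west vertex of the first tile,
uses alternately edges of `P` and diagonals (from north-west to south-east or conversely), and ends
at the north-east vertex of the last tile. No vertex lies on two diagonals; the diagonals are
traversed in the order of the tiles, each of them once. -/
def IsTravel (P : Finset (Sym2 PlanePoint)) (v : ℕ → PlanePoint) : Prop :=
  v 0 = Tile.sw (G.corner 0) ∧
  (∀ i ≤ G.len, s(v (2 * i), v (2 * i + 1)) ∈ P) ∧
  (∀ i < G.len, s(v (2 * i + 1), v (2 * i + 2)) = s(Tile.nw (G.corner i), Tile.se (G.corner i))) ∧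
  v (2 * G.len + 1) = Tile.ne (G.corner (G.len - 1))

/-- `P` orients the diagonal of the tile `j` down: it is traversed towards its south-east end. -/
def IsDown (P : Finset (Sym2 PlanePoint)) (j : ℕ) : Prop :=
  ∃ v, G.IsTravel P v ∧ v (2 * j + 1) = Tile.nw (G.corner j) ∧ v (2 * j + 2) = Tile.se (G.corner j)

/-- `P` orients the diagonal of the tile `j` up: it is traversed towards its north-west end. -/
def IsUp (P : Finset (Sym2 PlanePoint)) (j : ℕ) : Prop :=
  ∃ v, G.IsTravel P v ∧ v (2 * j + 1) = Tile.se (G.corner j) ∧ v (2 * j + 2) = Tile.nw (G.corner j)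

end SnakeGraph

/-- A snake graph whose tiles are labelled as tiles of crossings with a triangulation with set of
sides `D`: each tile has a relative orientation `1` or `-1`, and the side `diag i` through which
the curve leaves a triangle at the `i`-th crossing. -/
structure LabelledSnakeGraph (D : Type*) extends SnakeGraph where
  rel : ℕ → ℤˣ
  diag : ℕ → D

namespace LabelledSnakeGraph

/-- The subgraph of the `m` consecutive tiles `G_a, …, G_{a + m - 1}`. -/
def sub {D : Type*} (G : LabelledSnakeGraph D) (a m : ℕ) (h : a + m ≤ G.len) :
    LabelledSnakeGraph D where
  len := m
  corner i := G.corner (a + i)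
  step i hi := G.step (a + i) (by omega)
  rel i := G.rel (a + i)
  diag i := G.diag (a + i)

/-- The diagonal of the tile `j` is positive with respect to `P`. -/
def IsPositive {D : Type*} (G : LabelledSnakeGraph D) (P : Finset (Sym2 PlanePoint)) (j : ℕ) : Prop :=
  (G.IsDown P j ∧ G.rel j = 1) ∨ (G.IsUp P j ∧ G.rel j = -1)

end LabelledSnakeGraph

/-! # Loop graphs -/

/-- A loop graph with one loop, at the last tile of the underlying snake graph: the edge `cut`
(North or East) of the last tile is glued to the boundary edge of the tile `k` that is one of
its North and East edges. -/
structure LoopGraph (D : Type*) extends LabelledSnakeGraph D where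
  k : ℕ
  hk : k + 1 < len
  cut : Side
  hcut : cut = Side.N ∨ cut = Side.E

namespace LoopGraph

variable {D : Type*} (L : LoopGraph D)

/-- The end different from the north-east vertex of the North or East edge of the tile at `c`. -/
def otherEnd (c : PlanePoint) (s : Side) : PlanePoint :=
  if s = Side.N then Tile.nw c else Tile.se c

/-- That edge of North and East of the tile `k` which is not glued to the tile `k + 1`. -/
def cut' : Side :=
  if L.corner (L.k + 1) = L.corner L.k + (1, 0) then Side.N else Side.E

/-- The glued edges `c = {x, y}` and `c' = {x', y'}`. -/
def c : Sym2 PlanePoint := Tile.edge (L.corner (L.len - 1)) L.cut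
def c' : Sym2 PlanePoint := Tile.edge (L.corner L.k) L.cut'
def ptX : PlanePoint := Tile.ne (L.corner (L.len - 1))
def ptY : PlanePoint := otherEnd (L.corner (L.len - 1)) L.cut
def ptY' : PlanePoint := Tile.ne (L.corner L.k)
def ptX' : PlanePoint := otherEnd (L.corner L.k) L.cut'

/-- The gluing of vertices: `x'` becomes `x` and `y'` becomes `y`. -/
def glueVert (v : PlanePoint) : PlanePoint :=
  if v = L.ptX' then L.ptX else if v = L.ptY' then L.ptY else v

/-- The gluing of edges: `c'` becomes `c`. An edge of the loop graph is represented by an edge of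
the underlying snake graph; its ends are the glued ends, see `Inc`. -/
def glueEdge (e : Sym2 PlanePoint) : Sym2 PlanePoint := if e = L.c' then L.c else e

def verts : Finset PlanePoint := L.toSnakeGraph.verts.image L.glueVert

def edges : Finset (Sym2 PlanePoint) := L.toSnakeGraph.edges.image L.glueEdge

/-- `v` is an end of the edge `e` in the loop graph. -/
def Inc (e : Sym2 PlanePoint) (v : PlanePoint) : Prop :=
  ∃ e₀ ∈ L.toSnakeGraph.edges, ∃ v₀ ∈ e₀, L.glueEdge e₀ = e ∧ L.glueVert v₀ = v

def IsPerfectMatching (Q : Finset (Sym2 PlanePoint)) : Prop :=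
  Q ⊆ L.edges ∧ ∀ v ∈ L.verts, ∃! e, e ∈ Q ∧ L.Inc e v

/-- The perfect matching `P` of the underlying snake graph extends `Q`: it contains
each edge of the snake graph whose image in the loop graph is in `Q`. -/
def Extends (P Q : Finset (Sym2 PlanePoint)) : Prop :=
  L.toSnakeGraph.IsPerfectMatching P ∧ ∀ e ∈ L.toSnakeGraph.edges, L.glueEdge e ∈ Q → e ∈ P

/-- Good matchings: perfect matchings of the loop graph that can be extended to a perfect matching
of the underlying snake graph. -/
def IsGoodMatching (Q : Finset (Sym2 PlanePoint)) : Prop :=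
  L.IsPerfectMatching Q ∧ ∃ P, L.Extends P Q

end LoopGraph

/-! # Tiles of a triangulated surface, and weights -/

namespace IdealTriangulation

variable {D : Type*} (T : IdealTriangulation D)

/-- The side of a triangle on each edge of the tile of a crossing in which the curve leaves a
triangle through its side `d`. The triangle of `d` is the lower half of the tile, the triangle
of `glue d` is the upper half, the deleted diagonal joins north-west and south-east, and the sides
go clockwise (`r = 1`) or counterclockwise (`r = -1`) in the plane. If `d` is the radius of a
self-folded triangle, this gives the non-ordinary tile, in which North and West carry the same arc
and so do South and East. -/
def tileSide (r : ℤˣ) (d : D) : Side → D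
  | .S => if r = 1 then T.next d else T.next (T.next d)
  | .W => if r = 1 then T.next (T.next d) else T.next d
  | .N => if r = 1 then T.next (T.glue d) else T.next (T.next (T.glue d))
  | .E => if r = 1 then T.next (T.next (T.glue d)) else T.next (T.glue d)

open Classical in
/-- The displacement from the tile of a crossing through `d` to the tile of the next crossing,
through a side `d'` of the triangle of `glue d`. The two tiles share the third side of
this triangle: it is the East edge of the first tile if `d'` is its North edge, and conversely. -/
noncomputable def tileStep (r : ℤˣ) (d d' : D) : PlanePoint :=
  if d' = T.tileSide r d Side.N then (1, 0) else (0, 1)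

/-- The south-west vertices of the tiles of the crossings through `w 0, w 1, …`. -/
noncomputable def tileCorner (r : ℤˣ) (w : ℕ → D) : ℕ → PlanePoint
  | 0 => (0, 0)
  | i + 1 => tileCorner r w i + T.tileStep (r * (-1) ^ i) (w i) (w (i + 1))

/-- The snake graph of a curve that crosses `n` arcs, through the sides `w 0, …, w (n - 1)`. The
relative orientations alternate; that of the first tile is `r`. -/
noncomputable def snakeGraph (r : ℤˣ) (n : ℕ) (w : ℕ → D) : LabelledSnakeGraph D where
  len := n
  corner := T.tileCorner r w
  step i _ := by
    simp only [tileCorner, tileStep]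
    split_ifs
    · exact Or.inl rfl
    · exact Or.inr rfl
  rel i := r * (-1) ^ i
  diag := w

open Classical in
/-- The weight of an edge of a snake graph: `x_τ` if the edge carries the arc `τ`. (An edge in which
two tiles are glued carries the same side in both.) -/
noncomputable def edgeWeight (G : LabelledSnakeGraph D) (e : Sym2 PlanePoint) : T.Field :=
  if h : ∃ q : ℕ × Side, q.1 < G.len ∧ Tile.edge (G.corner q.1) q.2 = e then
    T.x (T.tileSide (G.rel h.choose.1) (G.diag h.choose.1) h.choose.2)
  else 1

/-- The weight monomial of a matching. (For a loop graph, the glued edges carry the same arc.) -/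
noncomputable def weightMonomial (G : LabelledSnakeGraph D) (P : Finset (Sym2 PlanePoint)) :
    T.Field :=
  ∏ e ∈ P, T.edgeWeight G e

open Classical in
/-- The coefficient monomial of a perfect matching of a snake graph. -/
noncomputable def coeffMonomial (G : LabelledSnakeGraph D) (P : Finset (Sym2 PlanePoint)) :
    T.Field :=
  ∏ j ∈ (Finset.range G.len).filter (fun j => G.IsPositive P j), T.y (G.diag j)

/-- The coefficient monomial of a good matching of a loop graph: its diagonals are oriented by the
perfect matching of the underlying snake graph that extends it. -/
noncomputable def coeffMonomialLoop (L : LoopGraph D) (Q : Finset (Sym2 PlanePoint))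
    (hQ : L.IsGoodMatching Q) : T.Field :=
  T.coeffMonomial L.toLabelledSnakeGraph hQ.2.choose

/-! # Arcs -/

/-- A directed plain curve between marked points that crosses at least one arc of `T`, up to
homotopy: it is recorded by the sides `cross 0, …, cross (len - 1)` through which it successively
leaves triangles when it is in minimal position with respect to `T`. It leaves each triangle through
a side other than the one through which it entered; it starts at the corner opposite to its first
crossing and ends at the corner opposite to its last one. Every arc that is not in `T` is such a
curve; we do not need that it has no self-crossings. Values of `cross` beyond `len` are ignored. -/
structure Curve where
  len : ℕ
  len_pos : 0 < len
  cross : ℕ → D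
  interior : ∀ i < len, ¬ T.IsBoundary (cross i)
  turn : ∀ i, i + 1 < len →
    cross (i + 1) = T.next (T.glue (cross i)) ∨
    cross (i + 1) = T.next (T.next (T.glue (cross i)))

/-- The corner at which the curve starts, opposite to the first side that it crosses. -/
def Curve.startCorner {T : IdealTriangulation D} (γ : Curve T) : D := T.next (γ.cross 0)

/-- The corner at which the curve ends, opposite to the last side that it crosses. -/
def Curve.endCorner {T : IdealTriangulation D} (γ : Curve T) : D :=
  T.next (T.glue (γ.cross (γ.len - 1)))

/-- A singly notched arc, given by its underlying plain arc (not in `T`), directed so that it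
ends at the puncture at which it is notched; it starts at another marked point. -/
structure SinglyNotchedArc extends Curve T where
  puncture : T.IsPuncture toCurve.endCorner
  start_ne : ¬ T.SameMarkedPoint toCurve.endCorner toCurve.startCorner

end IdealTriangulation

namespace IdealTriangulation.SinglyNotchedArc

variable {D : Type*} {T : IdealTriangulation D} (γ : SinglyNotchedArc T)

/-- The degree `l` of the puncture at which the arc is notched. -/
noncomputable def deg : ℕ := T.degree γ.endCorner

/-- The sides crossed when going once around the puncture, counterclockwise or clockwise, from the
last triangle of the arc back to this triangle. -/
def around (ccw : Bool) (j : ℕ) : D :=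
  if ccw then T.next ((T.rot ^ j) γ.endCorner) else (T.rot⁻¹ ^ j) γ.endCorner

/-- The hooked arc: it follows the arc and then travels around the puncture, crossing each end
of an arc there once. -/
def hookedCross (ccw : Bool) (i : ℕ) : D :=
  if i < γ.len then γ.cross i else γ.around ccw (i - γ.len)

/-- The plain arc `ℓ_p` that encloses the arc in a monogon with puncture `p`: it follows the arc,
travels once around the puncture and follows the arc backwards. -/
noncomputable def loopCross (ccw : Bool) (i : ℕ) : D :=
  if i < γ.len + γ.deg then γ.hookedCross ccw i
  else T.glue (γ.cross (2 * γ.len + γ.deg - 1 - i))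

/-- The snake graph of `ℓ_p`. -/
noncomputable def snakeLoop (ccw : Bool) (r : ℤˣ) : LabelledSnakeGraph D :=
  T.snakeGraph r (2 * γ.len + γ.deg) (γ.loopCross ccw)

/-- The two copies in the snake graph of `ℓ_p` of the snake graph of the plain arc: the first
`len` tiles and the last `len` tiles. -/
noncomputable def copy (ccw : Bool) (r : ℤˣ) : Fin 2 → LabelledSnakeGraph D
  | 0 => (γ.snakeLoop ccw r).sub 0 γ.len
      (by change 0 + γ.len ≤ 2 * γ.len + γ.deg; omega)
  | 1 => (γ.snakeLoop ccw r).sub (γ.len + γ.deg) γ.len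
      (by change γ.len + γ.deg + γ.len ≤ 2 * γ.len + γ.deg; omega)

/-- The isomorphism between the two copies sends the tile `j` to the tile
`2 * len + deg - 1 - j`, which is crossed in the opposite direction. The two tiles have the same
relative orientation exactly if `deg` is odd, and this determines the correspondence of edges. -/
noncomputable def flipSide : Side → Side
  | .N => if Odd γ.deg then Side.S else Side.W
  | .E => if Odd γ.deg then Side.W else Side.S
  | .S => if Odd γ.deg then Side.N else Side.E
  | .W => if Odd γ.deg then Side.E else Side.N

/-- `γ`-symmetric perfect matchings of the snake graph of `ℓ_p`: the restrictions to the first copy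
without the north-east vertex of its last tile and to the second copy without the south-west vertex
of its first tile correspond to each other. -/
def IsSymmetricMatching (ccw : Bool) (r : ℤˣ) (P : Finset (Sym2 PlanePoint)) : Prop :=
  (γ.snakeLoop ccw r).IsPerfectMatching P ∧
  ∀ j < γ.len, ∀ s : Side,
    Tile.ne ((γ.snakeLoop ccw r).corner (γ.len - 1)) ∉
      Tile.edge ((γ.snakeLoop ccw r).corner j) s →
    (Tile.edge ((γ.snakeLoop ccw r).corner j) s ∈ P ↔
      Tile.edge ((γ.snakeLoop ccw r).corner (2 * γ.len + γ.deg - 1 - j)) (γ.flipSide s) ∈ P)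

/-- The restriction of a matching to one of the two copies. -/
noncomputable def restrict (ccw : Bool) (r : ℤˣ) (i : Fin 2) (P : Finset (Sym2 PlanePoint)) :
    Finset (Sym2 PlanePoint) :=
  P ∩ (γ.copy ccw r i).edges

/-- The restriction of `P` to the copy `i` is a perfect matching of that copy. -/
def RestrictsTo (ccw : Bool) (r : ℤˣ) (i : Fin 2) (P : Finset (Sym2 PlanePoint)) : Prop :=
  (γ.copy ccw r i).IsPerfectMatching (γ.restrict ccw r i P)

/-- The normalized weight monomial, with respect to the copy `i`. -/
noncomputable def xBar (ccw : Bool) (r : ℤˣ) (i : Fin 2) (P : Finset (Sym2 PlanePoint)) : T.Field :=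
  T.weightMonomial (γ.snakeLoop ccw r) P /
    T.weightMonomial (γ.copy ccw r i) (γ.restrict ccw r i P)

/-- The normalized coefficient monomial, with respect to the copy `i`. -/
noncomputable def yBar (ccw : Bool) (r : ℤˣ) (i : Fin 2) (P : Finset (Sym2 PlanePoint)) : T.Field :=
  T.coeffMonomial (γ.snakeLoop ccw r) P /
    T.coeffMonomial (γ.copy ccw r i) (γ.restrict ccw r i P)

theorem deg_pos [Finite D] : 0 < γ.deg := by
  refine Function.minimalPeriod_pos_of_mem_periodicPts ?_
  exact T.rot.injective.mem_periodicPts _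

open Classical in
/-- The loop graph of the singly notched arc: the loop, at the last tile of the snake graph of the
hooked arc and the last tile of the snake graph of the plain arc, glues the two edges that
carry the side of the last triangle of the arc through which the hook first leaves it. -/
noncomputable def loopGraph [Finite D] (ccw : Bool) (r : ℤˣ) : LoopGraph D where
  toLabelledSnakeGraph := T.snakeGraph r (γ.len + γ.deg) (γ.hookedCross ccw)
  k := γ.len - 1
  hk := by
    have h1 := γ.len_pos
    have h2 := γ.deg_pos
    change γ.len - 1 + 1 < γ.len + γ.deg
    omega
  cut := if T.tileSide (r * (-1) ^ (γ.len + γ.deg - 1)) (γ.hookedCross ccw (γ.len + γ.deg - 1))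
      Side.N = γ.around ccw 0 then Side.N else Side.E
  hcut := by split_ifs <;> simp

end IdealTriangulation.SinglyNotchedArc

/-! A travel along a perfect matching of a snake graph meets the diagonals in the order of the
tiles, so a matching amounts to a direction, hence a sign, for each diagonal. Only neighbouring
tiles constrain each other (`Admissible`): if the curve leaves a triangle through the clockwise next
side, `p (i + 1)` implies `p i`; otherwise `p i` implies `p (i + 1)`. The relative orientation
cancels from this condition and from the sides carried by the matched edges (`carry`). Perfect
matchings and their monomials therefore depend only on the word of crossings and the signs, not on
the plane picture (`isPerfectMatching_signMatching_iff`, `weightMonomial_signMatching`,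
`coeffMonomial_signMatching`).

Write `k` for the number of crossings and `l` for the degree of the puncture, and count tiles from
0. Symmetry of a matching for the loop means `p (2 * k + l - 1 - i) = p i` for `i < k`
(`isSymmetricMatching_signMatching_iff`), so the first `k + l` signs determine it. Conversely,
admissible signs of the hooked arc extend by reflection exactly if the constraint between the tiles
`k + l - 1` and `k + l` holds with `p (k + l) = p (k - 1)`. This says that the matching of the
hooked snake graph contains `c` or `c'`. Good matchings of the loop graph are precisely such
matchings with one of `c`, `c'` erased (`isGoodMatching_iff`). Hence both sides of the bijection are
parametrized by the same signs.

A copy to divide by exists because the signs around the puncture are monotone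
(`IsLoopSign.restricts`). Both normalized coefficient monomials are the product over the first `k +
l` diagonals. For the weights, dividing by a copy leaves `k + l` edges, either those before the
second copy or those after the first; reflection compares the two products (`suffixWeight_mul`), and
the edge erased in the loop graph accounts for the difference (`weightMonomial_reduce`). Changing
the direction around the puncture reverses the loop, and the signs are read backwards. -/

/-- The level of a point of the plane; edges join points of consecutive levels. -/
def PlanePoint.level (v : PlanePoint) : ℤ := v.1 + v.2

/-! ### Perfect matchings of a snake graph as choices of directions for the diagonals. -/

namespace SnakeGraph

open PlanePoint

variable (G : SnakeGraph)

theorem level_corner {i : ℕ} (hi : i < G.len) :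
    level (G.corner i) = level (G.corner 0) + i := by
  induction i with
  | zero => simp
  | succ i ih =>
    have h := ih (by omega)
    simp only [level] at h ⊢
    rcases G.step i hi with h' | h' <;> rw [h'] <;> simp <;> omega

/-- The tile `i + 1` is to the right of the tile `i`. -/
def IsRight (i : ℕ) : Prop := G.corner (i + 1) = G.corner i + (1, 0)

theorem corner_succ_of_not_isRight {i : ℕ} (hi : i + 1 < G.len) (h : ¬ G.IsRight i) :
    G.corner (i + 1) = G.corner i + (0, 1) := (G.step i hi).resolve_left h

/-- The point from which the `m`-th matching edge of a travel departs, if `a i` tells whether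
the diagonal of the tile `i` is traversed downwards. -/
def dep (a : ℕ → Bool) : ℕ → PlanePoint
  | 0 => Tile.sw (G.corner 0)
  | m + 1 => if a m then Tile.se (G.corner m) else Tile.nw (G.corner m)

/-- The point at which the `m`-th matching edge of a travel arrives. -/
def arr (a : ℕ → Bool) (m : ℕ) : PlanePoint :=
  if m = G.len then Tile.ne (G.corner (G.len - 1))
  else if a m then Tile.nw (G.corner m) else Tile.se (G.corner m)

/-- The `m`-th matching edge of a travel. -/
def link (a : ℕ → Bool) (m : ℕ) : Sym2 PlanePoint := s(G.dep a m, G.arr a m)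

/-- The set of matching edges of a travel. -/
def matching (a : ℕ → Bool) : Finset (Sym2 PlanePoint) := (Finset.range (G.len + 1)).image (G.link a)

variable {G}

theorem mem_matching {a : ℕ → Bool} {e : Sym2 PlanePoint} :
    e ∈ G.matching a ↔ ∃ m ≤ G.len, G.link a m = e := by
  simp [matching]

theorem link_mem_matching (a : ℕ → Bool) {m : ℕ} (hm : m ≤ G.len) : G.link a m ∈ G.matching a :=
  mem_matching.2 ⟨m, hm, rfl⟩

theorem arr_of_lt (a : ℕ → Bool) {m : ℕ} (hm : m < G.len) :
    G.arr a m = if a m then Tile.nw (G.corner m) else Tile.se (G.corner m) := by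
  simp [arr, hm.ne]

theorem arr_len (a : ℕ → Bool) : G.arr a G.len = Tile.ne (G.corner (G.len - 1)) := by
  simp [arr]

theorem level_dep (a : ℕ → Bool) {m : ℕ} (hm : m ≤ G.len) :
    level (G.dep a m) = level (G.corner 0) + m := by
  cases m with
  | zero => simp [dep, Tile.sw]
  | succ m =>
    have h := G.level_corner (i := m) (by omega)
    simp only [dep, level] at h ⊢
    split_ifs <;> simp [Tile.se, Tile.nw] <;> omega

theorem level_arr (h0 : 0 < G.len) (a : ℕ → Bool) {m : ℕ} (hm : m ≤ G.len) :
    level (G.arr a m) = level (G.corner 0) + m + 1 := by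
  rcases hm.eq_or_lt with rfl | hm
  · have h := G.level_corner (i := G.len - 1) (by omega)
    rw [arr_len]
    simp only [level, Tile.ne] at h ⊢
    omega
  · have h := G.level_corner hm
    rw [arr_of_lt a hm]
    simp only [level] at h ⊢
    split_ifs <;> simp [Tile.se, Tile.nw] <;> omega

theorem arr_ne_dep (a : ℕ → Bool) {m : ℕ} (hm : m < G.len) : G.arr a m ≠ G.dep a (m + 1) := by
  rw [arr_of_lt a hm, dep]
  cases a m <;> simp [Tile.se, Tile.nw]

theorem mem_verts {v : PlanePoint} : v ∈ G.verts ↔ ∃ i < G.len,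
    v = Tile.sw (G.corner i) ∨ v = Tile.se (G.corner i) ∨ v = Tile.nw (G.corner i) ∨
      v = Tile.ne (G.corner i) := by
  simp [verts]

theorem mem_edges {e : Sym2 PlanePoint} :
    e ∈ G.edges ↔ ∃ i < G.len, ∃ s, Tile.edge (G.corner i) s = e := by
  simp [edges]

theorem edge_mem_edges {i : ℕ} (hi : i < G.len) (s : Side) :
    Tile.edge (G.corner i) s ∈ G.edges := mem_edges.2 ⟨i, hi, s, rfl⟩

/-- Apart from the south-west vertex of the first tile and the north-east vertex of the last one,
each vertex is an end of a diagonal, and a diagonal runs from an arrival to a departure. -/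
theorem exists_of_mem_verts (a : ℕ → Bool) {v : PlanePoint} (hv : v ∈ G.verts) :
    ∃ m ≤ G.len, v = G.dep a m ∨ v = G.arr a m := by
  obtain ⟨i, hi, h⟩ := mem_verts.1 hv
  have key : ∀ j < G.len, v = Tile.nw (G.corner j) ∨ v = Tile.se (G.corner j) →
      ∃ m ≤ G.len, v = G.dep a m ∨ v = G.arr a m := by
    intro j hj h
    cases haj : a j
    · rcases h with h | h
      · exact ⟨j + 1, hj, Or.inl (by simp [dep, haj, h])⟩
      · exact ⟨j, hj.le, Or.inr (by simp [arr_of_lt a hj, haj, h])⟩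
    · rcases h with h | h
      · exact ⟨j, hj.le, Or.inr (by simp [arr_of_lt a hj, haj, h])⟩
      · exact ⟨j + 1, hj, Or.inl (by simp [dep, haj, h])⟩
  rcases h with h | h | h | h
  · cases i with
    | zero => exact ⟨0, Nat.zero_le _, Or.inl h⟩
    | succ i =>
      refine key i (by omega) ?_
      rcases G.step i hi with h' | h' <;> rw [h, h']
      · right; simp [Tile.sw, Tile.se, Prod.ext_iff]
      · left; simp [Tile.sw, Tile.nw, Prod.ext_iff]
  · exact key i hi (Or.inr h)
  · exact key i hi (Or.inl h)
  · by_cases hl : i + 1 < G.len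
    · refine key (i + 1) hl ?_
      rcases G.step i hl with h' | h' <;> rw [h, h']
      · left; simp [Tile.ne, Tile.nw]
      · right; simp [Tile.ne, Tile.se]
    · refine ⟨G.len, le_rfl, Or.inr ?_⟩
      rw [arr_len, h]
      congr 2
      omega

theorem dep_mem_verts (h0 : 0 < G.len) (a : ℕ → Bool) {m : ℕ} (hm : m ≤ G.len) :
    G.dep a m ∈ G.verts := by
  rw [mem_verts]
  cases m with
  | zero => exact ⟨0, h0, Or.inl rfl⟩
  | succ m =>
    refine ⟨m, by omega, ?_⟩
    simp only [dep]
    split_ifs <;> simp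

theorem exists_level_of_mem_edges {e : Sym2 PlanePoint} (he : e ∈ G.edges) :
    ∃ u v, e = s(u, v) ∧ u ∈ G.verts ∧ v ∈ G.verts ∧ level v = level u + 1 := by
  obtain ⟨i, hi, s, rfl⟩ := mem_edges.1 he
  cases s
  · refine ⟨Tile.nw (G.corner i), Tile.ne (G.corner i), rfl, ?_, ?_, ?_⟩
    · exact mem_verts.2 ⟨i, hi, by simp⟩
    · exact mem_verts.2 ⟨i, hi, by simp⟩
    · simp [level, Tile.nw, Tile.ne]; ring
  · refine ⟨Tile.se (G.corner i), Tile.ne (G.corner i), rfl, ?_, ?_, ?_⟩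
    · exact mem_verts.2 ⟨i, hi, by simp⟩
    · exact mem_verts.2 ⟨i, hi, by simp⟩
    · simp [level, Tile.se, Tile.ne]; ring
  · refine ⟨Tile.sw (G.corner i), Tile.se (G.corner i), rfl, ?_, ?_, ?_⟩
    · exact mem_verts.2 ⟨i, hi, by simp⟩
    · exact mem_verts.2 ⟨i, hi, by simp⟩
    · simp [level, Tile.se, Tile.sw]; ring
  · refine ⟨Tile.sw (G.corner i), Tile.nw (G.corner i), rfl, ?_, ?_, ?_⟩
    · exact mem_verts.2 ⟨i, hi, by simp⟩
    · exact mem_verts.2 ⟨i, hi, by simp⟩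
    · simp [level, Tile.sw, Tile.nw]; ring

theorem mem_verts_of_mem {e : Sym2 PlanePoint} (he : e ∈ G.edges) {v : PlanePoint} (hv : v ∈ e) :
    v ∈ G.verts := by
  obtain ⟨u, w, rfl, hu, hw, -⟩ := exists_level_of_mem_edges he
  rcases Sym2.mem_iff.1 hv with rfl | rfl <;> assumption

theorem level_of_mk_mem_edges {u v : PlanePoint} (he : s(u, v) ∈ G.edges) :
    level v = level u + 1 ∨ level u = level v + 1 := by
  obtain ⟨u', v', h, -, -, hl⟩ := exists_level_of_mem_edges he
  rcases Sym2.eq_iff.1 h with ⟨rfl, rfl⟩ | ⟨rfl, rfl⟩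
  · exact Or.inl hl
  · exact Or.inr hl

/-- A level strictly between the lowest and the highest contains only the two ends of one diagonal,
one of them an arrival and the other a departure. -/
theorem dep_or_arr_of_level (h0 : 0 < G.len) (a : ℕ → Bool) {v : PlanePoint} (hv : v ∈ G.verts)
    {m : ℕ} (hl : level v = level (G.corner 0) + m) :
    (m ≤ G.len ∧ v = G.dep a m) ∨ ∃ j, j + 1 = m ∧ j ≤ G.len ∧ v = G.arr a j := by
  obtain ⟨j, hj, rfl | rfl⟩ := exists_of_mem_verts a hv
  · rw [level_dep a hj] at hl
    obtain rfl : j = m := by omega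
    exact Or.inl ⟨hj, rfl⟩
  · rw [level_arr h0 a hj] at hl
    exact Or.inr ⟨j, by omega, hj, rfl⟩

theorem eq_of_mem_link (h0 : 0 < G.len) (a : ℕ → Bool) {v : PlanePoint} {m m' : ℕ}
    (hm : m ≤ G.len) (hm' : m' ≤ G.len) (h : v ∈ G.link a m) (h' : v ∈ G.link a m') : m = m' := by
  have l1 := level_dep a hm
  have l2 := level_dep a hm'
  have l3 := level_arr h0 a hm
  have l4 := level_arr h0 a hm'
  rcases Sym2.mem_iff.1 h with h | h <;> rcases Sym2.mem_iff.1 h' with h' | h' <;>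
    subst h
  · rw [h'] at l1; omega
  · rw [h'] at l1
    obtain rfl : m = m' + 1 := by omega
    exact absurd h'.symm (arr_ne_dep a (by omega))
  · rw [h'] at l3
    obtain rfl : m' = m + 1 := by omega
    exact absurd h' (arr_ne_dep a (by omega))
  · rw [h'] at l3; omega

theorem link_eq_mk (h0 : 0 < G.len) (a : ℕ → Bool) {m : ℕ} (hm : m ≤ G.len) {u v : PlanePoint}
    (huv : level v = level u + 1) (h : G.link a m = s(u, v)) :
    level u = level (G.corner 0) + m ∧ G.dep a m = u ∧ G.arr a m = v := by
  have l1 := level_dep a hm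
  have l2 := level_arr h0 a hm
  rcases Sym2.eq_iff.1 h with ⟨rfl, rfl⟩ | ⟨rfl, rfl⟩
  · exact ⟨l1, rfl, rfl⟩
  · omega

theorem link_eq_link (h0 : 0 < G.len) {a a' : ℕ → Bool} {m m' : ℕ} (hm : m ≤ G.len)
    (hm' : m' ≤ G.len) (h : G.link a m = G.link a' m') :
    m = m' ∧ G.dep a m = G.dep a' m ∧ G.arr a m = G.arr a' m := by
  have l1 := level_dep a' hm'
  have l2 := level_arr h0 a' hm'
  obtain ⟨h1, h2, h3⟩ := link_eq_mk h0 a hm (by omega) h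
  obtain rfl : m = m' := by omega
  exact ⟨rfl, h2, h3⟩

theorem link_injOn (h0 : 0 < G.len) (a : ℕ → Bool) :
    Set.InjOn (G.link a) (Finset.range (G.len + 1)) := by
  intro m hm m' hm' h
  simp only [Finset.coe_range, Set.mem_Iio, Nat.lt_succ_iff] at hm hm'
  exact (link_eq_link h0 hm hm' h).1

theorem arr_eq_nw_iff (a : ℕ → Bool) {i : ℕ} (hi : i < G.len) :
    G.arr a i = Tile.nw (G.corner i) ↔ a i = true := by
  rw [arr_of_lt a hi]
  cases a i <;> simp [Tile.nw, Tile.se]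

theorem arr_eq_se_iff (a : ℕ → Bool) {i : ℕ} (hi : i < G.len) :
    G.arr a i = Tile.se (G.corner i) ↔ a i = false := by
  rw [arr_of_lt a hi]
  cases a i <;> simp [Tile.nw, Tile.se]

theorem dep_eq_nw_iff (a : ℕ → Bool) {i : ℕ} :
    G.dep a (i + 1) = Tile.nw (G.corner i) ↔ a i = false := by
  rw [dep]
  cases a i <;> simp [Tile.nw, Tile.se]

theorem dep_eq_se_iff (a : ℕ → Bool) {i : ℕ} :
    G.dep a (i + 1) = Tile.se (G.corner i) ↔ a i = true := by
  rw [dep]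
  cases a i <;> simp [Tile.nw, Tile.se]

theorem matching_injective (h0 : 0 < G.len) {a a' : ℕ → Bool} (h : G.matching a = G.matching a')
    {i : ℕ} (hi : i < G.len) : a i = a' i := by
  have h1 := link_mem_matching a hi.le
  rw [h] at h1
  obtain ⟨m, hm, h2⟩ := mem_matching.1 h1
  have h3 := (link_eq_link h0 hi.le hm h2.symm).2.2
  rw [Bool.eq_iff_iff, ← arr_eq_nw_iff a hi, ← arr_eq_nw_iff a' hi, h3]

theorem matching_congr {a a' : ℕ → Bool} (h : ∀ i < G.len, a i = a' i) :
    G.matching a = G.matching a' := by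
  refine Finset.image_congr fun m hm => ?_
  simp only [Finset.coe_range, Set.mem_Iio, Nat.lt_succ_iff] at hm
  have h1 : G.dep a m = G.dep a' m := by
    cases m with
    | zero => rfl
    | succ m => simp only [dep]; rw [h m (by omega)]
  have h2 : G.arr a m = G.arr a' m := by
    rcases hm.eq_or_lt with rfl | hm
    · rw [arr_len, arr_len]
    · rw [arr_of_lt a hm, arr_of_lt a' hm, h m hm]
  rw [link, link, h1, h2]

theorem isPerfectMatching_matching (h0 : 0 < G.len) {a : ℕ → Bool}
    (h : ∀ m ≤ G.len, G.link a m ∈ G.edges) : G.IsPerfectMatching (G.matching a) := by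
  refine ⟨fun e he => ?_, fun v hv => ?_⟩
  · obtain ⟨m, hm, rfl⟩ := mem_matching.1 he
    exact h m hm
  · obtain ⟨m, hm, hv⟩ := exists_of_mem_verts a hv
    have hv' : v ∈ G.link a m := Sym2.mem_iff.2 hv
    refine ⟨G.link a m, ⟨link_mem_matching a hm, hv'⟩, ?_⟩
    rintro e ⟨he, hve⟩
    obtain ⟨m', hm', rfl⟩ := mem_matching.1 he
    rw [eq_of_mem_link h0 a hm hm' hv' hve]

theorem IsPerfectMatching.eq_of_mem {P : Finset (Sym2 PlanePoint)} (hP : G.IsPerfectMatching P)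
    {e f : Sym2 PlanePoint} (he : e ∈ P) (hf : f ∈ P) {v : PlanePoint} (hve : v ∈ e)
    (hvf : v ∈ f) : e = f :=
  (hP.2 v (mem_verts_of_mem (hP.1 he) hve)).unique ⟨he, hve⟩ ⟨hf, hvf⟩

/-- The travel is built by induction: the vertices of lower level are already matched, so each
departure must be matched upwards, and there only one end of the next diagonal is possible. -/
theorem IsPerfectMatching.exists_matching (h0 : 0 < G.len) {P : Finset (Sym2 PlanePoint)}
    (hP : G.IsPerfectMatching P) : ∃ a, P = G.matching a := by
  classical
  -- The travel goes down the diagonal `i` if it reaches its north-west end first, that is, if this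
  -- end is matched to a vertex of lower level.
  let a : ℕ → Bool := fun i => decide (∃ u, level u < level (Tile.nw (G.corner i)) ∧
    s(u, Tile.nw (G.corner i)) ∈ P)
  have key : ∀ m ≤ G.len, G.link a m ∈ P := by
    intro m
    induction m using Nat.strong_induction_on with
    | _ m ih =>
    intro hm
    obtain ⟨e, ⟨he, hde⟩, -⟩ := hP.2 _ (dep_mem_verts h0 a hm)
    obtain ⟨u, rfl⟩ := hde
    have hu : u ∈ G.verts := mem_verts_of_mem (hP.1 he) (Sym2.mem_mk_right _ _)
    have hd : G.dep a m ∈ G.link a m := Sym2.mem_mk_left _ _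
    -- The ends of earlier links are taken, so `dep a m` is not matched to them.
    have back : ∀ u' j, j < m → u' ∈ G.link a j → s(u', G.dep a m) ∉ P := by
      intro u' j hj hu' h
      have h1 := hP.eq_of_mem h (ih j hj (by omega)) (Sym2.mem_mk_left _ _) hu'
      have h2 : G.dep a m ∈ G.link a j := h1 ▸ Sym2.mem_mk_right _ _
      have := eq_of_mem_link h0 a hm (by omega) hd h2
      omega
    have ld := level_dep a hm
    rcases level_of_mk_mem_edges (hP.1 he) with hl | hl
    · rcases dep_or_arr_of_level h0 a hu (m := m + 1) (by push_cast; omega) with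
        ⟨hm1, rfl⟩ | ⟨j, hj, hjl, rfl⟩
      -- Here `dep a m` would be matched to the end of the diagonal `m` that `a m` declares to be
      -- the second one. If it is the north-west end, this contradicts the definition of `a`; if
      -- not, the north-west end has no free partner below it.
      · exfalso
        cases ha : a m
        · have h1 := (dep_eq_nw_iff (G := G) a (i := m)).2 ha
          rw [h1] at he hl
          have : a m = true := decide_eq_true ⟨_, by omega, he⟩
          simp [this] at ha
        · obtain ⟨u', hu', he'⟩ := of_decide_eq_true ha
          have h1 := (arr_eq_nw_iff (G := G) a (i := m) hm1).2 ha
          have la := level_arr h0 a hm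
          rw [← h1] at hu' he'
          have hu'v : u' ∈ G.verts := mem_verts_of_mem (hP.1 he') (Sym2.mem_mk_left _ _)
          have hl' := level_of_mk_mem_edges (hP.1 he')
          rcases dep_or_arr_of_level h0 a hu'v (m := m) (by omega) with
            ⟨-, rfl⟩ | ⟨j, hj, hjl, rfl⟩
          · have h2 := hP.eq_of_mem he he' (Sym2.mem_mk_left _ _) (Sym2.mem_mk_left _ _)
            rcases Sym2.eq_iff.1 h2 with ⟨-, h3⟩ | ⟨h3, h4⟩
            · exact arr_ne_dep a hm1 h3.symm
            · rw [h3] at ld; omega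
          · have h1 := hP.eq_of_mem he' (ih j (by omega) (by omega)) (Sym2.mem_mk_left _ _)
              (Sym2.mem_mk_right _ _)
            have h2 : G.arr a m ∈ G.link a j := h1 ▸ Sym2.mem_mk_right _ _
            have := eq_of_mem_link h0 a hm (by omega) (Sym2.mem_mk_right _ _) h2
            omega
      · obtain rfl : j = m := by omega
        exact he
    · exfalso
      rw [Sym2.eq_swap] at he
      have hm0 : m ≠ 0 := by
        rintro rfl
        obtain ⟨j, hj, rfl | rfl⟩ := exists_of_mem_verts a hu
        · have := level_dep a hj; push_cast at *; omega
        · have := level_arr h0 a hj; push_cast at *; omega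
      rcases dep_or_arr_of_level h0 a hu (m := m - 1) (by omega) with
        ⟨hm1, rfl⟩ | ⟨j, hj, hjl, rfl⟩
      · exact back _ (m - 1) (by omega) (Sym2.mem_mk_left _ _) he
      · exact back _ j (by omega) (Sym2.mem_mk_right _ _) he
  refine ⟨a, Finset.Subset.antisymm (fun f hf => ?_) (fun f hf => ?_)⟩
  · obtain ⟨u, v, rfl, hu, -, -⟩ := exists_level_of_mem_edges (hP.1 hf)
    obtain ⟨m, hm, h⟩ := exists_of_mem_verts a hu
    rw [hP.eq_of_mem hf (key m hm) (Sym2.mem_mk_left _ _) (Sym2.mem_iff.2 h)]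
    exact link_mem_matching a hm
  · obtain ⟨m, hm, rfl⟩ := mem_matching.1 hf
    exact key m hm

/-! ### Travels -/

/-- The travel is forced: a departure lies on one edge of the matching, and an arrival lies on one
diagonal. -/
theorem isTravel_iff {a : ℕ → Bool} (hP : G.IsPerfectMatching (G.matching a))
    {v : ℕ → PlanePoint} : G.IsTravel (G.matching a) v ↔
      ∀ m ≤ G.len, v (2 * m) = G.dep a m ∧ v (2 * m + 1) = G.arr a m := by
  have diag : ∀ i < G.len, s(G.arr a i, G.dep a (i + 1)) =
      s(Tile.nw (G.corner i), Tile.se (G.corner i)) := by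
    intro i hi
    rw [arr_of_lt a hi, dep]
    cases a i
    · simp
    · simp
  constructor
  · rintro ⟨h1, h2, h3, h4⟩ m
    have step : ∀ m ≤ G.len, v (2 * m) = G.dep a m → v (2 * m + 1) = G.arr a m := by
      intro m hm h
      have h5 := h2 m hm
      have h6 := hP.eq_of_mem h5 (link_mem_matching a hm) (Sym2.mem_mk_left _ _)
        (h ▸ Sym2.mem_mk_left _ _)
      rw [link, h] at h6
      exact Sym2.congr_right.1 h6
    induction m with
    | zero => exact fun hm => ⟨h1, step 0 hm h1⟩
    | succ m ih =>
      intro hm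
      have h5 := (ih (by omega)).2
      have h6 := h3 m (by omega)
      rw [← diag m (by omega), h5] at h6
      have h7 : v (2 * (m + 1)) = G.dep a (m + 1) := Sym2.congr_right.1 h6
      exact ⟨h7, step _ hm h7⟩
  · intro h
    refine ⟨(h 0 (Nat.zero_le _)).1, fun i hi => ?_, fun i hi => ?_, ?_⟩
    · rw [(h i hi).1, (h i hi).2]
      exact link_mem_matching a hi
    · rw [(h i hi.le).2, ← diag i hi]
      have := (h (i + 1) hi).1
      rw [show 2 * i + 2 = 2 * (i + 1) by ring, this]
    · rw [(h G.len le_rfl).2, arr_len]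

theorem exists_isTravel {a : ℕ → Bool}
    (hP : G.IsPerfectMatching (G.matching a)) : ∃ v, G.IsTravel (G.matching a) v := by
  refine ⟨fun n => if n % 2 = 0 then G.dep a (n / 2) else G.arr a (n / 2),
    (isTravel_iff hP).2 fun m _ => ⟨?_, ?_⟩⟩
  · simp
  · have h1 : (2 * m + 1) % 2 = 1 := by omega
    have h2 : (2 * m + 1) / 2 = m := by omega
    simp [h1, h2]

theorem isDown_matching {a : ℕ → Bool}
    (hP : G.IsPerfectMatching (G.matching a)) {j : ℕ} (hj : j < G.len) :
    G.IsDown (G.matching a) j ↔ a j = true := by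
  constructor
  · rintro ⟨v, hv, h1, -⟩
    rw [((isTravel_iff hP).1 hv j hj.le).2] at h1
    exact (arr_eq_nw_iff a hj).1 h1
  · intro h
    obtain ⟨v, hv⟩ := exists_isTravel hP
    have h1 := (isTravel_iff hP).1 hv
    exact ⟨v, hv, (h1 j hj.le).2.trans ((arr_eq_nw_iff a hj).2 h),
      (h1 (j + 1) hj).1.trans ((dep_eq_se_iff a).2 h)⟩

theorem isUp_matching {a : ℕ → Bool}
    (hP : G.IsPerfectMatching (G.matching a)) {j : ℕ} (hj : j < G.len) :
    G.IsUp (G.matching a) j ↔ a j = false := by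
  constructor
  · rintro ⟨v, hv, h1, -⟩
    rw [((isTravel_iff hP).1 hv j hj.le).2] at h1
    exact (arr_eq_se_iff a hj).1 h1
  · intro h
    obtain ⟨v, hv⟩ := exists_isTravel hP
    have h1 := (isTravel_iff hP).1 hv
    exact ⟨v, hv, (h1 j hj.le).2.trans ((arr_eq_se_iff a hj).2 h),
      (h1 (j + 1) hj).1.trans ((dep_eq_nw_iff a).2 h)⟩

/-! ### Edges of tiles in the matching of a travel -/

theorem dep_eq_sw_iff (a : ℕ → Bool) {i : ℕ} (hi : i + 1 < G.len) :
    G.dep a (i + 1) = Tile.sw (G.corner (i + 1)) ↔ (G.IsRight i ↔ a i = true) := by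
  by_cases h : G.IsRight i
  · have h' := h
    rw [IsRight] at h'
    rw [dep, h']
    cases a i <;> simp [h, Tile.sw, Tile.nw, Tile.se, Prod.ext_iff]
  · rw [dep, corner_succ_of_not_isRight G hi h]
    cases a i <;> simp [h, Tile.sw, Tile.nw, Tile.se, Prod.ext_iff]

theorem arr_eq_ne_iff (a : ℕ → Bool) {i : ℕ} (hi : i + 1 < G.len) :
    G.arr a (i + 1) = Tile.ne (G.corner i) ↔ (G.IsRight i ↔ a (i + 1) = true) := by
  by_cases h : G.IsRight i
  · have h' := h
    rw [IsRight] at h'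
    rw [arr_of_lt a hi, h']
    cases a (i + 1) <;> simp [h, Tile.ne, Tile.nw, Tile.se, Prod.ext_iff]
  · rw [arr_of_lt a hi, corner_succ_of_not_isRight G hi h]
    cases a (i + 1) <;> simp [h, Tile.ne, Tile.nw, Tile.se, Prod.ext_iff]

theorem mk_mem_matching_iff (h0 : 0 < G.len) (a : ℕ → Bool) {m : ℕ} (hm : m ≤ G.len)
    {u v : PlanePoint} (hu : level u = level (G.corner 0) + m) (hv : level v = level u + 1) :
    s(u, v) ∈ G.matching a ↔ G.dep a m = u ∧ G.arr a m = v := by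
  constructor
  · intro h
    obtain ⟨m', hm', h1⟩ := mem_matching.1 h
    obtain ⟨h2, h3, h4⟩ := link_eq_mk h0 a hm' hv h1
    obtain rfl : m = m' := by omega
    exact ⟨h3, h4⟩
  · rintro ⟨rfl, rfl⟩
    exact link_mem_matching a hm

theorem edge_N_mem_matching (a : ℕ → Bool) {i : ℕ} (hi : i < G.len) :
    Tile.edge (G.corner i) .N ∈ G.matching a ↔
      a i = false ∧ G.arr a (i + 1) = Tile.ne (G.corner i) := by
  have hl := G.level_corner hi
  rw [Tile.edge, mk_mem_matching_iff (m := i + 1) (by omega) a hi, dep_eq_nw_iff]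
  · simp [level, Tile.nw] at hl ⊢; omega
  · simp [level, Tile.nw, Tile.ne] at hl ⊢; omega

theorem edge_E_mem_matching (a : ℕ → Bool) {i : ℕ} (hi : i < G.len) :
    Tile.edge (G.corner i) .E ∈ G.matching a ↔
      a i = true ∧ G.arr a (i + 1) = Tile.ne (G.corner i) := by
  have hl := G.level_corner hi
  rw [Tile.edge, mk_mem_matching_iff (m := i + 1) (by omega) a hi, dep_eq_se_iff]
  · simp [level, Tile.se] at hl ⊢; omega
  · simp [level, Tile.se, Tile.ne] at hl ⊢; omega

theorem edge_S_mem_matching (a : ℕ → Bool) {i : ℕ} (hi : i < G.len) :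
    Tile.edge (G.corner i) .S ∈ G.matching a ↔
      a i = false ∧ G.dep a i = Tile.sw (G.corner i) := by
  have hl := G.level_corner hi
  rw [Tile.edge, mk_mem_matching_iff (m := i) (by omega) a hi.le, arr_eq_se_iff a hi, and_comm]
  · simpa [level, Tile.sw] using hl
  · simp [level, Tile.se, Tile.sw] at hl ⊢; omega

theorem edge_W_mem_matching (a : ℕ → Bool) {i : ℕ} (hi : i < G.len) :
    Tile.edge (G.corner i) .W ∈ G.matching a ↔
      a i = true ∧ G.dep a i = Tile.sw (G.corner i) := by
  have hl := G.level_corner hi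
  rw [Tile.edge, mk_mem_matching_iff (m := i) (by omega) a hi.le, arr_eq_nw_iff a hi, and_comm]
  · simpa [level, Tile.sw] using hl
  · simp [level, Tile.nw, Tile.sw] at hl ⊢; omega

theorem link_eq_of_dep (a : ℕ → Bool) {i : ℕ} (hi : i < G.len)
    (h : G.dep a i = Tile.sw (G.corner i)) :
    G.link a i = Tile.edge (G.corner i) (if a i then .W else .S) := by
  rw [link, h, arr_of_lt a hi]
  cases a i <;> rfl

theorem link_eq_of_arr (a : ℕ → Bool) {i : ℕ}
    (h : G.arr a (i + 1) = Tile.ne (G.corner i)) :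
    G.link a (i + 1) = Tile.edge (G.corner i) (if a i then .E else .N) := by
  rw [link, h, dep]
  cases a i <;> rfl

theorem mk_add_mem_edges {u v : PlanePoint} (h : s(u, v) ∈ G.edges) :
    v = u + (1, 0) ∨ v = u + (0, 1) ∨ u = v + (1, 0) ∨ u = v + (0, 1) := by
  obtain ⟨i, hi, s, h⟩ := mem_edges.1 h
  cases s <;> rcases Sym2.eq_iff.1 h with ⟨rfl, rfl⟩ | ⟨rfl, rfl⟩ <;>
    simp [Tile.nw, Tile.se, Tile.ne, Tile.sw, Prod.ext_iff]

/-- The link `i + 1` is an edge once it departs from the south-west vertex of the tile `i + 1` or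
arrives at the north-east vertex of the tile `i`. If both fail, its ends are the two extreme points
of the domino formed by the two tiles, which differ by `(2, -1)` up to order of coordinates and
sign. -/
theorem link_mem_edges_iff (h0 : 0 < G.len) (a : ℕ → Bool) :
    (∀ m ≤ G.len, G.link a m ∈ G.edges) ↔
      ∀ i, i + 1 < G.len → (G.IsRight i ↔ a i = true) ∨ (G.IsRight i ↔ a (i + 1) = true) := by
  constructor
  · intro h i hi
    have h1 := mk_add_mem_edges (h (i + 1) hi.le)
    by_contra hc
    push Not at hc
    by_cases hr : G.IsRight i
    · have h3 : a i = false := by simpa [hr] using hc.1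
      have h4 : a (i + 1) = false := by simpa [hr] using hc.2
      rw [arr_of_lt a hi, dep, h3, h4] at h1
      rw [IsRight] at hr
      rw [hr] at h1
      simp [Tile.nw, Tile.se, Prod.ext_iff] at h1
      omega
    · have h3 : a i = true := by simpa [hr] using hc.1
      have h4 : a (i + 1) = true := by simpa [hr] using hc.2
      rw [arr_of_lt a hi, dep, h3, h4, corner_succ_of_not_isRight G hi hr] at h1
      simp [Tile.nw, Tile.se, Prod.ext_iff] at h1
      omega
  · intro h m hm
    rcases Nat.eq_zero_or_pos m with rfl | hm0
    · rw [link_eq_of_dep a h0 rfl]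
      exact edge_mem_edges h0 _
    · obtain ⟨i, rfl⟩ : ∃ i, m = i + 1 := ⟨m - 1, by omega⟩
      rcases hm.eq_or_lt with hm | hm
      · rw [link_eq_of_arr a (by rw [hm, arr_len, ← hm]; simp)]
        exact edge_mem_edges (by omega) _
      · rcases h i hm with h | h
        · rw [link_eq_of_dep a hm ((dep_eq_sw_iff a hm).2 h)]
          exact edge_mem_edges hm _
        · rw [link_eq_of_arr a ((arr_eq_ne_iff a hm).2 h)]
          exact edge_mem_edges (by omega) _

end SnakeGraph

/-! ### From directions to signs: admissibility and weights without the plane embedding. -/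

namespace IdealTriangulation

variable {D : Type*} (T : IdealTriangulation D)

theorem next_next_ne (d : D) : T.next (T.next d) ≠ d := by
  intro h
  have h1 := T.next_next_next d
  rw [h] at h1
  exact T.next_ne d h1

/-- The side on the lower edge of the matching at a tile with diagonal `d` which is positive exactly
if `p` holds, provided that such an edge exists. -/
def lowerSide (d : D) (p : Bool) : D := if p then T.next (T.next d) else T.next d

/-- The side on the upper edge of the matching at a tile with diagonal `d` which is positive exactly
if `p` holds, provided that such an edge exists. -/
def upperSide (d : D) (p : Bool) : D := T.lowerSide (T.glue d) p

theorem lowerSide_inj {d : D} {p q : Bool} : T.lowerSide d p = T.lowerSide d q ↔ p = q := by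
  cases p <;> cases q <;> simp [lowerSide, T.next_ne, (T.next_ne _).symm]

/-- After the crossing `i` the curve leaves the triangle through the side that follows clockwise
the one through which it entered. -/
def Turns (w : ℕ → D) (i : ℕ) : Prop := w (i + 1) = T.next (T.glue (w i))

/-- Compatibility of the signs of the diagonals in a snake graph of a curve with crossings `w`. -/
def Admissible (w : ℕ → D) (n : ℕ) (p : ℕ → Bool) : Prop :=
  ∀ i, i + 1 < n → (T.Turns w i ↔ p i = true) ∨ (T.Turns w i ↔ p (i + 1) = false)

open Classical in
/-- The side carried by the `m`-th edge of a matching in the order of its travel. -/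
noncomputable def carry (w : ℕ → D) (n : ℕ) (p : ℕ → Bool) (m : ℕ) : D :=
  if m = 0 then T.lowerSide (w 0) (p 0)
  else if m = n then T.upperSide (w (n - 1)) (p (n - 1))
  else if T.Turns w (m - 1) ↔ p (m - 1) = true then T.lowerSide (w m) (p m)
  else T.upperSide (w (m - 1)) (p (m - 1))

/-- The labelled snake graph `G` is built of the tiles of crossings through its diagonals. -/
structure IsTiled (G : LabelledSnakeGraph D) : Prop where
  turn : ∀ i, i + 1 < G.len → G.diag (i + 1) = T.next (T.glue (G.diag i)) ∨
    G.diag (i + 1) = T.next (T.next (T.glue (G.diag i)))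
  rel_succ : ∀ i, i + 1 < G.len → G.rel (i + 1) = -G.rel i
  corner_succ : ∀ i, i + 1 < G.len →
    G.corner (i + 1) = G.corner i + T.tileStep (G.rel i) (G.diag i) (G.diag (i + 1))

end IdealTriangulation

namespace LabelledSnakeGraph

variable {D : Type*} (G : LabelledSnakeGraph D)

/-- The diagonals that are traversed downwards if `p` gives the signs of the diagonals (and
conversely). -/
def down (p : ℕ → Bool) (i : ℕ) : Bool := p i == decide (G.rel i = 1)

theorem down_eq_true {p : ℕ → Bool} {i : ℕ} : G.down p i = true ↔ (p i = true ↔ G.rel i = 1) := by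
  simp only [down]
  by_cases h : G.rel i = 1 <;> simp [h]

theorem down_down (p : ℕ → Bool) : G.down (G.down p) = p := by
  funext i
  simp only [down]
  by_cases h : G.rel i = 1 <;> simp [h]

/-- The set of edges of the travel along the diagonals with signs `p`. -/
def signMatching (p : ℕ → Bool) : Finset (Sym2 PlanePoint) := G.matching (G.down p)

theorem signMatching_congr {p q : ℕ → Bool} (h : ∀ i < G.len, p i = q i) :
    G.signMatching p = G.signMatching q :=
  SnakeGraph.matching_congr fun i hi => by rw [down, down, h i hi]

theorem signMatching_injective (h0 : 0 < G.len) {p q : ℕ → Bool}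
    (h : G.signMatching p = G.signMatching q) {i : ℕ} (hi : i < G.len) : p i = q i := by
  have h1 := SnakeGraph.matching_injective h0 h hi
  simp only [down] at h1
  revert h1
  cases p i <;> cases q i <;> cases decide (G.rel i = 1) <;> simp

variable {G}

theorem isPositive_signMatching {p : ℕ → Bool}
    (hP : G.IsPerfectMatching (G.signMatching p)) {j : ℕ} (hj : j < G.len) :
    G.IsPositive (G.signMatching p) j ↔ p j = true := by
  have h1 := G.down_eq_true (p := p) (i := j)
  rw [IsPositive, signMatching, SnakeGraph.isDown_matching hP hj, SnakeGraph.isUp_matching hP hj,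
    ← Bool.not_eq_true, h1]
  rcases Int.units_eq_one_or (G.rel j) with h | h <;> simp [h]

end LabelledSnakeGraph

namespace IdealTriangulation

open PlanePoint SnakeGraph LabelledSnakeGraph

variable {D : Type*} {T : IdealTriangulation D} {G : LabelledSnakeGraph D}

namespace IsTiled

/-- The next tile lies to the right if the next crossing is on the North edge, and North carries the
clockwise next side exactly if `rel` is `1`. -/
theorem isRight_iff (hG : T.IsTiled G) {i : ℕ} (hi : i + 1 < G.len) :
    G.IsRight i ↔ (T.Turns G.diag i ↔ G.rel i = 1) := by
  rw [IsRight, hG.corner_succ i hi, Turns, tileStep]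
  have h1 := T.next_ne (T.next (T.glue (G.diag i)))
  rcases Int.units_eq_one_or (G.rel i) with h | h <;> rcases hG.turn i hi with h' | h' <;>
    simp [h, h', tileSide, h1, h1.symm]

theorem dep_eq_sw_iff (hG : T.IsTiled G) (p : ℕ → Bool) {i : ℕ} (hi : i + 1 < G.len) :
    G.dep (G.down p) (i + 1) = Tile.sw (G.corner (i + 1)) ↔
      (T.Turns G.diag i ↔ p i = true) := by
  rw [SnakeGraph.dep_eq_sw_iff _ hi, hG.isRight_iff hi, G.down_eq_true]
  tauto

theorem arr_eq_ne_iff (hG : T.IsTiled G) (p : ℕ → Bool) {i : ℕ} (hi : i + 1 < G.len) :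
    G.arr (G.down p) (i + 1) = Tile.ne (G.corner i) ↔
      (T.Turns G.diag i ↔ p (i + 1) = false) := by
  rw [SnakeGraph.arr_eq_ne_iff _ hi, hG.isRight_iff hi, G.down_eq_true, hG.rel_succ i hi,
    ← Bool.not_eq_true]
  rcases Int.units_eq_one_or (G.rel i) with h | h <;> cases p (i + 1) <;> simp [h]

/-- The orientation enters both the placement of the next tile and the passage from signs to
directions, and cancels. The alternation of `rel` turns the condition on the later tile into `p (i +
1) = false`. -/
theorem isPerfectMatching_signMatching_iff (hG : T.IsTiled G) (h0 : 0 < G.len) (p : ℕ → Bool) :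
    G.IsPerfectMatching (G.signMatching p) ↔ T.Admissible G.diag G.len p := by
  have h1 : (∀ m ≤ G.len, G.link (G.down p) m ∈ G.edges) ↔ T.Admissible G.diag G.len p := by
    rw [link_mem_edges_iff h0]
    refine forall_congr' fun i => forall_congr' fun hi => ?_
    rw [← SnakeGraph.dep_eq_sw_iff _ hi, ← SnakeGraph.arr_eq_ne_iff _ hi, hG.dep_eq_sw_iff p hi,
      hG.arr_eq_ne_iff p hi]
  rw [← h1]
  exact ⟨fun h m hm => h.1 (link_mem_matching _ hm), fun h => isPerfectMatching_matching h0 h⟩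

/-- The values of `p` beyond the last tile do not affect the matching; fixing them makes `p` unique.
-/
theorem exists_signMatching (hG : T.IsTiled G) (h0 : 0 < G.len) {P : Finset (Sym2 PlanePoint)}
    (hP : G.IsPerfectMatching P) :
    ∃ p, T.Admissible G.diag G.len p ∧ (∀ i, G.len ≤ i → p i = false) ∧
      P = G.signMatching p := by
  obtain ⟨a, rfl⟩ := hP.exists_matching h0
  have h : G.matching a = G.signMatching (fun i => if i < G.len then G.down a i else false) := by
    have h1 : G.matching a = G.signMatching (G.down a) := by rw [signMatching, down_down]
    rw [h1]
    exact signMatching_congr G fun i hi => (if_pos hi).symm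
  refine ⟨_, ?_, fun i hi => if_neg (by omega), h⟩
  rw [← hG.isPerfectMatching_signMatching_iff h0, ← h]
  exact hP

/-- A travel uses a lower edge of a tile only when it departs from its south-west vertex. The sign
then selects the side of the triangle, while `rel` decides whether this side is drawn South or West.
-/
theorem edge_mem_signMatching_of_lower {p : ℕ → Bool} {i : ℕ} (hi : i < G.len) {s : Side}
    (hs : s = .S ∨ s = .W) : Tile.edge (G.corner i) s ∈ G.signMatching p ↔
      T.tileSide (G.rel i) (G.diag i) s = T.lowerSide (G.diag i) (p i) ∧
        G.dep (G.down p) i = Tile.sw (G.corner i) := by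
  have h1 := T.next_ne (T.next (G.diag i))
  rw [signMatching]
  rcases hs with rfl | rfl
  · rw [edge_S_mem_matching _ hi, ← Bool.not_eq_true, G.down_eq_true]
    refine and_congr_left fun _ => ?_
    rcases Int.units_eq_one_or (G.rel i) with h | h <;> cases p i <;>
      simp [h, tileSide, lowerSide, h1, h1.symm]
  · rw [edge_W_mem_matching _ hi, G.down_eq_true]
    refine and_congr_left fun _ => ?_
    rcases Int.units_eq_one_or (G.rel i) with h | h <;> cases p i <;>
      simp [h, tileSide, lowerSide, h1, h1.symm]

theorem edge_mem_signMatching_of_upper {p : ℕ → Bool} {i : ℕ} (hi : i < G.len) {s : Side}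
    (hs : s = .N ∨ s = .E) : Tile.edge (G.corner i) s ∈ G.signMatching p ↔
      T.tileSide (G.rel i) (G.diag i) s = T.upperSide (G.diag i) (p i) ∧
        G.arr (G.down p) (i + 1) = Tile.ne (G.corner i) := by
  have h1 := T.next_ne (T.next (T.glue (G.diag i)))
  rw [signMatching]
  rcases hs with rfl | rfl
  · rw [edge_N_mem_matching _ hi, ← Bool.not_eq_true, G.down_eq_true]
    refine and_congr_left fun _ => ?_
    rcases Int.units_eq_one_or (G.rel i) with h | h <;> cases p i <;>
      simp [h, tileSide, upperSide, lowerSide, h1, h1.symm]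
  · rw [edge_E_mem_matching _ hi, G.down_eq_true]
    refine and_congr_left fun _ => ?_
    rcases Int.units_eq_one_or (G.rel i) with h | h <;> cases p i <;>
      simp [h, tileSide, upperSide, lowerSide, h1, h1.symm]

/-! ### Weights -/

theorem tileSide_eq_of_edge_eq_succ (hG : T.IsTiled G) {i : ℕ} (hi : i + 1 < G.len) {s s' : Side}
    (h : Tile.edge (G.corner i) s = Tile.edge (G.corner (i + 1)) s') :
    T.tileSide (G.rel i) (G.diag i) s = T.tileSide (G.rel (i + 1)) (G.diag (i + 1)) s' := by
  rw [hG.corner_succ i hi, tileStep] at h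
  rw [hG.rel_succ i hi]
  have h1 := T.next_ne (T.next (T.glue (G.diag i)))
  rcases Int.units_eq_one_or (G.rel i) with hr | hr <;> rcases hG.turn i hi with ht | ht <;>
    simp only [hr, ht, tileSide, if_true, h1, h1.symm, if_false,
      show ((-1 : ℤˣ) = 1) = False by decide] at h ⊢ <;>
    cases s <;> cases s' <;>
    simp [Tile.edge, Tile.sw, Tile.nw, Tile.ne, Tile.se, Prod.ext_iff, T.next_next_next] at h ⊢ <;>
    omega

/-- `edgeWeight` chooses some tile and position for an edge; this makes its value independent of the
choice. -/
theorem tileSide_eq_of_edge_eq (hG : T.IsTiled G) {i j : ℕ} (hi : i < G.len) (hj : j < G.len)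
    {s s' : Side} (h : Tile.edge (G.corner i) s = Tile.edge (G.corner j) s') :
    T.tileSide (G.rel i) (G.diag i) s = T.tileSide (G.rel j) (G.diag j) s' := by
  have l1 := level_corner G.toSnakeGraph hi
  have l2 := level_corner G.toSnakeGraph hj
  -- Tiles with a common edge have corners at most one step apart, and the level of the corner
  -- counts the tiles.
  have hij : i = j ∨ j = i + 1 ∨ i = j + 1 := by
    simp only [level] at l1 l2
    cases s <;> cases s' <;>
      simp [Tile.edge, Tile.sw, Tile.nw, Tile.ne, Tile.se, Prod.ext_iff] at h <;> omega
  rcases hij with rfl | rfl | rfl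
  · have hss : s = s' := by
      cases s <;> cases s' <;>
        simp [Tile.edge, Tile.sw, Tile.nw, Tile.ne, Tile.se, Prod.ext_iff] at h ⊢
    rw [hss]
  · exact hG.tileSide_eq_of_edge_eq_succ hj h
  · exact (hG.tileSide_eq_of_edge_eq_succ hi h.symm).symm

theorem edgeWeight_edge (hG : T.IsTiled G) {i : ℕ} (hi : i < G.len) (s : Side) :
    T.edgeWeight G (Tile.edge (G.corner i) s) = T.x (T.tileSide (G.rel i) (G.diag i) s) := by
  have h : ∃ q : ℕ × Side, q.1 < G.len ∧
      Tile.edge (G.corner q.1) q.2 = Tile.edge (G.corner i) s := ⟨(i, s), hi, rfl⟩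
  rw [edgeWeight, dif_pos h, hG.tileSide_eq_of_edge_eq h.choose_spec.1 hi h.choose_spec.2]

theorem edgeWeight_link_of_dep (hG : T.IsTiled G) (p : ℕ → Bool) {i : ℕ} (hi : i < G.len)
    (h : G.dep (G.down p) i = Tile.sw (G.corner i)) :
    T.edgeWeight G (G.link (G.down p) i) = T.x (T.lowerSide (G.diag i) (p i)) := by
  have h1 := link_mem_matching (G := G.toSnakeGraph) (G.down p) hi.le
  rw [link_eq_of_dep _ hi h] at h1 ⊢
  rw [hG.edgeWeight_edge hi,
    ((edge_mem_signMatching_of_lower (T := T) hi (by split_ifs <;> simp)).1 h1).1]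

theorem edgeWeight_link_of_arr (hG : T.IsTiled G) (p : ℕ → Bool) {i : ℕ} (hi : i < G.len)
    (h : G.arr (G.down p) (i + 1) = Tile.ne (G.corner i)) :
    T.edgeWeight G (G.link (G.down p) (i + 1)) = T.x (T.upperSide (G.diag i) (p i)) := by
  have h1 := link_mem_matching (G := G.toSnakeGraph) (G.down p) (m := i + 1) hi
  rw [link_eq_of_arr _ h] at h1 ⊢
  rw [hG.edgeWeight_edge hi,
    ((edge_mem_signMatching_of_upper (T := T) hi (by split_ifs <;> simp)).1 h1).1]

theorem edgeWeight_link (hG : T.IsTiled G) (h0 : 0 < G.len) {p : ℕ → Bool}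
    (hp : T.Admissible G.diag G.len p) {m : ℕ} (hm : m ≤ G.len) :
    T.edgeWeight G (G.link (G.down p) m) = T.x (T.carry G.diag G.len p m) := by
  rcases Nat.eq_zero_or_pos m with rfl | hm0
  · rw [hG.edgeWeight_link_of_dep p h0 rfl, carry, if_pos rfl]
  · obtain ⟨i, rfl⟩ : ∃ i, m = i + 1 := ⟨m - 1, by omega⟩
    rw [carry, if_neg (by omega)]
    split_ifs with h1 h2
    · rw [hG.edgeWeight_link_of_arr p (by omega) (by rw [h1, arr_len, ← h1]; simp), ← h1]
      simp
    · exact hG.edgeWeight_link_of_dep p (by omega) ((hG.dep_eq_sw_iff p (by omega)).2 h2)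
    · exact hG.edgeWeight_link_of_arr p (by omega)
        ((hG.arr_eq_ne_iff p (by omega)).2 ((hp i (by omega)).resolve_left h2))

theorem weightMonomial_signMatching (hG : T.IsTiled G) (h0 : 0 < G.len) {p : ℕ → Bool}
    (hp : T.Admissible G.diag G.len p) : T.weightMonomial G (G.signMatching p) =
      ∏ m ∈ Finset.range (G.len + 1), T.x (T.carry G.diag G.len p m) := by
  rw [weightMonomial, signMatching, matching, Finset.prod_image (link_injOn h0 _)]
  refine Finset.prod_congr rfl fun m hm => hG.edgeWeight_link h0 hp ?_
  simpa [Nat.lt_succ_iff] using hm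

theorem coeffMonomial_signMatching {p : ℕ → Bool}
    (hP : G.IsPerfectMatching (G.signMatching p)) : T.coeffMonomial G (G.signMatching p) =
      ∏ j ∈ Finset.range G.len, if p j then T.y (G.diag j) else 1 := by
  classical
  rw [coeffMonomial, Finset.prod_filter]
  refine Finset.prod_congr rfl fun j hj => ?_
  simp only [isPositive_signMatching hP (Finset.mem_range.1 hj)]

/-! ### Subgraphs -/

variable {o n : ℕ} (h : o + n ≤ G.len)

theorem sub (hG : T.IsTiled G) : T.IsTiled (G.sub o n h) where
  turn i hi := hG.turn (o + i) (by change i + 1 < n at hi; omega)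
  rel_succ i hi := hG.rel_succ (o + i) (by change i + 1 < n at hi; omega)
  corner_succ i hi := hG.corner_succ (o + i) (by change i + 1 < n at hi; omega)

theorem edgeWeight_sub (hG : T.IsTiled G) {e : Sym2 PlanePoint} (he : e ∈ (G.sub o n h).edges) :
    T.edgeWeight (G.sub o n h) e = T.edgeWeight G e := by
  obtain ⟨i, hi, s, rfl⟩ := mem_edges.1 he
  rw [(hG.sub h).edgeWeight_edge hi]
  change i < n at hi
  exact (hG.edgeWeight_edge (i := o + i) (by omega) s).symm

end IsTiled

end IdealTriangulation

/-! ### Restriction of a matching to consecutive tiles. -/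

namespace LabelledSnakeGraph

open PlanePoint SnakeGraph

variable {D : Type*} {G : LabelledSnakeGraph D} {o n : ℕ} (h : o + n ≤ G.len)

/-- Only the two outermost points differ in the definitions of the two travels: a travel of the
subgraph starts and ends at its extreme corners by definition, and `h1`, `h2` supply this for the
large travel. -/
theorem sub_link (hn : 0 < n) {a : ℕ → Bool} (h1 : G.dep a o = Tile.sw (G.corner o))
    (h2 : G.arr a (o + n) = Tile.ne (G.corner (o + n - 1))) {j : ℕ} (hj : j ≤ n) :
    (G.sub o n h).link (fun i => a (o + i)) j = G.link a (o + j) := by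
  have hd : (G.sub o n h).dep (fun i => a (o + i)) j = G.dep a (o + j) := by
    cases j with
    | zero => exact h1.symm
    | succ j => rfl
  have ha : (G.sub o n h).arr (fun i => a (o + i)) j = G.arr a (o + j) := by
    rcases hj.eq_or_lt with rfl | hj
    · rw [h2]
      refine (arr_len (G := (G.sub o j h).toSnakeGraph) _).trans ?_
      change Tile.ne (G.corner (o + (j - 1))) = _
      congr 2
      omega
    · rw [arr_of_lt a (by omega)]
      exact arr_of_lt (G := (G.sub o n h).toSnakeGraph) _ hj
  rw [link, link, hd, ha]

theorem level_of_mem_sub_verts (hn : 0 < n) {v : PlanePoint}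
    (hv : v ∈ (G.sub o n h).verts) : level (G.corner 0) + o ≤ level v ∧
      level v ≤ level (G.corner 0) + o + n + 1 := by
  have h3 := level_corner G.toSnakeGraph (i := o) (by omega)
  have h4 : level ((G.sub o n h).corner 0) = level (G.corner o) := rfl
  obtain ⟨m, hm, rfl | rfl⟩ := exists_of_mem_verts (fun _ => true) hv
  · rw [level_dep _ hm]
    change m ≤ n at hm
    omega
  · rw [level_arr hn _ hm]
    change m ≤ n at hm
    omega

/-- If the travel enters the subgraph at its first corner and leaves it at its last one, the part in
between is a travel of the subgraph. Levels exclude all other edges of the matching. -/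
theorem inter_sub_edges (hn : 0 < n) {a : ℕ → Bool} (hP : G.IsPerfectMatching (G.matching a))
    (h1 : G.dep a o = Tile.sw (G.corner o))
    (h2 : G.arr a (o + n) = Tile.ne (G.corner (o + n - 1))) :
    G.matching a ∩ (G.sub o n h).edges = (G.sub o n h).matching (fun i => a (o + i)) ∧
    (G.sub o n h).IsPerfectMatching (G.matching a ∩ (G.sub o n h).edges) := by
  have hne : ∀ j ≤ n, (G.sub o n h).link (fun i => a (o + i)) j ∈ (G.sub o n h).edges := by
    refine (link_mem_edges_iff (G := (G.sub o n h).toSnakeGraph) hn _).2 fun i hi => ?_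
    change i + 1 < n at hi
    exact (link_mem_edges_iff (by omega) a).1 (fun m hm => hP.1 (link_mem_matching a hm)) (o + i)
      (by omega)
  have key : G.matching a ∩ (G.sub o n h).edges =
      (G.sub o n h).matching (fun i => a (o + i)) := by
    ext e
    rw [Finset.mem_inter]
    constructor
    · rintro ⟨he, he'⟩
      obtain ⟨m, hm, rfl⟩ := mem_matching.1 he
      -- The lower end gives `o ≤ m`, the upper end gives `m ≤ o + n`.
      have hd := level_of_mem_sub_verts h hn (mem_verts_of_mem he' (Sym2.mem_mk_left _ _))
      have ha := level_of_mem_sub_verts h hn (mem_verts_of_mem he' (Sym2.mem_mk_right _ _))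
      rw [level_dep a hm] at hd
      rw [level_arr (by omega) a hm] at ha
      refine mem_matching.2 ⟨m - o, ?_, ?_⟩
      · change m - o ≤ n
        omega
      · rw [sub_link h hn h1 h2 (by omega), Nat.add_sub_cancel' (by omega)]
    · intro he
      obtain ⟨m, hm, rfl⟩ := mem_matching.1 he
      refine ⟨?_, hne m hm⟩
      rw [sub_link h hn h1 h2 hm]
      exact link_mem_matching a (by change m ≤ n at hm; omega)
  refine ⟨key, ?_⟩
  rw [key]
  exact isPerfectMatching_matching (G := (G.sub o n h).toSnakeGraph) hn hne

/-- The first corner of the subgraph is its unique lowest vertex, so the edge that covers it goes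
upwards and is the link `o`; likewise the last corner is the upper end of the link `o + n`. -/
theorem dep_eq_and_arr_eq_of_inter_sub_edges (hn : 0 < n) {a : ℕ → Bool}
    (hQ : (G.sub o n h).IsPerfectMatching (G.matching a ∩ (G.sub o n h).edges)) :
    G.dep a o = Tile.sw (G.corner o) ∧ G.arr a (o + n) = Tile.ne (G.corner (o + n - 1)) := by
  have key : ∀ v ∈ (G.sub o n h).verts, ∃ m ≤ G.len, ∃ u w, u ∈ (G.sub o n h).verts ∧
      w ∈ (G.sub o n h).verts ∧ G.dep a m = u ∧ G.arr a m = w ∧ (v = u ∨ v = w) ∧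
      level u = level (G.corner 0) + m ∧ level w = level u + 1 := by
    intro v hv
    obtain ⟨e, ⟨he, hve⟩, -⟩ := hQ.2 v hv
    obtain ⟨he1, he2⟩ := Finset.mem_inter.1 he
    obtain ⟨u, w, rfl, hu, hw, hl⟩ := exists_level_of_mem_edges he2
    obtain ⟨m, hm, he⟩ := mem_matching.1 he1
    obtain ⟨h3, h4, h5⟩ := link_eq_mk (by omega) a hm hl he
    exact ⟨m, hm, u, w, hu, hw, h4, h5, Sym2.mem_iff.1 hve, h3, hl⟩
  have hso : level (Tile.sw (G.corner o)) = level (G.corner 0) + o :=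
    level_corner G.toSnakeGraph (i := o) (by omega)
  have hne : level (Tile.ne (G.corner (o + n - 1))) = level (G.corner 0) + o + n + 1 := by
    have := level_corner G.toSnakeGraph (i := o + n - 1) (by omega)
    simp only [level, Tile.ne] at this ⊢
    omega
  constructor
  · obtain ⟨m, hm, u, w, hu, hw, h1, h2, h3, h4, h5⟩ := key (Tile.sw (G.corner o))
      (mem_verts.2 ⟨0, hn, Or.inl rfl⟩)
    have := level_of_mem_sub_verts h hn hu
    rcases h3 with rfl | rfl
    · obtain rfl : m = o := by omega
      exact h1
    · omega
  · obtain ⟨m, hm, u, w, hu, hw, h1, h2, h3, h4, h5⟩ := key (Tile.ne (G.corner (o + n - 1)))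
      (mem_verts.2 ⟨n - 1, by change n - 1 < n; omega, by
        change _ ∨ _ ∨ _ ∨ _ = Tile.ne (G.corner (o + (n - 1)))
        rw [Nat.add_sub_assoc hn]
        simp⟩)
    have := level_of_mem_sub_verts h hn hw
    rcases h3 with rfl | rfl
    · omega
    · obtain rfl : m = o + n := by omega
      exact h2

end LabelledSnakeGraph

namespace IdealTriangulation.IsTiled

open SnakeGraph LabelledSnakeGraph

variable {D : Type*} {T : IdealTriangulation D} {G : LabelledSnakeGraph D} {o n : ℕ}
  (h : o + n ≤ G.len)

theorem weightMonomial_inter_sub_edges (hG : T.IsTiled G) (hn : 0 < n) {p : ℕ → Bool}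
    (hp : T.Admissible G.diag G.len p)
    (h1 : G.dep (G.down p) o = Tile.sw (G.corner o))
    (h2 : G.arr (G.down p) (o + n) = Tile.ne (G.corner (o + n - 1))) :
    T.weightMonomial (G.sub o n h) (G.signMatching p ∩ (G.sub o n h).edges) =
      ∏ j ∈ Finset.range (n + 1), T.x (T.carry G.diag G.len p (o + j)) := by
  have hP := (hG.isPerfectMatching_signMatching_iff (by omega) p).2 hp
  obtain ⟨h3, h4⟩ := inter_sub_edges h hn hP h1 h2
  rw [signMatching, h3, weightMonomial, matching, Finset.prod_image (link_injOn hn _)]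
  refine Finset.prod_congr rfl fun m hm => ?_
  have hm' : m ≤ n := Nat.lt_succ_iff.1 (Finset.mem_range.1 hm)
  rw [hG.edgeWeight_sub h, sub_link h hn h1 h2 hm', hG.edgeWeight_link (by omega) hp (by omega)]
  rw [h3] at h4
  exact h4.1 (link_mem_matching _ hm')

theorem coeffMonomial_inter_sub_edges (hG : T.IsTiled G) (hn : 0 < n) {p : ℕ → Bool}
    (hp : T.Admissible G.diag G.len p)
    (h1 : G.dep (G.down p) o = Tile.sw (G.corner o))
    (h2 : G.arr (G.down p) (o + n) = Tile.ne (G.corner (o + n - 1))) :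
    T.coeffMonomial (G.sub o n h) (G.signMatching p ∩ (G.sub o n h).edges) =
      ∏ j ∈ Finset.range n, if p (o + j) then T.y (G.diag (o + j)) else 1 := by
  have hP := (hG.isPerfectMatching_signMatching_iff (by omega) p).2 hp
  obtain ⟨h3, h4⟩ := inter_sub_edges h hn hP h1 h2
  have h5 : G.signMatching p ∩ (G.sub o n h).edges =
      (G.sub o n h).signMatching (fun i => p (o + i)) := h3
  change (G.sub o n h).IsPerfectMatching (G.signMatching p ∩ _) at h4
  rw [h5] at h4 ⊢
  exact coeffMonomial_signMatching h4

end IdealTriangulation.IsTiled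

/-! ### Good matchings of a loop graph as matchings of its snake graph that contain `c` or `c'`. -/

namespace LoopGraph

open PlanePoint SnakeGraph

variable {D : Type*} (L : LoopGraph D)

/-- The matching of the loop graph that is obtained from a matching of the underlying snake
graph by removing one of the glued edges. -/
def reduce (P : Finset (Sym2 PlanePoint)) : Finset (Sym2 PlanePoint) :=
  if L.c' ∈ P then P.erase L.c' else P.erase L.c

variable {L}

theorem c_eq : L.c = s(L.ptX, L.ptY) := by
  rw [Sym2.eq_swap]
  rcases L.hcut with h | h <;> simp [c, ptX, ptY, otherEnd, h, Tile.edge]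

theorem c'_eq : L.c' = s(L.ptX', L.ptY') := by
  by_cases h : L.corner (L.k + 1) = L.corner L.k + (1, 0) <;>
    simp [c', ptX', ptY', cut', otherEnd, h, Tile.edge]

theorem c_mem_edges : L.c ∈ L.toSnakeGraph.edges :=
  edge_mem_edges (by have := L.hk; omega) _

theorem c'_mem_edges : L.c' ∈ L.toSnakeGraph.edges :=
  edge_mem_edges (by have := L.hk; omega) _

theorem level_ptX : level L.ptX = level (L.corner 0) + L.len + 1 := by
  have h1 := L.hk
  have h2 := level_corner L.toSnakeGraph (i := L.len - 1) (by omega)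
  simp only [level, ptX, Tile.ne] at h2 ⊢
  omega

theorem level_ptY : level L.ptY = level (L.corner 0) + L.len := by
  have h1 := L.hk
  have h2 := level_corner L.toSnakeGraph (i := L.len - 1) (by omega)
  simp only [level, ptY, otherEnd] at h2 ⊢
  split_ifs <;> simp only [Tile.nw, Tile.se] <;> omega

theorem level_ptX' : level L.ptX' = level (L.corner 0) + L.k + 1 := by
  have h1 := L.hk
  have h2 := level_corner L.toSnakeGraph (i := L.k) (by omega)
  simp only [level, ptX', otherEnd] at h2 ⊢
  split_ifs <;> simp only [Tile.nw, Tile.se] <;> omega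

theorem level_ptY' : level L.ptY' = level (L.corner 0) + L.k + 2 := by
  have h1 := L.hk
  have h2 := level_corner L.toSnakeGraph (i := L.k) (by omega)
  simp only [level, ptY', Tile.ne] at h2 ⊢
  omega

theorem ptX_ne_ptY : L.ptX ≠ L.ptY := fun h => by
  have h1 := L.level_ptX
  have h2 := L.level_ptY
  rw [h] at h1
  omega

theorem ptX'_ne_ptY' : L.ptX' ≠ L.ptY' := fun h => by
  have h1 := L.level_ptX'
  have h2 := L.level_ptY'
  rw [h] at h1
  omega

/-- The levels of `ptY` and `ptY'` are `len` and `k + 2` above the first corner, so a second tile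
after the tile `k + 1` is what keeps the glued edges disjoint. -/
theorem pt_ne_pt' (hl : L.k + 2 < L.len) :
    L.ptX ≠ L.ptX' ∧ L.ptX ≠ L.ptY' ∧ L.ptY ≠ L.ptX' ∧ L.ptY ≠ L.ptY' := by
  have h1 := L.level_ptX
  have h2 := L.level_ptY
  have h3 := L.level_ptX'
  have h4 := L.level_ptY'
  refine ⟨?_, ?_, ?_, ?_⟩ <;> intro h <;> have h5 := congrArg level h <;> omega

theorem mk_not_mem_edges (hl : L.k + 2 < L.len) : s(L.ptX, L.ptX') ∉ L.toSnakeGraph.edges ∧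
    s(L.ptX, L.ptY') ∉ L.toSnakeGraph.edges ∧ s(L.ptY, L.ptX') ∉ L.toSnakeGraph.edges := by
  have h1 := L.level_ptX
  have h2 := L.level_ptY
  have h3 := L.level_ptX'
  have h4 := L.level_ptY'
  refine ⟨?_, ?_, ?_⟩ <;> intro h <;> have h5 := level_of_mk_mem_edges h <;> omega

theorem glueVert_ptX' : L.glueVert L.ptX' = L.ptX := if_pos rfl

theorem glueVert_ptY' : L.glueVert L.ptY' = L.ptY := by
  rw [glueVert, if_neg ptX'_ne_ptY'.symm, if_pos rfl]

theorem glueVert_of_ne {v : PlanePoint} (h1 : v ≠ L.ptX') (h2 : v ≠ L.ptY') :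
    L.glueVert v = v := by
  rw [glueVert, if_neg h1, if_neg h2]

theorem glueVert_eq_cases (v : PlanePoint) : (v = L.ptX' ∧ L.glueVert v = L.ptX) ∨
    (v = L.ptY' ∧ L.glueVert v = L.ptY) ∨
    (v ≠ L.ptX' ∧ v ≠ L.ptY' ∧ L.glueVert v = v) := by
  by_cases h1 : v = L.ptX'
  · exact Or.inl ⟨h1, h1 ▸ glueVert_ptX'⟩
  · by_cases h2 : v = L.ptY'
    · exact Or.inr (Or.inl ⟨h2, h2 ▸ glueVert_ptY'⟩)
    · exact Or.inr (Or.inr ⟨h1, h2, glueVert_of_ne h1 h2⟩)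

theorem glueEdge_c' : L.glueEdge L.c' = L.c := if_pos rfl

theorem glueEdge_of_ne {e : Sym2 PlanePoint} (h : e ≠ L.c') : L.glueEdge e = e := if_neg h

theorem ptX_mem_c : L.ptX ∈ L.c := by rw [c_eq]; exact Sym2.mem_mk_left _ _
theorem ptY_mem_c : L.ptY ∈ L.c := by rw [c_eq]; exact Sym2.mem_mk_right _ _
theorem ptX'_mem_c' : L.ptX' ∈ L.c' := by rw [c'_eq]; exact Sym2.mem_mk_left _ _
theorem ptY'_mem_c' : L.ptY' ∈ L.c' := by rw [c'_eq]; exact Sym2.mem_mk_right _ _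

theorem ptX_not_mem_c' (hl : L.k + 2 < L.len) : L.ptX ∉ L.c' := by
  obtain ⟨h1, h2, -, -⟩ := pt_ne_pt' hl
  rw [c'_eq]
  simp [h1, h2]

theorem c_ne_c' (hl : L.k + 2 < L.len) : L.c ≠ L.c' :=
  fun h => ptX_not_mem_c' hl (h ▸ ptX_mem_c)

theorem mem_edges_of_ne {e : Sym2 PlanePoint} (he : e ∈ L.toSnakeGraph.edges) (h : e ≠ L.c') :
    e ∈ L.edges := Finset.mem_image.2 ⟨e, he, glueEdge_of_ne h⟩

theorem glueVert_mem_verts {v : PlanePoint} (hv : v ∈ L.toSnakeGraph.verts) :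
    L.glueVert v ∈ L.verts := Finset.mem_image_of_mem _ hv

/-- An edge has an end that is glued to no other vertex, or both of its ends are glued to
each other, or it is one of the two glued edges. -/
theorem exists_glueVert_injective (hl : L.k + 2 < L.len) {e : Sym2 PlanePoint}
    (he : e ∈ L.toSnakeGraph.edges) (h1 : e ≠ L.c) (h2 : e ≠ L.c') :
    ∃ v ∈ e, ∀ u, L.glueVert u = L.glueVert v → u ∈ e := by
  obtain ⟨n1, n2, n3, n4⟩ := pt_ne_pt' hl
  obtain ⟨m1, m2, m3⟩ := mk_not_mem_edges hl
  have key : ∀ v ∈ e, v ≠ L.ptX → v ≠ L.ptX' → v ≠ L.ptY → v ≠ L.ptY' →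
      ∃ v ∈ e, ∀ u, L.glueVert u = L.glueVert v → u ∈ e := by
    intro v hv v1 v2 v3 v4
    refine ⟨v, hv, fun u hu => ?_⟩
    rw [glueVert_of_ne v2 v4] at hu
    rcases L.glueVert_eq_cases u with ⟨-, h⟩ | ⟨-, h⟩ | ⟨-, -, h⟩
    · exact absurd (hu.symm.trans h) v1
    · exact absurd (hu.symm.trans h) v3
    · rwa [← h, hu]
  by_contra hc
  have key' : ∀ v ∈ e, v = L.ptX ∨ v = L.ptX' ∨ v = L.ptY ∨ v = L.ptY' := by
    intro v hv
    by_contra h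
    push Not at h
    exact hc (key v hv h.1 h.2.1 h.2.2.1 h.2.2.2)
  rw [c_eq] at h1
  rw [c'_eq] at h2
  obtain ⟨u, v, rfl, -, -, hlev⟩ := exists_level_of_mem_edges he
  have hne : u ≠ v := by rintro rfl; omega
  -- This edge, whose ends become one vertex of the loop graph, can exist only if `len = k + 3`.
  have special : s(u, v) ≠ s(L.ptY, L.ptY') := by
    intro h
    rw [h] at hc
    refine hc ⟨L.ptY, Sym2.mem_mk_left _ _, fun w hw => ?_⟩
    rw [glueVert_of_ne n3 n4] at hw
    rcases L.glueVert_eq_cases w with ⟨-, h⟩ | ⟨h, -⟩ | ⟨-, -, h⟩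
    · exact absurd (h.symm.trans hw) ptX_ne_ptY
    · rw [h]; exact Sym2.mem_mk_right _ _
    · rw [← h, hw]; exact Sym2.mem_mk_left _ _
  rcases key' u (Sym2.mem_mk_left _ _) with rfl | rfl | rfl | rfl <;>
    rcases key' v (Sym2.mem_mk_right _ _) with rfl | rfl | rfl | rfl <;>
    first
    | exact hne rfl
    | exact h1 rfl
    | exact h1 Sym2.eq_swap
    | exact h2 rfl
    | exact h2 Sym2.eq_swap
    | exact m1 he
    | exact m1 (Sym2.eq_swap ▸ he)
    | exact m2 he
    | exact m2 (Sym2.eq_swap ▸ he)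
    | exact m3 he
    | exact m3 (Sym2.eq_swap ▸ he)
    | exact special rfl
    | exact special Sym2.eq_swap

theorem Extends.subset {P Q : Finset (Sym2 PlanePoint)} (hQ : L.IsPerfectMatching Q)
    (hP : L.Extends P Q) : Q ⊆ P := by
  intro q hq
  obtain ⟨e, he, rfl⟩ := Finset.mem_image.1 (hQ.1 hq)
  by_cases h : e = L.c'
  · rw [h, glueEdge_c'] at hq ⊢
    refine hP.2 _ c_mem_edges ?_
    by_cases h' : L.c = L.c'
    · rw [h', glueEdge_c']
      exact hq
    · rwa [glueEdge_of_ne h']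
  · rw [glueEdge_of_ne h] at hq ⊢
    exact hP.2 e he (by rwa [glueEdge_of_ne h])

/-- Gluing loses information only at `c` and `c'`: all other edges of an extension lie in `Q`.
Counting the edges of `Q` at the glued vertex `ptX` then shows that `P` has exactly one more edge
than `Q`. -/
theorem eq_reduce_of_extends (hl : L.k + 2 < L.len) {P Q : Finset (Sym2 PlanePoint)}
    (hQ : L.IsPerfectMatching Q) (hP : L.Extends P Q) :
    (L.c ∈ P ∨ L.c' ∈ P) ∧ Q = L.reduce P := by
  obtain ⟨n1, n2, n3, n4⟩ := pt_ne_pt' hl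
  have hcc := c_ne_c' hl
  have hsub := Extends.subset hQ hP
  have hc'Q : L.c' ∉ Q := by
    intro h
    obtain ⟨e, he, h⟩ := Finset.mem_image.1 (hQ.1 h)
    by_cases h' : e = L.c'
    · rw [h', glueEdge_c'] at h; exact hcc h
    · rw [glueEdge_of_ne h'] at h; exact h' h
  -- Some edge of `Q` covers the image of the end `v` of `f`. Its preimage lies in `P` and, by the
  -- choice of `v`, meets `f`, hence equals `f`.
  have hmem : ∀ f ∈ P, f ≠ L.c → f ≠ L.c' → f ∈ Q := by
    intro f hf h1 h2
    obtain ⟨v, hv, hinj⟩ := exists_glueVert_injective hl (hP.1.1 hf) h1 h2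
    obtain ⟨q, ⟨hq, e, he, u, hu, rfl, huv⟩, -⟩ := hQ.2 _
      (glueVert_mem_verts (mem_verts_of_mem (hP.1.1 hf) hv))
    have heP := hP.2 e he hq
    have : e = f := hP.1.eq_of_mem heP hf hu (hinj u huv)
    rw [this, glueEdge_of_ne h2] at hq
    exact hq
  have hX : L.ptX ∈ L.toSnakeGraph.verts := mem_verts_of_mem c_mem_edges ptX_mem_c
  have hX' : L.ptX' ∈ L.toSnakeGraph.verts := mem_verts_of_mem c'_mem_edges ptX'_mem_c'
  have hXL : L.ptX ∈ L.verts := by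
    have := glueVert_mem_verts hX
    rwa [glueVert_of_ne n1 n2] at this
  -- If `c` is in `Q`, then both of its preimages are in `P`, and removing `c'` leaves `Q`.
  by_cases hcQ : L.c ∈ Q
  · have hc'P : L.c' ∈ P := hP.2 _ c'_mem_edges (by rwa [glueEdge_c'])
    refine ⟨Or.inr hc'P, ?_⟩
    rw [reduce, if_pos hc'P]
    ext f
    rw [Finset.mem_erase]
    refine ⟨fun h => ⟨fun h' => hc'Q (h' ▸ h), hsub h⟩, fun ⟨h1, h2⟩ => ?_⟩
    by_cases h3 : f = L.c
    · rwa [h3]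
    · exact hmem f h2 h3 h1
  · have hor : L.c ∈ P ∨ L.c' ∈ P := by
      by_contra h
      push Not at h
      -- With neither glued edge in `P`, the edges at `ptX` and at `ptX'` both survive in `Q` and
      -- meet at the same vertex.
      obtain ⟨f, ⟨hf, hXf⟩, -⟩ := hP.1.2 _ hX
      obtain ⟨f', ⟨hf', hXf'⟩, -⟩ := hP.1.2 _ hX'
      have h1 : f ≠ L.c' := fun h' => h.2 (h' ▸ hf)
      have h2 : f' ≠ L.c' := fun h' => h.2 (h' ▸ hf')
      have h3 := hmem f hf (fun h' => h.1 (h' ▸ hf)) h1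
      have h4 := hmem f' hf' (fun h' => h.1 (h' ▸ hf')) h2
      have h5 : f = f' := (hQ.2 _ hXL).unique
        ⟨h3, f, hP.1.1 hf, _, hXf, glueEdge_of_ne h1, glueVert_of_ne n1 n2⟩
        ⟨h4, f', hP.1.1 hf', _, hXf', glueEdge_of_ne h2, glueVert_ptX'⟩
      rw [← h5] at hXf'
      have h6 := (Sym2.mem_and_mem_iff n1).1 ⟨hXf, hXf'⟩
      exact (mk_not_mem_edges hl).1 (h6 ▸ hP.1.1 hf)
    -- With both glued edges in `P` but `c` not in `Q`, no edge of `Q` covers `ptX`.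
    have hand : ¬ (L.c ∈ P ∧ L.c' ∈ P) := by
      rintro ⟨h1, h2⟩
      obtain ⟨q, ⟨hq, e, he, u, hu, rfl, huv⟩, -⟩ := hQ.2 _ hXL
      have heP := hP.2 e he hq
      have he1 : e ≠ L.c' := by rintro rfl; rw [glueEdge_c'] at hq; exact hcQ hq
      have he2 : e ≠ L.c := by rintro rfl; rw [glueEdge_of_ne he1] at hq; exact hcQ hq
      rcases L.glueVert_eq_cases u with ⟨h, -⟩ | ⟨-, h⟩ | ⟨-, -, h⟩
      · exact he1 (hP.1.eq_of_mem heP h2 (h ▸ hu) ptX'_mem_c')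
      · exact ptX_ne_ptY (huv.symm.trans h)
      · exact he2 (hP.1.eq_of_mem heP h1 ((h.symm.trans huv) ▸ hu) ptX_mem_c)
    refine ⟨hor, ?_⟩
    rw [reduce]
    split_ifs with hc'P
    · ext f
      rw [Finset.mem_erase]
      refine ⟨fun h => ⟨fun h' => hc'Q (h' ▸ h), hsub h⟩, fun ⟨h1, h2⟩ => ?_⟩
      exact hmem f h2 (fun h3 => hand ⟨h3 ▸ h2, hc'P⟩) h1
    · ext f
      rw [Finset.mem_erase]
      refine ⟨fun h => ⟨fun h' => hcQ (h' ▸ h), hsub h⟩, fun ⟨h1, h2⟩ => ?_⟩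
      exact hmem f h2 h1 (fun h3 => hc'P (h3 ▸ h2))

/-- Whether `c` or `c'` was erased is visible afterwards: `ptX` is still covered in the snake graph
in the latter case, and uncovered in the former. -/
theorem reduce_injective (hl : L.k + 2 < L.len) {P P' : Finset (Sym2 PlanePoint)}
    (hP : L.toSnakeGraph.IsPerfectMatching P) (hP' : L.toSnakeGraph.IsPerfectMatching P')
    (hc : L.c ∈ P ∨ L.c' ∈ P) (hc' : L.c ∈ P' ∨ L.c' ∈ P') (h : L.reduce P = L.reduce P') :
    P = P' := by
  have aux : ∀ {P P' : Finset (Sym2 PlanePoint)}, L.toSnakeGraph.IsPerfectMatching P →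
      L.toSnakeGraph.IsPerfectMatching P' → L.c' ∈ P → L.c ∈ P' →
      P.erase L.c' ≠ P'.erase L.c := by
    intro P P' hP hP' h1 h2 h
    obtain ⟨f, ⟨hf, hXf⟩, -⟩ := hP.2 L.ptX (mem_verts_of_mem c_mem_edges ptX_mem_c)
    have h3 : f ≠ L.c' := by rintro rfl; exact ptX_not_mem_c' hl hXf
    have h4 : f ∈ P'.erase L.c := h ▸ Finset.mem_erase.2 ⟨h3, hf⟩
    obtain ⟨h5, h6⟩ := Finset.mem_erase.1 h4
    exact h5 (hP'.eq_of_mem h6 h2 hXf ptX_mem_c)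
  rw [reduce, reduce] at h
  split_ifs at h with h1 h2 h2
  · rw [← Finset.insert_erase h1, h, Finset.insert_erase h2]
  · exact absurd h (aux hP hP' h1 (hc'.resolve_right h2))
  · exact absurd h.symm (aux hP' hP h2 (hc.resolve_right h1))
  · rw [← Finset.insert_erase (hc.resolve_right h1), h,
      Finset.insert_erase (hc'.resolve_right h2)]

theorem extends_reduce {P : Finset (Sym2 PlanePoint)}
    (hP : L.toSnakeGraph.IsPerfectMatching P) : L.Extends P (L.reduce P) := by
  refine ⟨hP, fun e he h => ?_⟩
  by_cases h1 : e = L.c'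
  · subst h1
    by_contra h2
    rw [glueEdge_c', reduce, if_neg h2] at h
    exact (Finset.notMem_erase _ _) h
  · rw [glueEdge_of_ne h1, reduce] at h
    split_ifs at h <;> exact (Finset.mem_erase.1 h).2

/-- Erasing a glued edge frees exactly its two ends. Each glued vertex has another preimage, on the
other glued edge, where the covering edge is unchanged. -/
theorem isPerfectMatching_reduce (hl : L.k + 2 < L.len) {P : Finset (Sym2 PlanePoint)}
    (hP : L.toSnakeGraph.IsPerfectMatching P) (hc : L.c ∈ P ∨ L.c' ∈ P) :
    L.IsPerfectMatching (L.reduce P) := by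
  obtain ⟨n1, n2, n3, n4⟩ := pt_ne_pt' hl
  have hcc := c_ne_c' hl
  have hX : L.ptX ∈ L.toSnakeGraph.verts := mem_verts_of_mem c_mem_edges ptX_mem_c
  have hY : L.ptY ∈ L.toSnakeGraph.verts := mem_verts_of_mem c_mem_edges ptY_mem_c
  have hX' : L.ptX' ∈ L.toSnakeGraph.verts := mem_verts_of_mem c'_mem_edges ptX'_mem_c'
  have hY' : L.ptY' ∈ L.toSnakeGraph.verts := mem_verts_of_mem c'_mem_edges ptY'_mem_c'
  by_cases hc'P : L.c' ∈ P
  · rw [reduce, if_pos hc'P]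
    refine ⟨fun f hf => ?_, fun v hv => ?_⟩
    · obtain ⟨h1, h2⟩ := Finset.mem_erase.1 hf
      exact mem_edges_of_ne (hP.1 h2) h1
    · have hv' : v ∈ L.toSnakeGraph.verts ∧ v ≠ L.ptX' ∧ v ≠ L.ptY' := by
        obtain ⟨u, hu, rfl⟩ := Finset.mem_image.1 hv
        rcases L.glueVert_eq_cases u with ⟨-, h⟩ | ⟨-, h⟩ | ⟨h1, h2, h⟩ <;> rw [h]
        · exact ⟨hX, n1, n2⟩
        · exact ⟨hY, n3, n4⟩
        · exact ⟨hu, h1, h2⟩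
      obtain ⟨hv1, hv2, hv3⟩ := hv'
      have hmem : ∀ q ∈ P.erase L.c', L.Inc q v → v ∈ q := by
        rintro q hq ⟨e, he, u, hu, rfl, rfl⟩
        obtain ⟨hq1, hq2⟩ := Finset.mem_erase.1 hq
        by_cases h : e = L.c'
        · subst h
          rw [glueEdge_c']
          rw [c'_eq] at hu
          rcases Sym2.mem_iff.1 hu with rfl | rfl
          · rw [glueVert_ptX']; exact ptX_mem_c
          · rw [glueVert_ptY']; exact ptY_mem_c
        · rw [glueEdge_of_ne h] at hq2 ⊢
          rcases L.glueVert_eq_cases u with ⟨h1, -⟩ | ⟨h1, -⟩ | ⟨-, -, h1⟩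
          · exact absurd (hP.eq_of_mem hq2 hc'P (h1 ▸ hu) ptX'_mem_c') h
          · exact absurd (hP.eq_of_mem hq2 hc'P (h1 ▸ hu) ptY'_mem_c') h
          · rwa [h1]
      obtain ⟨f, ⟨hf, hvf⟩, -⟩ := hP.2 v hv1
      have hfc' : f ≠ L.c' := by
        rintro rfl
        rw [c'_eq] at hvf
        rcases Sym2.mem_iff.1 hvf with h | h
        · exact hv2 h
        · exact hv3 h
      refine ⟨f, ⟨Finset.mem_erase.2 ⟨hfc', hf⟩, f, hP.1 hf, v, hvf, glueEdge_of_ne hfc',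
        glueVert_of_ne hv2 hv3⟩, ?_⟩
      rintro q ⟨hq, hinc⟩
      exact hP.eq_of_mem (Finset.mem_erase.1 hq).2 hf (hmem q hq hinc) hvf
  · have hcP := hc.resolve_right hc'P
    rw [reduce, if_neg hc'P]
    refine ⟨fun f hf => ?_, fun v hv => ?_⟩
    · have h2 := (Finset.mem_erase.1 hf).2
      exact mem_edges_of_ne (hP.1 h2) fun h => hc'P (h ▸ h2)
    · have hv' : ∃ u ∈ L.toSnakeGraph.verts, u ≠ L.ptX ∧ u ≠ L.ptY ∧ L.glueVert u = v := by
        obtain ⟨u, hu, rfl⟩ := Finset.mem_image.1 hv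
        by_cases h1 : u = L.ptX
        · exact ⟨L.ptX', hX', n1.symm, n3.symm, by rw [h1, glueVert_ptX', glueVert_of_ne n1 n2]⟩
        · by_cases h2 : u = L.ptY
          · exact ⟨L.ptY', hY', n2.symm, n4.symm, by rw [h2, glueVert_ptY', glueVert_of_ne n3 n4]⟩
          · exact ⟨u, hu, h1, h2, rfl⟩
      obtain ⟨u, hu, hu1, hu2, rfl⟩ := hv'
      have hmem : ∀ q ∈ P.erase L.c, L.Inc q (L.glueVert u) → u ∈ q := by
        rintro q hq ⟨e, he, w, hw, rfl, hwu⟩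
        obtain ⟨hq1, hq2⟩ := Finset.mem_erase.1 hq
        have h : e ≠ L.c' := by
          rintro rfl
          exact hq1 glueEdge_c'
        rw [glueEdge_of_ne h] at hq1 hq2 ⊢
        have hw1 : w ≠ L.ptX := by
          rintro rfl
          exact hq1 (hP.eq_of_mem hq2 hcP hw ptX_mem_c)
        have hw2 : w ≠ L.ptY := by
          rintro rfl
          exact hq1 (hP.eq_of_mem hq2 hcP hw ptY_mem_c)
        have hwu' : w = u := by
          rcases L.glueVert_eq_cases w with ⟨h1, h2⟩ | ⟨h1, h2⟩ | ⟨-, -, h2⟩ <;>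
            rcases L.glueVert_eq_cases u with ⟨h3, h4⟩ | ⟨h3, h4⟩ | ⟨-, -, h4⟩ <;>
            rw [h2, h4] at hwu
          · rw [h1, h3]
          · exact absurd hwu ptX_ne_ptY
          · exact absurd hwu.symm hu1
          · exact absurd hwu.symm ptX_ne_ptY
          · rw [h1, h3]
          · exact absurd hwu.symm hu2
          · exact absurd hwu hw1
          · exact absurd hwu hw2
          · exact hwu
        exact hwu' ▸ hw
      obtain ⟨f, ⟨hf, huf⟩, -⟩ := hP.2 u hu
      have hfc : f ≠ L.c := by
        rintro rfl
        rw [c_eq] at huf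
        rcases Sym2.mem_iff.1 huf with h | h
        · exact hu1 h
        · exact hu2 h
      refine ⟨f, ⟨Finset.mem_erase.2 ⟨hfc, hf⟩, f, hP.1 hf, u, huf,
        glueEdge_of_ne fun h => hc'P (h ▸ hf), rfl⟩, ?_⟩
      rintro q ⟨hq, hinc⟩
      exact hP.eq_of_mem (Finset.mem_erase.1 hq).2 hf (hmem q hq hinc) huf

theorem isGoodMatching_iff (hl : L.k + 2 < L.len) {Q : Finset (Sym2 PlanePoint)} :
    L.IsGoodMatching Q ↔ ∃ P, L.toSnakeGraph.IsPerfectMatching P ∧ (L.c ∈ P ∨ L.c' ∈ P) ∧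
      Q = L.reduce P := by
  constructor
  · rintro ⟨hQ, P, hP⟩
    exact ⟨P, hP.1, eq_reduce_of_extends hl hQ hP⟩
  · rintro ⟨P, hP, hc, rfl⟩
    exact ⟨isPerfectMatching_reduce hl hP hc, P, extends_reduce hP⟩

/-- The extension of a good matching is unique, so the choice in `coeffMonomialLoop` is harmless. -/
theorem choose_isGoodMatching (hl : L.k + 2 < L.len) {P : Finset (Sym2 PlanePoint)}
    (hP : L.toSnakeGraph.IsPerfectMatching P) (hc : L.c ∈ P ∨ L.c' ∈ P)
    (hQ : L.IsGoodMatching (L.reduce P)) : hQ.2.choose = P := by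
  have h1 := hQ.2.choose_spec
  obtain ⟨h2, h3⟩ := eq_reduce_of_extends hl hQ.1 h1
  exact (reduce_injective hl hP h1.1 hc h2 h3).symm

end LoopGraph

/-! ### Combinatorics of words of crossings and symmetric signs. -/

namespace IdealTriangulation

variable {D : Type*} {T : IdealTriangulation D}

/-- Passing to the other side of a radius exchanges the two cases in the definition of `y`, and both
name the same outer side. -/
theorem y_glue (d : D) : T.y (T.glue d) = T.y d := by
  have h1 : T.coeffVar (T.glue d) = T.coeffVar d := by
    by_cases hd : T.IsBoundary d
    · rw [show T.glue d = d from hd]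
    · have hd' : ¬ T.IsBoundary (T.glue d) := by
        intro h
        rw [IsBoundary, T.glue_glue] at h
        exact hd h.symm
      rw [coeffVar, coeffVar, dif_neg hd, dif_neg hd']
      have h : T.arc (T.glue d) hd' = T.arc d hd := by
        refine Subtype.ext ?_
        change s(T.glue d, T.glue (T.glue d)) = s(d, T.glue d)
        rw [T.glue_glue, Sym2.eq_swap]
      rw [h]
  have h2 : d = T.next (T.glue d) ↔ T.glue d = T.next (T.next d) := by
    constructor
    · intro h
      conv_rhs => rw [h]
      rw [T.next_next_next]
    · intro h
      rw [h, T.next_next_next]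
  have h3 : d = T.next (T.next (T.glue d)) ↔ T.glue d = T.next d := by
    constructor
    · intro h
      conv_rhs => rw [h]
      rw [T.next_next_next]
    · intro h
      rw [h, T.next_next_next]
  rw [y, y, h1, T.glue_glue, mul_assoc, mul_assoc]
  congr 1
  rw [mul_comm]
  congr 1
  · by_cases h : T.glue d = T.next d
    · rw [if_pos h, if_pos (h3.2 h), h]
    · rw [if_neg h, if_neg fun h' => h (h3.1 h')]
  · by_cases h : T.glue d = T.next (T.next d)
    · rw [if_pos h, if_pos (h2.2 h), h, T.next_next_next]
    · rw [if_neg h, if_neg fun h' => h (h2.1 h')]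

theorem clusterVar_ne_zero (d : D) : T.clusterVar d ≠ 0 := by
  rw [clusterVar]
  split_ifs
  · exact one_ne_zero
  · exact (map_ne_zero_iff _ (IsFractionRing.injective _ _)).2 (MvPolynomial.X_ne_zero _)

theorem coeffVar_ne_zero (d : D) : T.coeffVar d ≠ 0 := by
  rw [coeffVar]
  split_ifs
  · exact one_ne_zero
  · exact (map_ne_zero_iff _ (IsFractionRing.injective _ _)).2 (MvPolynomial.X_ne_zero _)

theorem x_ne_zero (d : D) : T.x d ≠ 0 := by
  rw [x]
  split_ifs <;> simp [clusterVar_ne_zero]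

theorem y_ne_zero (d : D) : T.y d ≠ 0 := by
  rw [y]
  split_ifs <;> simp [coeffVar_ne_zero]

/-! ### Words of crossings -/

theorem glue_eq_next_iff {d d' : D}
    (h : d' = T.next (T.glue d) ∨ d' = T.next (T.next (T.glue d))) :
    T.glue d = T.next d' ↔ ¬ d' = T.next (T.glue d) := by
  have h1 := T.next_next_ne (T.glue d)
  have h2 := T.next_ne (T.next (T.glue d))
  rcases h with rfl | rfl
  · simp [h1.symm]
  · simp [T.next_next_next, h2]

/-- When both alternatives of admissibility hold, the link is the edge along which the two tiles are
glued, and it carries the third side of the triangle traversed. -/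
theorem lowerSide_eq_upperSide {d d' : D} {p p' : Bool}
    (h : d' = T.next (T.glue d) ∨ d' = T.next (T.next (T.glue d)))
    (h1 : d' = T.next (T.glue d) ↔ p = true) (h2 : d' = T.next (T.glue d) ↔ p' = false) :
    T.lowerSide d' p' = T.upperSide d p := by
  have h3 := T.next_ne (T.next (T.glue d))
  rcases h with rfl | rfl
  · obtain rfl : p = true := by simpa using h1
    obtain rfl : p' = false := by simpa using h2
    simp [lowerSide, upperSide]
  · obtain rfl : p = false := by simpa [h3] using h1
    obtain rfl : p' = true := by simpa [h3] using h2
    simp [lowerSide, upperSide, T.next_next_next]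

/-- The side carried by an edge that is an upper edge of its tile. -/
theorem carry_of_upper {w : ℕ → D} {n : ℕ} {p : ℕ → Bool} {i : ℕ} (hi : i + 1 < n)
    (ht : w (i + 1) = T.next (T.glue (w i)) ∨ w (i + 1) = T.next (T.next (T.glue (w i))))
    (h : T.Turns w i ↔ p (i + 1) = false) :
    T.carry w n p (i + 1) = T.upperSide (w i) (p i) := by
  rw [carry, if_neg (by omega), if_neg (by omega)]
  split_ifs with h1
  · exact lowerSide_eq_upperSide ht h1 h
  · rfl

theorem carry_of_lower {w : ℕ → D} {n : ℕ} {p : ℕ → Bool} {i : ℕ} (hi : i + 1 < n)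
    (h : T.Turns w i ↔ p i = true) :
    T.carry w n p (i + 1) = T.lowerSide (w (i + 1)) (p (i + 1)) := by
  rw [carry, if_neg (by omega), if_neg (by omega)]
  exact if_pos h

theorem carry_of_not_lower {w : ℕ → D} {n : ℕ} {p : ℕ → Bool} {i : ℕ} (hi : i + 1 < n)
    (h : ¬ (T.Turns w i ↔ p i = true)) :
    T.carry w n p (i + 1) = T.upperSide (w i) (p i) := by
  rw [carry, if_neg (by omega), if_neg (by omega)]
  exact if_neg h

/-- Reversal exchanges the entry and the exit of a triangle, hence clockwise and counterclockwise.
-/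
theorem turns_of_reverse {w w' : ℕ → D} {i j : ℕ}
    (ht : w (i + 1) = T.next (T.glue (w i)) ∨ w (i + 1) = T.next (T.next (T.glue (w i))))
    (h1 : w' j = T.glue (w (i + 1))) (h2 : w' (j + 1) = T.glue (w i)) :
    T.Turns w' j ↔ ¬ T.Turns w i := by
  rw [Turns, Turns, h1, h2, T.glue_glue, glue_eq_next_iff ht]

theorem carry_of_reverse {w w' : ℕ → D} {n : ℕ} {p p' : ℕ → Bool} {i j : ℕ} (hi : i + 1 < n)
    (hj : j + 1 < n)
    (ht : w (i + 1) = T.next (T.glue (w i)) ∨ w (i + 1) = T.next (T.next (T.glue (w i))))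
    (hp : (T.Turns w i ↔ p i = true) ∨ (T.Turns w i ↔ p (i + 1) = false))
    (h1 : w' j = T.glue (w (i + 1))) (h2 : w' (j + 1) = T.glue (w i))
    (h3 : p' j = p (i + 1)) (h4 : p' (j + 1) = p i) :
    T.carry w' n p' (j + 1) = T.carry w n p (i + 1) := by
  have h5 := turns_of_reverse ht h1 h2
  have h6 : (T.Turns w' j ↔ p' j = true) ↔ (T.Turns w i ↔ p (i + 1) = false) := by
    rw [h5, h3]
    cases p (i + 1) <;> simp
  by_cases h : T.Turns w i ↔ p (i + 1) = false
  · rw [carry_of_lower hj (h6.2 h), carry_of_upper hi ht h, h2, h4, upperSide]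
  · rw [carry_of_not_lower hj (fun h' => h (h6.1 h')), carry_of_lower hi (hp.resolve_right h), h1,
      h3, upperSide, T.glue_glue]

/-- The bound on `m` is strict: the edge with index `n` ends the shorter travel, while in the longer
one it is still constrained by the next tile. -/
theorem carry_prefix {w w' : ℕ → D} {n n' m : ℕ} (p : ℕ → Bool) (hw : ∀ i < n, w i = w' i)
    (hn : n ≤ n') (hm : m < n) : T.carry w n p m = T.carry w' n' p m := by
  rcases Nat.eq_zero_or_pos m with rfl | hm0
  · rw [carry, carry, if_pos rfl, if_pos rfl, hw 0 hm]
  · obtain ⟨i, rfl⟩ : ∃ i, m = i + 1 := ⟨m - 1, by omega⟩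
    have h : T.Turns w i ↔ T.Turns w' i := by
      rw [Turns, Turns, hw i (by omega), hw (i + 1) hm]
    by_cases h' : T.Turns w i ↔ p i = true
    · rw [carry_of_lower hm h', carry_of_lower (by omega) (by rwa [← h]), hw (i + 1) hm]
    · rw [carry_of_not_lower hm h', carry_of_not_lower (by omega) (by rwa [← h]), hw i (by omega)]

variable (T) in
/-- `w` lists the crossings of a loop that follows a curve with `k` crossings, crosses the `l` ends
of arcs at the end point of the curve and then follows the curve backwards. -/
structure IsLoopWord (k l : ℕ) (w : ℕ → D) : Prop where
  pos : 0 < k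
  two_le : 2 ≤ l
  turn : ∀ i, i + 1 < 2 * k + l →
    w (i + 1) = T.next (T.glue (w i)) ∨ w (i + 1) = T.next (T.next (T.glue (w i)))
  mirror : ∀ i < k, w (2 * k + l - 1 - i) = T.glue (w i)
  turns_last : T.Turns w (k + l - 1) ↔ T.Turns w (k - 1)
  turns_around : ∀ i, k ≤ i → i + 1 < k + l → (T.Turns w i ↔ ¬ T.Turns w (k - 1))

variable (T) in
/-- `p` gives the signs of the diagonals for a symmetric matching of the snake graph of a loop. -/
structure IsLoopSign (k l : ℕ) (w : ℕ → D) (p : ℕ → Bool) : Prop where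
  admissible : T.Admissible w (2 * k + l) p
  mirror : ∀ i < k, p (2 * k + l - 1 - i) = p i
  support : ∀ i, 2 * k + l ≤ i → p i = false

variable (T) in
-- The edges `0` to `k + l - 1` are those left when the `k + 1` edges of the second copy are
-- removed.
noncomputable def prefixWeight (k l : ℕ) (w : ℕ → D) (p : ℕ → Bool) : T.Field :=
  ∏ m ∈ Finset.range (k + l), T.x (T.carry w (2 * k + l) p m)

variable (T) in
-- The edges `k + 1` to `2 * k + l` are those left when the `k + 1` edges of the first copy are
-- removed.
noncomputable def suffixWeight (k l : ℕ) (w : ℕ → D) (p : ℕ → Bool) : T.Field :=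
  ∏ m ∈ Finset.range (k + l), T.x (T.carry w (2 * k + l) p (k + 1 + m))

variable (T) in
open Classical in
/-- The normalized weight of a symmetric matching of the snake graph of a loop. -/
noncomputable def loopWeight (k l : ℕ) (w : ℕ → D) (p : ℕ → Bool) : T.Field :=
  if T.Turns w (k + l - 1) ↔ p (k + l - 1) = true then T.prefixWeight k l w p
  else T.suffixWeight k l w p

variable (T) in
/-- The normalized coefficient monomial of a symmetric matching of the snake graph of a loop. -/
noncomputable def loopCoeff (k l : ℕ) (w : ℕ → D) (p : ℕ → Bool) : T.Field :=
  ∏ m ∈ Finset.range (k + l), if p m then T.y (w m) else 1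

section

variable {k l : ℕ} {w : ℕ → D} {p : ℕ → Bool}

theorem IsLoopWord.turns_mirror (hw : T.IsLoopWord k l w) {i j : ℕ} (hi : i + 1 < k)
    (hij : i + j + 2 = 2 * k + l) : T.Turns w j ↔ ¬ T.Turns w i := by
  refine turns_of_reverse (hw.turn i (by omega)) ?_ ?_
  · rw [← hw.mirror (i + 1) hi]; congr 1; omega
  · rw [← hw.mirror i (by omega)]; congr 1; omega

theorem IsLoopWord.mid_eq (hw : T.IsLoopWord k l w) : w (k + l) = T.glue (w (k - 1)) := by
  have h := hw.pos
  rw [← hw.mirror (k - 1) (by omega)]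
  congr 1
  omega

theorem IsLoopSign.mid_eq (hw : T.IsLoopWord k l w) (hp : T.IsLoopSign k l w p) :
    p (k + l) = p (k - 1) := by
  have h := hw.pos
  rw [← hp.mirror (k - 1) (by omega)]
  congr 1
  omega

theorem IsLoopSign.carry_mirror (hw : T.IsLoopWord k l w) (hp : T.IsLoopSign k l w p) {m : ℕ}
    (hm : m < k) :
    T.carry w (2 * k + l) p (2 * k + l - m) = T.carry w (2 * k + l) p m := by
  have h2 := hw.two_le
  rcases Nat.eq_zero_or_pos m with rfl | hm0
  · have h3 := hw.mirror 0 hm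
    have h4 := hp.mirror 0 hm
    simp only [Nat.sub_zero] at h3 h4 ⊢
    rw [carry, if_neg (by omega), if_pos rfl, carry, if_pos rfl, h3, h4, upperSide, T.glue_glue]
  · obtain ⟨i, rfl⟩ : ∃ i, m = i + 1 := ⟨m - 1, by omega⟩
    obtain ⟨j, hj⟩ : ∃ j, 2 * k + l - (i + 1) = j + 1 := ⟨2 * k + l - (i + 2), by omega⟩
    rw [hj]
    refine carry_of_reverse (by omega) (by omega) (hw.turn i (by omega))
      (hp.admissible i (by omega)) ?_ ?_ ?_ ?_
    · rw [← hw.mirror (i + 1) hm]; congr 1; omega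
    · rw [← hw.mirror i (by omega)]; congr 1; omega
    · rw [← hp.mirror (i + 1) hm]; congr 1; omega
    · rw [← hp.mirror i (by omega)]; congr 1; omega

/-- All turns around the puncture agree, so the signs there form a monotone sequence. If the travel
misses the end of the first copy, the sign `p k` is extreme in the direction of monotonicity and
propagates to `p (k + l - 1)`, which makes the travel enter the second copy at its corner. -/
theorem IsLoopSign.restricts (hw : T.IsLoopWord k l w) (hp : T.IsLoopSign k l w p) :
    (T.Turns w (k - 1) ↔ p k = false) ∨ (T.Turns w (k + l - 1) ↔ p (k + l - 1) = true) := by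
  have h1 := hw.pos
  have h2 := hw.two_le
  by_cases h : T.Turns w (k - 1) ↔ p k = false
  · exact Or.inl h
  · right
    rw [hw.turns_last]
    have key : ∀ j < l, (T.Turns w (k - 1) ↔ p (k + j) = true) := by
      intro j
      induction j with
      | zero =>
        intro _
        rw [Nat.add_zero]
        revert h
        cases p k <;> simp
      | succ j ih =>
        intro hj
        have h3 := ih (by omega)
        have h4 := hp.admissible (k + j) (by omega)
        rw [hw.turns_around (k + j) (by omega) (by omega)] at h4
        rw [← add_assoc]
        revert h3 h4
        cases p (k + j) <;> cases p (k + j + 1) <;> by_cases h : T.Turns w (k - 1) <;> simp [h]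
    have := key (l - 1) (by omega)
    rwa [← Nat.add_sub_assoc (by omega)] at this

/-- The reflection `m ↦ 2 * k + l - m` matches the last `k` edges with the first `k`. What remains
are the ranges from `k + 1` to `k + l` and from `k` to `k + l - 1`. -/
theorem IsLoopSign.suffixWeight_mul (hw : T.IsLoopWord k l w) (hp : T.IsLoopSign k l w p) :
    T.suffixWeight k l w p * T.x (T.carry w (2 * k + l) p k) =
      T.prefixWeight k l w p * T.x (T.carry w (2 * k + l) p (k + l)) := by
  have h3 : ∏ m ∈ Finset.range k, T.x (T.carry w (2 * k + l) p (k + 1 + (l + m))) =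
      ∏ m ∈ Finset.range k, T.x (T.carry w (2 * k + l) p m) := by
    rw [← Finset.prod_range_reflect]
    refine Finset.prod_congr rfl fun m hm => ?_
    have hm' := Finset.mem_range.1 hm
    rw [← hp.carry_mirror hw hm']
    congr 2
    omega
  have h4 : (∏ m ∈ Finset.range l, T.x (T.carry w (2 * k + l) p (k + 1 + m))) *
      T.x (T.carry w (2 * k + l) p k) =
      (∏ m ∈ Finset.range l, T.x (T.carry w (2 * k + l) p (k + m))) *
        T.x (T.carry w (2 * k + l) p (k + l)) := by
    rw [← Finset.prod_range_succ (fun m => T.x (T.carry w (2 * k + l) p (k + m))),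
      Finset.prod_range_succ']
    congr 1
    refine Finset.prod_congr rfl fun m _ => ?_
    congr 2
    omega
  have h5 : T.suffixWeight k l w p =
      (∏ m ∈ Finset.range l, T.x (T.carry w (2 * k + l) p (k + 1 + m))) *
        ∏ m ∈ Finset.range k, T.x (T.carry w (2 * k + l) p m) := by
    rw [suffixWeight, Nat.add_comm k l, Finset.prod_range_add, h3]
  rw [h5, prefixWeight, Finset.prod_range_add, mul_right_comm, h4]
  ring

/-- This is the independence of the copy: if both can be used, the edges `k` and `k + l` are mirror
images and carry the same side. -/
theorem IsLoopSign.prefixWeight_eq_suffixWeight (hw : T.IsLoopWord k l w)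
    (hp : T.IsLoopSign k l w p) (h0 : T.Turns w (k - 1) ↔ p k = false)
    (h1 : T.Turns w (k + l - 1) ↔ p (k + l - 1) = true) :
    T.prefixWeight k l w p = T.suffixWeight k l w p := by
  have hk := hw.pos
  have hl := hw.two_le
  have e1 : k - 1 + 1 = k := by omega
  have e2 : k + l - 1 + 1 = k + l := by omega
  have hkl : T.carry w (2 * k + l) p k = T.carry w (2 * k + l) p (k + l) := by
    have h2 := carry_of_upper (T := T) (n := 2 * k + l) (p := p) (i := k - 1) (by omega)
      (hw.turn _ (by omega)) (by rwa [e1])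
    have h3 := carry_of_lower (T := T) (n := 2 * k + l) (p := p) (i := k + l - 1) (by omega) h1
    rw [e1] at h2
    rw [e2] at h3
    rw [h2, h3, hw.mid_eq, hp.mid_eq hw, upperSide]
  have h2 := hp.suffixWeight_mul hw
  rw [hkl] at h2
  exact (mul_right_cancel₀ (x_ne_zero _) h2).symm

theorem IsLoopSign.loopWeight_of_lower
    (h : T.Turns w (k + l - 1) ↔ p (k + l - 1) = true) :
    T.loopWeight k l w p = T.prefixWeight k l w p := if_pos h

theorem IsLoopSign.loopWeight_of_upper (hw : T.IsLoopWord k l w) (hp : T.IsLoopSign k l w p)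
    (h : T.Turns w (k - 1) ↔ p k = false) :
    T.loopWeight k l w p = T.suffixWeight k l w p := by
  rw [loopWeight]
  split_ifs with h1
  · exact hp.prefixWeight_eq_suffixWeight hw h h1
  · rfl

/-! ### The loop in the opposite direction -/

variable {w' : ℕ → D}

/-- The signs in the opposite order. -/
def reverseSign (n : ℕ) (p : ℕ → Bool) (i : ℕ) : Bool := if i < n then p (n - 1 - i) else false

theorem reverseSign_of_lt {n i : ℕ} (p : ℕ → Bool) (hi : i < n) :
    reverseSign n p i = p (n - 1 - i) := if_pos hi

theorem IsLoopSign.reverseSign_reverseSign (hp : T.IsLoopSign k l w p) :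
    reverseSign (2 * k + l) (reverseSign (2 * k + l) p) = p := by
  funext i
  by_cases hi : i < 2 * k + l
  · rw [reverseSign_of_lt _ hi, reverseSign_of_lt _ (by omega)]
    congr 1
    omega
  · rw [reverseSign, if_neg hi, hp.support i (by omega)]

theorem IsLoopWord.turns_reverse (hw : T.IsLoopWord k l w)
    (hww : ∀ i < 2 * k + l, w' i = T.glue (w (2 * k + l - 1 - i))) {i j : ℕ}
    (hij : i + j + 2 = 2 * k + l) : T.Turns w' j ↔ ¬ T.Turns w i := by
  refine turns_of_reverse (hw.turn i (by omega)) ?_ ?_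
  · rw [hww j (by omega)]; congr 2; omega
  · rw [hww (j + 1) (by omega)]; congr 2; omega

theorem IsLoopSign.reverse (hw : T.IsLoopWord k l w) (hp : T.IsLoopSign k l w p)
    (hww : ∀ i < 2 * k + l, w' i = T.glue (w (2 * k + l - 1 - i))) :
    T.IsLoopSign k l w' (reverseSign (2 * k + l) p) where
  admissible j hj := by
    obtain ⟨i, hij⟩ : ∃ i, i + j + 2 = 2 * k + l := ⟨2 * k + l - (j + 2), by omega⟩
    rw [hw.turns_reverse hww hij, reverseSign_of_lt _ (by omega), reverseSign_of_lt _ hj,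
      show 2 * k + l - 1 - j = i + 1 by omega, show 2 * k + l - 1 - (j + 1) = i by omega]
    have := hp.admissible i (by omega)
    revert this
    cases p i <;> cases p (i + 1) <;> simp <;> tauto
  mirror i hi := by
    rw [reverseSign_of_lt _ (by omega), reverseSign_of_lt _ (by omega), hp.mirror i hi]
    congr 1
    omega
  support i hi := if_neg (by omega)

theorem IsLoopSign.carry_reverse (hw : T.IsLoopWord k l w) (hp : T.IsLoopSign k l w p)
    (hww : ∀ i < 2 * k + l, w' i = T.glue (w (2 * k + l - 1 - i))) {m m' : ℕ}
    (hm : m + m' = 2 * k + l) :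
    T.carry w' (2 * k + l) (reverseSign (2 * k + l) p) m = T.carry w (2 * k + l) p m' := by
  have hk := hw.pos
  rcases Nat.eq_zero_or_pos m with rfl | hm0
  · rw [carry, if_pos rfl, carry, if_neg (by omega), if_pos (by omega), hww 0 (by omega),
      reverseSign_of_lt _ (by omega), upperSide]
    rfl
  · rcases Nat.eq_zero_or_pos m' with rfl | hm0'
    · rw [carry, if_neg (by omega), if_pos (by omega), carry, if_pos rfl, hww _ (by omega),
        reverseSign_of_lt _ (by omega), upperSide, T.glue_glue]
      simp
    · obtain ⟨j, rfl⟩ : ∃ j, m = j + 1 := ⟨m - 1, by omega⟩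
      obtain ⟨i, rfl⟩ : ∃ i, m' = i + 1 := ⟨m' - 1, by omega⟩
      refine carry_of_reverse (by omega) (by omega) (hw.turn i (by omega))
        (hp.admissible i (by omega)) ?_ ?_ ?_ ?_
      · rw [hww j (by omega)]; congr 2; omega
      · rw [hww (j + 1) (by omega)]; congr 2; omega
      · rw [reverseSign_of_lt _ (by omega)]; congr 1; omega
      · rw [reverseSign_of_lt _ (by omega)]; congr 1; omega

/-- Reversal exchanges the prefix with the suffix, and the condition for using one copy with that
for the other. -/
theorem IsLoopSign.loopWeight_reverse (hw : T.IsLoopWord k l w) (hp : T.IsLoopSign k l w p)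
    (hww : ∀ i < 2 * k + l, w' i = T.glue (w (2 * k + l - 1 - i))) :
    T.loopWeight k l w' (reverseSign (2 * k + l) p) = T.loopWeight k l w p := by
  have hk := hw.pos
  have hl := hw.two_le
  have h1 : T.prefixWeight k l w' (reverseSign (2 * k + l) p) = T.suffixWeight k l w p := by
    rw [prefixWeight, suffixWeight, ← Finset.prod_range_reflect]
    refine Finset.prod_congr rfl fun m hm => ?_
    have hm' := Finset.mem_range.1 hm
    rw [hp.carry_reverse hw hww (m' := k + 1 + m) (by omega)]
  have h2 : T.suffixWeight k l w' (reverseSign (2 * k + l) p) = T.prefixWeight k l w p := by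
    rw [prefixWeight, suffixWeight, ← Finset.prod_range_reflect]
    refine Finset.prod_congr rfl fun m hm => ?_
    have hm' := Finset.mem_range.1 hm
    rw [hp.carry_reverse hw hww (m' := m) (by omega)]
  have h3 : (T.Turns w' (k + l - 1) ↔ reverseSign (2 * k + l) p (k + l - 1) = true) ↔
      (T.Turns w (k - 1) ↔ p k = false) := by
    rw [hw.turns_reverse hww (i := k - 1) (by omega), reverseSign_of_lt _ (by omega),
      show 2 * k + l - 1 - (k + l - 1) = k by omega]
    cases p k <;> simp
  rw [loopWeight, h1, h2]
  split_ifs with h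
  · exact (hp.loopWeight_of_upper hw (h3.1 h)).symm
  · exact (IsLoopSign.loopWeight_of_lower
      ((hp.restricts hw).resolve_left fun h' => h (h3.2 h'))).symm

/-- The tiles around the puncture are permuted among themselves; the first `k` tiles become the last
`k`, which carry the same signs by symmetry. -/
theorem IsLoopSign.loopCoeff_reverse (hw : T.IsLoopWord k l w) (hp : T.IsLoopSign k l w p)
    (hww : ∀ i < 2 * k + l, w' i = T.glue (w (2 * k + l - 1 - i))) :
    T.loopCoeff k l w' (reverseSign (2 * k + l) p) = T.loopCoeff k l w p := by
  have hl := hw.two_le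
  have h1 : ∀ m < 2 * k + l, (if reverseSign (2 * k + l) p m then T.y (w' m) else 1) =
      if p (2 * k + l - 1 - m) then T.y (w (2 * k + l - 1 - m)) else 1 := by
    intro m hm
    rw [reverseSign_of_lt _ hm, hww m hm, y_glue]
  rw [loopCoeff, loopCoeff, Finset.prod_range_add, Finset.prod_range_add]
  congr 1
  · refine Finset.prod_congr rfl fun m hm => ?_
    have hm' := Finset.mem_range.1 hm
    rw [h1 m (by omega), hp.mirror m hm', hw.mirror m hm', y_glue]
  · rw [← Finset.prod_range_reflect]
    refine Finset.prod_congr rfl fun m hm => ?_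
    have hm' := Finset.mem_range.1 hm
    rw [h1 _ (by omega), show 2 * k + l - 1 - (k + (l - 1 - m)) = k + m by omega]

/-- Symmetric signs for a loop correspond to those for the loop in the opposite direction. -/
def loopSignReverse (hw : T.IsLoopWord k l w) (hw' : T.IsLoopWord k l w')
    (hww : ∀ i < 2 * k + l, w' i = T.glue (w (2 * k + l - 1 - i))) :
    {p // T.IsLoopSign k l w p} ≃ {p // T.IsLoopSign k l w' p} where
  toFun p := ⟨reverseSign (2 * k + l) p.1, p.2.reverse hw hww⟩
  invFun p := ⟨reverseSign (2 * k + l) p.1, p.2.reverse hw' fun i hi => by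
    rw [hww _ (by omega), T.glue_glue]
    congr 1
    omega⟩
  left_inv p := Subtype.ext p.2.reverseSign_reverseSign
  right_inv p := Subtype.ext p.2.reverseSign_reverseSign

/-! ### Signs for the hook -/

/-- After going around the puncture the curve is back in the last triangle of the arc. Its three
sides are the one just entered, the one opposite the puncture, which is crossed next, and `w k`; so
`w k` is on the edge shared with the tile `k + l`. -/
theorem IsLoopWord.upperSide_last_eq_iff (hw : T.IsLoopWord k l w) (q : Bool) :
    T.upperSide (w (k + l - 1)) q = w k ↔ (T.Turns w (k + l - 1) ↔ q = true) := by
  have hk := hw.pos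
  have hl := hw.two_le
  have h1 := hw.turn (k - 1) (by omega)
  have h2 := hw.turn (k + l - 1) (by omega)
  have h3 := hw.turns_last
  have e1 : k - 1 + 1 = k := by omega
  have e2 : k + l - 1 + 1 = k + l := by omega
  rw [Turns, Turns, e1, e2] at h3
  rw [Turns, e2]
  rw [e1] at h1
  rw [e2] at h2
  rw [hw.mid_eq] at *
  have n1 := T.next_ne (T.next (T.glue (w (k + l - 1))))
  have n2 := T.next_ne (T.next (T.glue (w (k - 1))))
  rcases h2 with h2 | h2
  · have h4 := h3.1 h2
    rw [h4, h2]
    cases q <;> simp [upperSide, lowerSide, n1.symm]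
  · have h4 : w k = T.next (T.next (T.glue (w (k - 1)))) := by
      refine h1.resolve_left fun h => ?_
      rw [h3.2 h] at h2
      exact n1 h2.symm
    rw [h4, h2]
    cases q <;> simp [upperSide, lowerSide, n1, T.next_next_next]

/-- At the tile `k - 1`, in contrast, `w k` is the exit, which lies on the upper edge that is not
shared with the tile `k`. -/
theorem IsLoopWord.upperSide_eq_iff (hw : T.IsLoopWord k l w) (q : Bool) :
    T.upperSide (w (k - 1)) q = w k ↔ (T.Turns w (k - 1) ↔ q = false) := by
  have hk := hw.pos
  have hl := hw.two_le
  have h1 := hw.turn (k - 1) (by omega)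
  have e1 : k - 1 + 1 = k := by omega
  have n1 := T.next_ne (T.next (T.glue (w (k - 1))))
  rw [Turns, e1]
  rw [e1] at h1
  rcases h1 with h1 | h1 <;> rw [h1] <;> cases q <;>
    simp [upperSide, lowerSide, n1, n1.symm]

/-- This is admissibility where the loop starts back along the arc, with the sign of the tile `k +
l` replaced by that of its mirror image. -/
theorem IsLoopSign.closes (hw : T.IsLoopWord k l w) (hp : T.IsLoopSign k l w p) :
    (T.Turns w (k + l - 1) ↔ p (k + l - 1) = true) ∨ (T.Turns w (k - 1) ↔ p (k - 1) = false) := by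
  have hk := hw.pos
  have h1 := hp.admissible (k + l - 1) (by omega)
  rw [show k + l - 1 + 1 = k + l by omega, hp.mid_eq hw] at h1
  rcases h1 with h | h
  · exact Or.inl h
  · right
    rwa [← hw.turns_last]

theorem IsLoopSign.ext_of_lt {q : ℕ → Bool} (hp : T.IsLoopSign k l w p)
    (hq : T.IsLoopSign k l w q) (h : ∀ i < k + l, p i = q i) : p = q := by
  funext i
  by_cases h1 : i < k + l
  · exact h i h1
  · by_cases h2 : i < 2 * k + l
    · have h3 := hp.mirror (2 * k + l - 1 - i) (by omega)
      have h4 := hq.mirror (2 * k + l - 1 - i) (by omega)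
      rw [show 2 * k + l - 1 - (2 * k + l - 1 - i) = i by omega] at h3 h4
      rw [h3, h4, h _ (by omega)]
    · rw [hp.support i (by omega), hq.support i (by omega)]

/-- Extension by reflection: under reversal the constraints on the first `k` tiles become those on
the last `k`, and `h` is the single new constraint at the junction. -/
theorem IsLoopWord.exists_isLoopSign (hw : T.IsLoopWord k l w) (hp : T.Admissible w (k + l) p)
    (h : (T.Turns w (k + l - 1) ↔ p (k + l - 1) = true) ∨
      (T.Turns w (k - 1) ↔ p (k - 1) = false)) :
    ∃ q, T.IsLoopSign k l w q ∧ ∀ i < k + l, q i = p i := by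
  have hk := hw.pos
  have hl := hw.two_le
  let q : ℕ → Bool := fun i =>
    if i < k + l then p i else if i < 2 * k + l then p (2 * k + l - 1 - i) else false
  have q1 : ∀ i < k + l, q i = p i := fun i hi => if_pos hi
  have q2 : ∀ i, i < k → q (2 * k + l - 1 - i) = p i := by
    intro i h1
    simp only [q]
    rw [if_neg (by omega), if_pos (by omega)]
    congr 1
    omega
  refine ⟨q, ⟨fun i hi => ?_, fun i hi => ?_, fun i hi => ?_⟩, q1⟩
  · rcases lt_trichotomy (i + 1) (k + l) with h1 | h1 | h1
    · rw [q1 _ h1, q1 i (by omega)]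
      exact hp i h1
    -- The junction, where the tile `k + l` has the sign of the tile `k - 1`.
    · obtain rfl : i = k + l - 1 := by omega
      have h2 := q2 (k - 1) (by omega)
      rw [show 2 * k + l - 1 - (k - 1) = k + l - 1 + 1 by omega] at h2
      rw [h2, q1 _ (by omega)]
      rcases h with h | h
      · exact Or.inl h
      · right
        rwa [hw.turns_last]
    · obtain ⟨j, hj⟩ : ∃ j, j + i + 2 = 2 * k + l := ⟨2 * k + l - (i + 2), by omega⟩
      have h2 := q2 j (by omega)
      have h3 := q2 (j + 1) (by omega)
      rw [show 2 * k + l - 1 - j = i + 1 by omega] at h2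
      rw [show 2 * k + l - 1 - (j + 1) = i by omega] at h3
      rw [hw.turns_mirror (by omega) hj, h2, h3]
      have := hp j (by omega)
      revert this
      cases p j <;> cases p (j + 1) <;> simp <;> tauto
  · rw [q2 i hi, q1 i (by omega)]
  · simp only [q]
    rw [if_neg (by omega), if_neg (by omega)]

end

end IdealTriangulation

/-! ### The enclosing loop: its word, its symmetric matchings and their normalized monomials. -/

namespace IdealTriangulation

open PlanePoint SnakeGraph LabelledSnakeGraph

variable {D : Type*} {T : IdealTriangulation D}

theorem isTiled_snakeGraph (r : ℤˣ) {n : ℕ} {w : ℕ → D} (h : ∀ i, i + 1 < n →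
    w (i + 1) = T.next (T.glue (w i)) ∨ w (i + 1) = T.next (T.next (T.glue (w i)))) :
    T.IsTiled (T.snakeGraph r n w) where
  turn := h
  rel_succ i _ := by
    change r * (-1) ^ (i + 1) = -(r * (-1) ^ i)
    rw [pow_succ]
    simp
  corner_succ _ _ := rfl

theorem upperSide_eq_tileSide (r : ℤˣ) (d : D) (q : Bool) :
    T.upperSide d q = T.tileSide r d .N ∨ T.upperSide d q = T.tileSide r d .E := by
  rcases Int.units_eq_one_or r with rfl | rfl <;> cases q <;> simp [upperSide, lowerSide, tileSide]

namespace SinglyNotchedArc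

variable (γ : SinglyNotchedArc T)

/-! ### The crossings around the puncture -/

theorem rot_pow_deg : (T.rot ^ γ.deg) γ.endCorner = γ.endCorner := by
  rw [← Equiv.Perm.iterate_eq_pow]
  exact Function.iterate_minimalPeriod

theorem rot_inv_pow {j : ℕ} (hj : j ≤ γ.deg) :
    (T.rot⁻¹ ^ j) γ.endCorner = (T.rot ^ (γ.deg - j)) γ.endCorner := by
  rw [inv_pow, Equiv.Perm.inv_eq_iff_eq, ← Equiv.Perm.mul_apply, ← pow_add,
    Nat.add_sub_cancel' hj, rot_pow_deg]

/-- At a puncture of degree one, `rot` fixes the corner, so its two sides are glued to each other: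
the triangle is self-folded and encloses the puncture. -/
theorem two_le_deg [Finite D] (hp : ¬ T.IsEnclosedBySelfFolded γ.endCorner) : 2 ≤ γ.deg := by
  by_contra h
  have h1 := γ.deg_pos
  have h2 : γ.deg = 1 := by omega
  have h3 := γ.rot_pow_deg
  rw [h2, pow_one] at h3
  refine hp ⟨γ.endCorner, Relation.EqvGen.refl _, ?_⟩
  conv_lhs => rw [← h3]
  exact T.glue_glue _

theorem around_succ (j : ℕ) : γ.around true (j + 1) = T.next (T.glue (γ.around true j)) := by
  simp only [around, if_true]
  rw [pow_succ', Equiv.Perm.mul_apply]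
  rfl

theorem around_false_succ (j : ℕ) :
    γ.around false (j + 1) = T.next (T.next (T.glue (γ.around false j))) := by
  simp only [around, Bool.false_eq_true, if_false]
  rw [pow_succ', Equiv.Perm.mul_apply, Equiv.Perm.inv_eq_iff_eq]
  change _ = T.glue (T.next _)
  rw [T.next_next_next, T.glue_glue]

/-- Going around the other way crosses the same ends of arcs in the opposite order and from the
other side. -/
theorem around_not (b : Bool) {j : ℕ} (hj : j < γ.deg) :
    γ.around (!b) j = T.glue (γ.around b (γ.deg - 1 - j)) := by
  have key : ∀ j < γ.deg, γ.around false j = T.glue (γ.around true (γ.deg - 1 - j)) := by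
    intro j hj
    simp only [around, Bool.false_eq_true, if_false, if_true]
    rw [γ.rot_inv_pow hj.le, show γ.deg - j = (γ.deg - 1 - j) + 1 by omega, pow_succ',
      Equiv.Perm.mul_apply]
    rfl
  cases b
  · rw [Bool.not_false, key _ (by omega), T.glue_glue]
    congr 1
    omega
  · exact key j hj

theorem glue_around_last (hl : 2 ≤ γ.deg) (b : Bool) :
    T.glue (γ.around b (γ.deg - 1)) = γ.around (!b) 0 := by
  rw [γ.around_not b (by omega), Nat.sub_zero]

theorem loopCross_of_lt (b : Bool) {i : ℕ} (hi : i < γ.len) : γ.loopCross b i = γ.cross i := by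
  rw [loopCross, if_pos (by omega), hookedCross, if_pos hi]

theorem loopCross_around (b : Bool) {j : ℕ} (hj : j < γ.deg) :
    γ.loopCross b (γ.len + j) = γ.around b j := by
  rw [loopCross, if_pos (by omega), hookedCross, if_neg (by omega), Nat.add_sub_cancel_left]

theorem loopCross_mirror (b : Bool) {i : ℕ} (hi : i < γ.len) :
    γ.loopCross b (2 * γ.len + γ.deg - 1 - i) = T.glue (γ.cross i) := by
  rw [loopCross, if_neg (by omega)]
  congr 2
  omega

theorem loopCross_not (b : Bool) {i : ℕ} (hi : i < 2 * γ.len + γ.deg) :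
    γ.loopCross (!b) i = T.glue (γ.loopCross b (2 * γ.len + γ.deg - 1 - i)) := by
  by_cases h1 : i < γ.len
  · rw [γ.loopCross_mirror b h1, T.glue_glue, γ.loopCross_of_lt _ h1]
  · by_cases h2 : i < γ.len + γ.deg
    · obtain ⟨j, rfl⟩ := Nat.exists_eq_add_of_le (not_lt.1 h1)
      rw [γ.loopCross_around _ (by omega), show 2 * γ.len + γ.deg - 1 - (γ.len + j) =
        γ.len + (γ.deg - 1 - j) by omega, γ.loopCross_around b (by omega),
        γ.around_not b (by omega)]
    · obtain ⟨j, hj, rfl⟩ : ∃ j < γ.len, i = 2 * γ.len + γ.deg - 1 - j :=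
        ⟨2 * γ.len + γ.deg - 1 - i, by omega, by omega⟩
      rw [γ.loopCross_mirror _ hj, show 2 * γ.len + γ.deg - 1 - (2 * γ.len + γ.deg - 1 - j) = j by
        omega, γ.loopCross_of_lt b hj]

theorem turns_loopCross_before (hl : 2 ≤ γ.deg) (b : Bool) :
    T.Turns (γ.loopCross b) (γ.len - 1) ↔ b = false := by
  have h0 := γ.len_pos
  have h1 := T.next_ne (T.next (T.glue (γ.cross (γ.len - 1))))
  rw [Turns, show γ.len - 1 + 1 = γ.len + 0 by omega, γ.loopCross_around b (by omega),
    γ.loopCross_of_lt b (by omega)]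
  cases b
  · simp [around, Curve.endCorner]
  · simpa [around, Curve.endCorner] using h1

theorem turns_loopCross_around (b : Bool) {j : ℕ} (hj : j + 1 < γ.deg) :
    T.Turns (γ.loopCross b) (γ.len + j) ↔ b = true := by
  rw [Turns, add_assoc, γ.loopCross_around b hj, γ.loopCross_around b (by omega)]
  cases b
  · rw [around_false_succ]
    simpa using T.next_ne _
  · simp [around_succ]

theorem turns_loopCross_after (hl : 2 ≤ γ.deg) (b : Bool) :
    T.Turns (γ.loopCross b) (γ.len + γ.deg - 1) ↔ b = false := by
  have h0 := γ.len_pos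
  have h1 := T.next_next_ne (T.glue (γ.cross (γ.len - 1)))
  have h2 := γ.loopCross_mirror b (i := γ.len - 1) (by omega)
  rw [show 2 * γ.len + γ.deg - 1 - (γ.len - 1) = γ.len + γ.deg by omega] at h2
  rw [Turns, show γ.len + γ.deg - 1 + 1 = γ.len + γ.deg by omega, h2,
    Nat.add_sub_assoc (by omega), γ.loopCross_around b (by omega), γ.glue_around_last hl b]
  cases b
  · simp [around, Curve.endCorner, T.next_next_next]
  · simpa [around, Curve.endCorner] using h1.symm

/-- Around the puncture the curve always cuts off the corner at the puncture, so all turns agree. On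
entering and leaving this fan it cuts off another corner of the last triangle, with the puncture on
the same side as before, so it turns the other way. -/
theorem isLoopWord (hl : 2 ≤ γ.deg) (b : Bool) :
    T.IsLoopWord γ.len γ.deg (γ.loopCross b) where
  pos := γ.len_pos
  two_le := hl
  turn i hi := by
    have h0 := γ.len_pos
    have key : ∀ b, ∀ i, i < γ.len + γ.deg - 1 →
        γ.loopCross b (i + 1) = T.next (T.glue (γ.loopCross b i)) ∨
        γ.loopCross b (i + 1) = T.next (T.next (T.glue (γ.loopCross b i))) := by
      intro b i hi
      rcases lt_trichotomy (i + 1) γ.len with h | h | h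
      · rw [γ.loopCross_of_lt b h, γ.loopCross_of_lt b (by omega)]
        exact γ.turn i h
      · obtain rfl : i = γ.len - 1 := by omega
        rw [show γ.len - 1 + 1 = γ.len + 0 by omega, γ.loopCross_around b (by omega),
          γ.loopCross_of_lt b (by omega)]
        cases b
        · exact Or.inl rfl
        · exact Or.inr rfl
      · obtain ⟨j, rfl⟩ := Nat.exists_eq_add_of_le (show γ.len ≤ i by omega)
        rw [add_assoc, γ.loopCross_around b (by omega), γ.loopCross_around b (by omega)]
        cases b
        · exact Or.inr (γ.around_false_succ j)
        · exact Or.inl (γ.around_succ j)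
    by_cases h : i < γ.len + γ.deg - 1
    · exact key b i h
    -- The remaining turns are those of the loop with the other direction, traversed backwards.
    · have h1 := γ.loopCross_not (!b) (i := i) (by omega)
      have h2 := γ.loopCross_not (!b) (i := i + 1) hi
      rw [Bool.not_not] at h1 h2
      obtain ⟨j, hj⟩ : ∃ j, j + i + 2 = 2 * γ.len + γ.deg := ⟨2 * γ.len + γ.deg - (i + 2), by omega⟩
      rw [show 2 * γ.len + γ.deg - 1 - i = j + 1 by omega] at h1
      rw [show 2 * γ.len + γ.deg - 1 - (i + 1) = j by omega] at h2
      rw [h1, h2, T.glue_glue]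
      rcases key (!b) j (by omega) with h3 | h3
      · right
        rw [h3, T.next_next_next]
      · left
        rw [h3, T.next_next_next]
  mirror i hi := by rw [γ.loopCross_mirror b hi, γ.loopCross_of_lt b hi]
  turns_last := by rw [γ.turns_loopCross_after hl, γ.turns_loopCross_before hl]
  turns_around i h1 h2 := by
    obtain ⟨j, rfl⟩ := Nat.exists_eq_add_of_le h1
    rw [γ.turns_loopCross_around b (by omega), γ.turns_loopCross_before hl]
    simp

/-! ### Symmetric matchings -/

theorem isTiled_snakeLoop (hl : 2 ≤ γ.deg) (b : Bool) (r : ℤˣ) : T.IsTiled (γ.snakeLoop b r) :=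
  isTiled_snakeGraph r (γ.isLoopWord hl b).turn

/-- Crossing from the other side exchanges the two triangles. The relative orientations multiply to
`(-1) ^ (j + j')`, and `j + j'` is even exactly if the degree is odd. -/
theorem tileSide_flipSide (r : ℤˣ) {j j' : ℕ} (h : j + j' + 1 = 2 * γ.len + γ.deg) (d : D)
    (s : Side) : T.tileSide (r * (-1) ^ j') (T.glue d) (γ.flipSide s) =
      T.tileSide (r * (-1) ^ j) d s := by
  have h1 : ((-1 : ℤˣ) ^ j) * (-1) ^ j' = if Odd γ.deg then 1 else -1 := by
    rw [← pow_add]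
    split_ifs with hd
    · exact Even.neg_one_pow (by obtain ⟨m, hm⟩ := hd; exact ⟨γ.len + m, by omega⟩)
    · rw [Nat.not_odd_iff_even] at hd
      exact Odd.neg_one_pow (by obtain ⟨m, hm⟩ := hd; exact ⟨(j + j') / 2, by omega⟩)
  have hne : ((-1 : ℤˣ) = 1) = False := by decide
  have hne' : ((1 : ℤˣ) = -1) = False := by decide
  rcases Int.units_eq_one_or ((-1) ^ j) with h2 | h2 <;>
    rcases Int.units_eq_one_or ((-1) ^ j') with h3 | h3 <;>
    rcases Int.units_eq_one_or r with h4 | h4 <;>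
    by_cases hd : Odd γ.deg <;> simp [h2, h3, hd, hne, hne'] at h1 <;>
    cases s <;> simp [tileSide, flipSide, h2, h3, h4, hd, hne, T.glue_glue]

theorem ne_corner_mem_edge_iff (b : Bool) (r : ℤˣ) {j : ℕ} (hj : j < γ.len) (s : Side) :
    Tile.ne ((γ.snakeLoop b r).corner (γ.len - 1)) ∈ Tile.edge ((γ.snakeLoop b r).corner j) s ↔
      j + 1 = γ.len ∧ (s = .N ∨ s = .E) := by
  have h0 := γ.len_pos
  have hlen : (γ.snakeLoop b r).len = 2 * γ.len + γ.deg := rfl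
  have h1 := level_corner (γ.snakeLoop b r).toSnakeGraph (i := j) (by omega)
  have h2 := level_corner (γ.snakeLoop b r).toSnakeGraph (i := γ.len - 1) (by omega)
  constructor
  · intro h
    simp only [level] at h1 h2
    cases s <;> rcases Sym2.mem_iff.1 h with h | h <;>
      simp only [Tile.ne, Tile.nw, Tile.se, Tile.sw, Prod.ext_iff] at h <;>
      first
      | (exfalso; omega)
      | exact ⟨by omega, by simp⟩
  · rintro ⟨h, rfl | rfl⟩
    · rw [show γ.len - 1 = j by omega]
      exact Sym2.mem_mk_right _ _
    · rw [show γ.len - 1 = j by omega]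
      exact Sym2.mem_mk_right _ _

theorem flipSide_lower {s : Side} (hs : s = .S ∨ s = .W) :
    γ.flipSide s = .N ∨ γ.flipSide s = .E := by
  rcases hs with rfl | rfl <;> simp only [flipSide] <;> split_ifs <;> simp

theorem flipSide_upper {s : Side} (hs : s = .N ∨ s = .E) :
    γ.flipSide s = .S ∨ γ.flipSide s = .W := by
  rcases hs with rfl | rfl <;> simp only [flipSide] <;> split_ifs <;> simp

theorem exists_tileSide_lower (r : ℤˣ) (d : D) (q : Bool) :
    ∃ s, (s = Side.S ∨ s = Side.W) ∧ T.tileSide r d s = T.lowerSide d q := by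
  rcases Int.units_eq_one_or r with rfl | rfl <;> cases q
  · exact ⟨.S, by simp [tileSide, lowerSide]⟩
  · exact ⟨.W, by simp [tileSide, lowerSide]⟩
  · exact ⟨.W, by simp [tileSide, lowerSide]⟩
  · exact ⟨.S, by simp [tileSide, lowerSide]⟩

section

variable {γ} {b : Bool} {r : ℤˣ} {p : ℕ → Bool}

theorem flip_mem_iff_of_lower {j j' : ℕ}
    (hj : j < γ.len) (hjj : j + j' + 1 = 2 * γ.len + γ.deg) {s : Side} (hs : s = .S ∨ s = .W) :
    Tile.edge ((γ.snakeLoop b r).corner j') (γ.flipSide s) ∈ (γ.snakeLoop b r).signMatching p ↔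
      T.tileSide (r * (-1) ^ j) (γ.loopCross b j) s = T.lowerSide (γ.loopCross b j) (p j') ∧
        (γ.snakeLoop b r).arr ((γ.snakeLoop b r).down p) (j' + 1) =
          Tile.ne ((γ.snakeLoop b r).corner j') := by
  rw [IsTiled.edge_mem_signMatching_of_upper (T := T) (by change j' < 2 * γ.len + γ.deg; omega)
    (γ.flipSide_lower hs)]
  refine and_congr_left fun _ => ?_
  have h1 : (γ.snakeLoop b r).diag j' = T.glue (γ.loopCross b j) := by
    rw [γ.loopCross_of_lt b hj, ← γ.loopCross_mirror b hj]
    change γ.loopCross b j' = _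
    congr 1
    omega
  rw [h1, upperSide, T.glue_glue]
  change T.tileSide (r * (-1) ^ j') _ _ = _ ↔ _
  rw [γ.tileSide_flipSide r hjj]

theorem flip_mem_iff_of_upper {j j' : ℕ}
    (hj : j < γ.len) (hjj : j + j' + 1 = 2 * γ.len + γ.deg) {s : Side} (hs : s = .N ∨ s = .E) :
    Tile.edge ((γ.snakeLoop b r).corner j') (γ.flipSide s) ∈ (γ.snakeLoop b r).signMatching p ↔
      T.tileSide (r * (-1) ^ j) (γ.loopCross b j) s = T.upperSide (γ.loopCross b j) (p j') ∧
        (γ.snakeLoop b r).dep ((γ.snakeLoop b r).down p) j' =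
          Tile.sw ((γ.snakeLoop b r).corner j') := by
  rw [IsTiled.edge_mem_signMatching_of_lower (T := T) (by change j' < 2 * γ.len + γ.deg; omega)
    (γ.flipSide_upper hs)]
  refine and_congr_left fun _ => ?_
  have h1 : (γ.snakeLoop b r).diag j' = T.glue (γ.loopCross b j) := by
    rw [γ.loopCross_of_lt b hj, ← γ.loopCross_mirror b hj]
    change γ.loopCross b j' = _
    congr 1
    omega
  rw [h1, upperSide]
  change T.tileSide (r * (-1) ^ j') _ _ = _ ↔ _
  rw [γ.tileSide_flipSide r hjj]

/-- The tiles of the first copy and the corresponding tiles of the second copy have the same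
lower, respectively upper, edges in the matching. -/
theorem dep_eq_iff_arr_eq (hl : 2 ≤ γ.deg) {j j' : ℕ} (hj : j < γ.len)
    (hjj : j + j' + 1 = 2 * γ.len + γ.deg) (hp : ∀ i, i + 1 = j → p (j' + 1) = p i) :
    (γ.snakeLoop b r).dep ((γ.snakeLoop b r).down p) j =
      Tile.sw ((γ.snakeLoop b r).corner j) ↔
    (γ.snakeLoop b r).arr ((γ.snakeLoop b r).down p) (j' + 1) =
      Tile.ne ((γ.snakeLoop b r).corner j') := by
  have hlen : (γ.snakeLoop b r).len = 2 * γ.len + γ.deg := rfl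
  rcases Nat.eq_zero_or_pos j with rfl | hj0
  · refine iff_of_true rfl ?_
    have h1 := arr_len (G := (γ.snakeLoop b r).toSnakeGraph) ((γ.snakeLoop b r).down p)
    rw [show (γ.snakeLoop b r).len = j' + 1 by omega] at h1
    exact h1
  · obtain ⟨i, rfl⟩ : ∃ i, j = i + 1 := ⟨j - 1, by omega⟩
    have hG := γ.isTiled_snakeLoop hl b r
    have hw := γ.isLoopWord hl b
    rw [hG.dep_eq_sw_iff p (by omega), hG.arr_eq_ne_iff p (by omega), hp i rfl]
    change (T.Turns (γ.loopCross b) i ↔ _) ↔ (T.Turns (γ.loopCross b) j' ↔ _)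
    rw [hw.turns_mirror (j := j') hj (by omega)]
    cases p i <;> simp

theorem arr_eq_iff_dep_eq (hl : 2 ≤ γ.deg) {j j' : ℕ} (hj : j + 1 < γ.len)
    (hjj : j + j' + 1 = 2 * γ.len + γ.deg) (hp : ∀ i, i + 1 = j' → p i = p (j + 1)) :
    (γ.snakeLoop b r).arr ((γ.snakeLoop b r).down p) (j + 1) =
      Tile.ne ((γ.snakeLoop b r).corner j) ↔
    (γ.snakeLoop b r).dep ((γ.snakeLoop b r).down p) j' =
      Tile.sw ((γ.snakeLoop b r).corner j') := by
  have hlen : (γ.snakeLoop b r).len = 2 * γ.len + γ.deg := rfl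
  obtain ⟨i, rfl⟩ : ∃ i, j' = i + 1 := ⟨j' - 1, by omega⟩
  have hG := γ.isTiled_snakeLoop hl b r
  have hw := γ.isLoopWord hl b
  rw [hG.dep_eq_sw_iff p (by omega), hG.arr_eq_ne_iff p (by omega), hp i rfl]
  change (T.Turns (γ.loopCross b) j ↔ _) ↔ (T.Turns (γ.loopCross b) i ↔ _)
  rw [hw.turns_mirror (j := i) hj (by omega)]
  cases p (j + 1) <;> simp

/-- The lower edges of the first `k` tiles already detect the signs. They avoid the deleted vertex,
so even the sign of the tile `k - 1` is compared. -/
theorem isSymmetricMatching_signMatching_iff (hl : 2 ≤ γ.deg)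
    (hp : T.Admissible (γ.loopCross b) (2 * γ.len + γ.deg) p) :
    γ.IsSymmetricMatching b r ((γ.snakeLoop b r).signMatching p) ↔
      ∀ j < γ.len, p (2 * γ.len + γ.deg - 1 - j) = p j := by
  have hlen : (γ.snakeLoop b r).len = 2 * γ.len + γ.deg := rfl
  have hG := γ.isTiled_snakeLoop hl b r
  have hw := γ.isLoopWord hl b
  have h0 := γ.len_pos
  constructor
  · rintro ⟨-, h⟩ j hj
    obtain ⟨j', hj'⟩ : ∃ j', j + j' + 1 = 2 * γ.len + γ.deg :=
      ⟨2 * γ.len + γ.deg - 1 - j, by omega⟩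
    have e : 2 * γ.len + γ.deg - 1 - j = j' := by omega
    -- For a suitable `q`, having this sign forces the travel through the outer corner of the tile,
    -- for `j` and for its mirror image alike; then one lower edge of the tile `j` tests whether the
    -- sign is `q`. For `j = 0` any `q` works; otherwise `q` is the value that violates the second
    -- alternative of admissibility.
    have key : ∃ q : Bool,
        (p j = q → (γ.snakeLoop b r).dep ((γ.snakeLoop b r).down p) j =
          Tile.sw ((γ.snakeLoop b r).corner j)) ∧
        (p j' = q → (γ.snakeLoop b r).arr ((γ.snakeLoop b r).down p) (j' + 1) =
          Tile.ne ((γ.snakeLoop b r).corner j')) := by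
      rcases Nat.eq_zero_or_pos j with rfl | hj0
      · refine ⟨true, fun _ => rfl, fun _ => ?_⟩
        have h1 := arr_len (G := (γ.snakeLoop b r).toSnakeGraph) ((γ.snakeLoop b r).down p)
        rw [show (γ.snakeLoop b r).len = j' + 1 by omega] at h1
        exact h1
      · obtain ⟨i, rfl⟩ : ∃ i, j = i + 1 := ⟨j - 1, by omega⟩
        classical
        rw [hG.dep_eq_sw_iff p (by omega), hG.arr_eq_ne_iff p (by omega)]
        change ∃ q : Bool, (_ → (T.Turns (γ.loopCross b) i ↔ _)) ∧
          (_ → (T.Turns (γ.loopCross b) j' ↔ _))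
        have h1 := hp i (by omega)
        have h2 := hp j' (by omega)
        rw [hw.turns_mirror (j := j') hj (by omega)] at h2 ⊢
        refine ⟨decide (T.Turns (γ.loopCross b) i), fun h => ?_, fun h => ?_⟩
        · refine h1.resolve_right fun h' => ?_
          rw [h] at h'
          simp at h'
        · refine h2.resolve_left fun h' => ?_
          rw [h] at h'
          simp at h'
    obtain ⟨q, hq1, hq2⟩ := key
    obtain ⟨s, hs, hsq⟩ := exists_tileSide_lower (T := T) (r * (-1) ^ j) (γ.loopCross b j) q
    have h1 := h j hj s (fun h' => by
      rw [γ.ne_corner_mem_edge_iff b r hj] at h'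
      rcases hs with rfl | rfl <;> simp at h')
    rw [e, flip_mem_iff_of_lower hj hj' hs,
      IsTiled.edge_mem_signMatching_of_lower (T := T) (by omega) hs] at h1
    change T.tileSide (r * (-1) ^ j) (γ.loopCross b j) s =
      T.lowerSide (γ.loopCross b j) (p j) ∧ _ ↔ _ at h1
    rw [hsq, lowerSide_inj, lowerSide_inj] at h1
    rw [e]
    have h2 : q = p j ↔ q = p j' :=
      ⟨fun h => (h1.1 ⟨h, hq1 h.symm⟩).1, fun h => (h1.2 ⟨h, hq2 h.symm⟩).1⟩
    revert h2
    cases q <;> cases p j <;> cases p j' <;> simp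
  · intro h
    refine ⟨(hG.isPerfectMatching_signMatching_iff (by omega) p).2 hp, fun j hj s hs => ?_⟩
    obtain ⟨j', hj'⟩ : ∃ j', j + j' + 1 = 2 * γ.len + γ.deg :=
      ⟨2 * γ.len + γ.deg - 1 - j, by omega⟩
    have e : 2 * γ.len + γ.deg - 1 - j = j' := by omega
    have hpj := h j hj
    rw [e] at hpj ⊢
    have hcases : (s = .S ∨ s = .W) ∨ (s = .N ∨ s = .E) := by cases s <;> simp
    rcases hcases with hs' | hs'
    · rw [flip_mem_iff_of_lower hj hj' hs',
        IsTiled.edge_mem_signMatching_of_lower (T := T) (by omega) hs',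
        dep_eq_iff_arr_eq hl hj hj', hpj]
      · rfl
      · rintro i rfl
        rw [← h i (by omega)]
        congr 1
        omega
    -- The upper edges of the tile `k - 1` contain the deleted vertex, so nothing is claimed for
    -- them.
    · have hj1 : j + 1 < γ.len := by
        rw [γ.ne_corner_mem_edge_iff b r hj] at hs
        by_contra h'
        exact hs ⟨by omega, hs'⟩
      rw [flip_mem_iff_of_upper hj hj' hs',
        IsTiled.edge_mem_signMatching_of_upper (T := T) (by omega) hs',
        arr_eq_iff_dep_eq hl hj1 hj', hpj]
      · rfl
      · rintro i rfl
        rw [← h (j + 1) hj1]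
        congr 1
        omega

/-- Symmetric matchings of the snake graph of the loop are given by symmetric signs. -/
noncomputable def loopSignEquiv (hl : 2 ≤ γ.deg) (b : Bool) (r : ℤˣ) :
    {p // T.IsLoopSign γ.len γ.deg (γ.loopCross b) p} ≃ {P // γ.IsSymmetricMatching b r P} :=
  Equiv.ofBijective
    (fun p => ⟨(γ.snakeLoop b r).signMatching p.1,
      (isSymmetricMatching_signMatching_iff hl p.2.admissible).2 p.2.mirror⟩) <| by
    have h0 := γ.len_pos
    have hlen : (γ.snakeLoop b r).len = 2 * γ.len + γ.deg := rfl
    constructor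
    · rintro ⟨p, hp⟩ ⟨q, hq⟩ h
      refine Subtype.ext (hp.ext_of_lt hq fun i hi => ?_)
      exact signMatching_injective _ (by omega) (Subtype.ext_iff.1 h) (by omega)
    · rintro ⟨P, hP⟩
      obtain ⟨p, hp, hs, rfl⟩ := (γ.isTiled_snakeLoop hl b r).exists_signMatching (by omega) hP.1
      exact ⟨⟨p, hp, (isSymmetricMatching_signMatching_iff hl hp).1 hP, hs⟩, rfl⟩

/-! ### Normalized monomials -/

variable (γ b r) in
theorem zero_add_len_le : 0 + γ.len ≤ (γ.snakeLoop b r).len := by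
  change _ ≤ 2 * γ.len + γ.deg
  omega

variable (γ b r) in
theorem len_add_deg_add_len_le : γ.len + γ.deg + γ.len ≤ (γ.snakeLoop b r).len := by
  change _ ≤ 2 * γ.len + γ.deg
  omega

theorem arr_eq_iff_restricts (hl : 2 ≤ γ.deg) :
    (γ.snakeLoop b r).arr ((γ.snakeLoop b r).down p) (0 + γ.len) =
      Tile.ne ((γ.snakeLoop b r).corner (0 + γ.len - 1)) ↔
      (T.Turns (γ.loopCross b) (γ.len - 1) ↔ p γ.len = false) := by
  have h0 := γ.len_pos
  have h1 := (γ.isTiled_snakeLoop hl b r).arr_eq_ne_iff p (i := γ.len - 1)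
    (by change _ < 2 * γ.len + γ.deg; omega)
  rw [show γ.len - 1 + 1 = γ.len by omega] at h1
  rw [Nat.zero_add]
  exact h1

theorem dep_eq_iff_restricts (hl : 2 ≤ γ.deg) :
    (γ.snakeLoop b r).dep ((γ.snakeLoop b r).down p) (γ.len + γ.deg) =
      Tile.sw ((γ.snakeLoop b r).corner (γ.len + γ.deg)) ↔
      (T.Turns (γ.loopCross b) (γ.len + γ.deg - 1) ↔ p (γ.len + γ.deg - 1) = true) := by
  have h0 := γ.len_pos
  have h1 := (γ.isTiled_snakeLoop hl b r).dep_eq_sw_iff p (i := γ.len + γ.deg - 1)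
    (by change _ < 2 * γ.len + γ.deg; omega)
  rw [show γ.len + γ.deg - 1 + 1 = γ.len + γ.deg by omega] at h1
  exact h1

theorem arr_last : (γ.snakeLoop b r).arr ((γ.snakeLoop b r).down p) (γ.len + γ.deg + γ.len) =
    Tile.ne ((γ.snakeLoop b r).corner (γ.len + γ.deg + γ.len - 1)) := by
  have h1 := arr_len (G := (γ.snakeLoop b r).toSnakeGraph) ((γ.snakeLoop b r).down p)
  rw [show (γ.snakeLoop b r).len = γ.len + γ.deg + γ.len by
    change 2 * γ.len + γ.deg = _; omega] at h1
  exact h1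

/-- The first copy starts where the whole graph does, so only the arrival at its last corner
matters. -/
theorem restrictsTo_zero_iff (hl : 2 ≤ γ.deg)
    (hp : T.Admissible (γ.loopCross b) (2 * γ.len + γ.deg) p) :
    γ.RestrictsTo b r 0 ((γ.snakeLoop b r).signMatching p) ↔
      (T.Turns (γ.loopCross b) (γ.len - 1) ↔ p γ.len = false) := by
  rw [← arr_eq_iff_restricts (r := r) hl]
  have hP := ((γ.isTiled_snakeLoop hl b r).isPerfectMatching_signMatching_iff
    (by change 0 < 2 * γ.len + γ.deg; omega) p).2 hp
  exact ⟨fun h => (dep_eq_and_arr_eq_of_inter_sub_edges (γ.zero_add_len_le b r) γ.len_pos h).2,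
    fun h => (inter_sub_edges (γ.zero_add_len_le b r) γ.len_pos hP rfl h).2⟩

theorem restrictsTo_one_iff (hl : 2 ≤ γ.deg)
    (hp : T.Admissible (γ.loopCross b) (2 * γ.len + γ.deg) p) :
    γ.RestrictsTo b r 1 ((γ.snakeLoop b r).signMatching p) ↔
      (T.Turns (γ.loopCross b) (γ.len + γ.deg - 1) ↔ p (γ.len + γ.deg - 1) = true) := by
  rw [← dep_eq_iff_restricts (r := r) hl]
  have hP := ((γ.isTiled_snakeLoop hl b r).isPerfectMatching_signMatching_iff
    (by change 0 < 2 * γ.len + γ.deg; omega) p).2 hp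
  exact ⟨fun h => (dep_eq_and_arr_eq_of_inter_sub_edges (γ.len_add_deg_add_len_le b r) γ.len_pos h).1,
    fun h => (inter_sub_edges (γ.len_add_deg_add_len_le b r) γ.len_pos hP h arr_last).2⟩

theorem exists_restrictsTo (hl : 2 ≤ γ.deg)
    (hp : T.IsLoopSign γ.len γ.deg (γ.loopCross b) p) :
    ∃ i, γ.RestrictsTo b r i ((γ.snakeLoop b r).signMatching p) := by
  rcases hp.restricts (γ.isLoopWord hl b) with h | h
  · exact ⟨0, (restrictsTo_zero_iff hl hp.admissible).2 h⟩
  · exact ⟨1, (restrictsTo_one_iff hl hp.admissible).2 h⟩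

theorem xBar_eq (hl : 2 ≤ γ.deg) (hp : T.IsLoopSign γ.len γ.deg (γ.loopCross b) p) (i : Fin 2)
    (h : γ.RestrictsTo b r i ((γ.snakeLoop b r).signMatching p)) :
    γ.xBar b r i ((γ.snakeLoop b r).signMatching p) =
      T.loopWeight γ.len γ.deg (γ.loopCross b) p := by
  have hlen : (γ.snakeLoop b r).len = 2 * γ.len + γ.deg := rfl
  have h0 := γ.len_pos
  have hG := γ.isTiled_snakeLoop hl b r
  have hw := γ.isLoopWord hl b
  rw [xBar, restrict, hG.weightMonomial_signMatching (by omega) hp.admissible]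
  fin_cases i
  · have h1 := (restrictsTo_zero_iff hl hp.admissible).1 h
    rw [hp.loopWeight_of_upper hw h1]
    have hle := γ.zero_add_len_le b r
    change _ / T.weightMonomial ((γ.snakeLoop b r).sub 0 γ.len hle)
      (_ ∩ ((γ.snakeLoop b r).sub 0 γ.len hle).edges) = _
    rw [hG.weightMonomial_inter_sub_edges _ h0 hp.admissible rfl ((arr_eq_iff_restricts hl).2 h1)]
    simp only [Nat.zero_add]
    -- The first copy has `len + 1` matched edges, which cancel.
    rw [div_eq_iff (Finset.prod_ne_zero_iff.2 fun _ _ => x_ne_zero _),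
      show (γ.snakeLoop b r).len + 1 = (γ.len + 1) + (γ.len + γ.deg) by omega,
      Finset.prod_range_add, mul_comm, suffixWeight]
    rfl
  · have h1 := (restrictsTo_one_iff hl hp.admissible).1 h
    rw [IsLoopSign.loopWeight_of_lower h1]
    have hle := γ.len_add_deg_add_len_le b r
    change _ / T.weightMonomial ((γ.snakeLoop b r).sub (γ.len + γ.deg) γ.len hle)
      (_ ∩ ((γ.snakeLoop b r).sub (γ.len + γ.deg) γ.len hle).edges) = _
    rw [hG.weightMonomial_inter_sub_edges _ h0 hp.admissible ((dep_eq_iff_restricts hl).2 h1)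
      arr_last]
    rw [div_eq_iff (Finset.prod_ne_zero_iff.2 fun _ _ => x_ne_zero _),
      show (γ.snakeLoop b r).len + 1 = (γ.len + γ.deg) + (γ.len + 1) by omega,
      Finset.prod_range_add, prefixWeight]
    rfl

theorem yBar_eq (hl : 2 ≤ γ.deg) (hp : T.IsLoopSign γ.len γ.deg (γ.loopCross b) p) (i : Fin 2)
    (h : γ.RestrictsTo b r i ((γ.snakeLoop b r).signMatching p)) :
    γ.yBar b r i ((γ.snakeLoop b r).signMatching p) =
      T.loopCoeff γ.len γ.deg (γ.loopCross b) p := by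
  have hlen : (γ.snakeLoop b r).len = 2 * γ.len + γ.deg := rfl
  have h0 := γ.len_pos
  have hG := γ.isTiled_snakeLoop hl b r
  have hw := γ.isLoopWord hl b
  have hP := (hG.isPerfectMatching_signMatching_iff (by omega) p).2 hp.admissible
  have hne : ∀ j, (if p j then T.y (γ.loopCross b j) else 1) ≠ 0 := by
    intro j
    split_ifs
    · exact y_ne_zero _
    · exact one_ne_zero
  -- Both copies contribute the same coefficients, so the quotient does not see which one is used.
  have hend : ∏ j ∈ Finset.range γ.len,
      (if p (γ.len + γ.deg + j) then T.y (γ.loopCross b (γ.len + γ.deg + j)) else 1) =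
      ∏ j ∈ Finset.range γ.len, (if p j then T.y (γ.loopCross b j) else 1) := by
    rw [← Finset.prod_range_reflect]
    refine Finset.prod_congr rfl fun j hj => ?_
    have hj' := Finset.mem_range.1 hj
    rw [show γ.len + γ.deg + (γ.len - 1 - j) = 2 * γ.len + γ.deg - 1 - j by omega, hp.mirror j hj',
      hw.mirror j hj', y_glue]
  have htotal : ∏ j ∈ Finset.range (γ.snakeLoop b r).len,
      (if p j then T.y ((γ.snakeLoop b r).diag j) else 1) =
      T.loopCoeff γ.len γ.deg (γ.loopCross b) p *
        ∏ j ∈ Finset.range γ.len, (if p j then T.y (γ.loopCross b j) else 1) := by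
    rw [show (γ.snakeLoop b r).len = (γ.len + γ.deg) + γ.len by omega, Finset.prod_range_add,
      loopCoeff, ← hend]
    rfl
  rw [yBar, restrict, IsTiled.coeffMonomial_signMatching hP, htotal]
  fin_cases i
  · have h1 := (restrictsTo_zero_iff hl hp.admissible).1 h
    have hle := γ.zero_add_len_le b r
    change _ / T.coeffMonomial ((γ.snakeLoop b r).sub 0 γ.len hle)
      (_ ∩ ((γ.snakeLoop b r).sub 0 γ.len hle).edges) = _
    rw [hG.coeffMonomial_inter_sub_edges _ h0 hp.admissible rfl ((arr_eq_iff_restricts hl).2 h1)]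
    simp only [Nat.zero_add]
    exact mul_div_cancel_right₀ _ (Finset.prod_ne_zero_iff.2 fun j _ => hne j)
  · have h1 := (restrictsTo_one_iff hl hp.admissible).1 h
    have hle := γ.len_add_deg_add_len_le b r
    change _ / T.coeffMonomial ((γ.snakeLoop b r).sub (γ.len + γ.deg) γ.len hle)
      (_ ∩ ((γ.snakeLoop b r).sub (γ.len + γ.deg) γ.len hle).edges) = _
    rw [hG.coeffMonomial_inter_sub_edges _ h0 hp.admissible ((dep_eq_iff_restricts hl).2 h1)
      arr_last]
    change _ / (∏ j ∈ Finset.range γ.len,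
      (if p (γ.len + γ.deg + j) then T.y (γ.loopCross b (γ.len + γ.deg + j)) else 1)) = _
    rw [hend]
    exact mul_div_cancel_right₀ _ (Finset.prod_ne_zero_iff.2 fun j _ => hne j)

end

end SinglyNotchedArc

end IdealTriangulation

/-! ### Good matchings in terms of symmetric signs, and the bijection. -/

namespace IdealTriangulation.SinglyNotchedArc

open PlanePoint SnakeGraph LabelledSnakeGraph LoopGraph

variable {D : Type*} {T : IdealTriangulation D} {γ : SinglyNotchedArc T} {b : Bool} {r : ℤˣ}
  {p : ℕ → Bool}

/-! ### Good matchings -/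

theorem hookedCross_eq_loopCross (γ : SinglyNotchedArc T) (b : Bool) {i : ℕ}
    (hi : i < γ.len + γ.deg) : γ.hookedCross b i = γ.loopCross b i := (if_pos hi).symm

theorem turns_hookedCross (γ : SinglyNotchedArc T) (b : Bool) {i : ℕ}
    (hi : i + 1 < γ.len + γ.deg) :
    T.Turns (γ.hookedCross b) i ↔ T.Turns (γ.loopCross b) i := by
  rw [Turns, Turns, γ.hookedCross_eq_loopCross b hi, γ.hookedCross_eq_loopCross b (by omega)]

theorem admissible_hookedCross_iff :
    T.Admissible (γ.hookedCross b) (γ.len + γ.deg) p ↔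
      T.Admissible (γ.loopCross b) (γ.len + γ.deg) p :=
  forall_congr' fun i => forall_congr' fun hi => by rw [γ.turns_hookedCross b hi]

theorem loopCross_len (γ : SinglyNotchedArc T) (hl : 2 ≤ γ.deg) (b : Bool) :
    γ.loopCross b γ.len = γ.around b 0 := γ.loopCross_around b (j := 0) (by omega)

variable [Finite D]

theorem isTiled_loopGraph (hl : 2 ≤ γ.deg) (b : Bool) (r : ℤˣ) :
    T.IsTiled (γ.loopGraph b r).toLabelledSnakeGraph :=
  isTiled_snakeGraph r fun i hi => by
    rw [γ.hookedCross_eq_loopCross b hi, γ.hookedCross_eq_loopCross b (by omega)]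
    exact (γ.isLoopWord hl b).turn i (by omega)

/-- The definition of `cut` tests only North; that East carries the side otherwise holds because the
upper half of the last tile is again the last triangle of the arc. -/
theorem cut_eq (γ : SinglyNotchedArc T) (hl : 2 ≤ γ.deg) (b : Bool) (r : ℤˣ) :
    T.tileSide (r * (-1) ^ (γ.len + γ.deg - 1)) (γ.loopCross b (γ.len + γ.deg - 1))
      (γ.loopGraph b r).cut = γ.loopCross b γ.len := by
  classical
  have hw := γ.isLoopWord hl b
  have h1 := (hw.upperSide_last_eq_iff (decide (T.Turns (γ.loopCross b) (γ.len + γ.deg - 1)))).2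
    (by simp)
  have h2 := upperSide_eq_tileSide (T := T) (r * (-1) ^ (γ.len + γ.deg - 1))
    (γ.loopCross b (γ.len + γ.deg - 1))
    (decide (T.Turns (γ.loopCross b) (γ.len + γ.deg - 1)))
  rw [h1] at h2
  have h3 : (γ.loopGraph b r).cut = if T.tileSide (r * (-1) ^ (γ.len + γ.deg - 1))
      (γ.loopCross b (γ.len + γ.deg - 1)) Side.N = γ.loopCross b γ.len then Side.N else Side.E := by
    rw [← γ.hookedCross_eq_loopCross b (by omega), γ.loopCross_len hl]
    simp only [loopGraph]
  rw [h3]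
  split_ifs with h
  · exact h
  · exact (h2.resolve_left fun h' => h h'.symm).symm

theorem cut'_eq (γ : SinglyNotchedArc T) (hl : 2 ≤ γ.deg) (b : Bool) (r : ℤˣ) :
    T.tileSide (r * (-1) ^ (γ.len - 1)) (γ.loopCross b (γ.len - 1))
      (γ.loopGraph b r).cut' = γ.loopCross b γ.len := by
  classical
  have h0 := γ.len_pos
  have hw := γ.isLoopWord hl b
  have h1 := (isTiled_loopGraph (γ := γ) hl b r).corner_succ (γ.len - 1)
    (by change _ < γ.len + γ.deg; omega)
  have h2 := hw.turn (γ.len - 1) (by omega)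
  have h3 : (γ.loopGraph b r).diag (γ.len - 1 + 1) = γ.loopCross b γ.len := by
    rw [show γ.len - 1 + 1 = γ.len by omega]
    exact γ.hookedCross_eq_loopCross b (by omega)
  have h4 : (γ.loopGraph b r).diag (γ.len - 1) = γ.loopCross b (γ.len - 1) :=
    γ.hookedCross_eq_loopCross b (by omega)
  rw [h3, h4] at h1
  change _ = _ + T.tileStep (r * (-1) ^ (γ.len - 1)) _ _ at h1
  rw [show γ.len - 1 + 1 = γ.len by omega] at h2
  have h5 : (γ.loopGraph b r).cut' = if γ.loopCross b γ.len =
      T.tileSide (r * (-1) ^ (γ.len - 1)) (γ.loopCross b (γ.len - 1)) .N then Side.N else Side.E := by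
    change (if (γ.loopGraph b r).corner (γ.len - 1 + 1) =
      (γ.loopGraph b r).corner (γ.len - 1) + (1, 0) then Side.N else Side.E) = _
    rw [h1, tileStep]
    split_ifs with h <;> simp_all
  rw [h5]
  split_ifs with h
  · exact h.symm
  · generalize r * (-1) ^ (γ.len - 1) = r' at h ⊢
    rcases Int.units_eq_one_or r' with rfl | rfl <;> rcases h2 with h2 | h2 <;>
      rw [h2] at h ⊢ <;> simp_all [tileSide]

theorem c_mem_signMatching_iff (hl : 2 ≤ γ.deg) :
    (γ.loopGraph b r).c ∈ (γ.loopGraph b r).signMatching p ↔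
      (T.Turns (γ.loopCross b) (γ.len + γ.deg - 1) ↔ p (γ.len + γ.deg - 1) = true) := by
  have hlen : (γ.loopGraph b r).len = γ.len + γ.deg := rfl
  have h1 : (γ.loopGraph b r).diag (γ.len + γ.deg - 1) = γ.loopCross b (γ.len + γ.deg - 1) :=
    γ.hookedCross_eq_loopCross b (by omega)
  have h2 := arr_len (G := (γ.loopGraph b r).toSnakeGraph) ((γ.loopGraph b r).down p)
  rw [show (γ.loopGraph b r).len = γ.len + γ.deg - 1 + 1 by omega, Nat.add_sub_cancel] at h2
  rw [LoopGraph.c, hlen, IsTiled.edge_mem_signMatching_of_upper (T := T) (by omega)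
    (γ.loopGraph b r).hcut, and_iff_left h2, h1, ← (γ.isLoopWord hl b).upperSide_last_eq_iff]
  change T.tileSide (r * (-1) ^ (γ.len + γ.deg - 1)) _ _ = _ ↔ _
  rw [γ.cut_eq hl, eq_comm]

/-- The sign alone suffices: when it selects the side of `c'`, the first alternative of
admissibility fails, so the travel passes through the north-east vertex of the tile. -/
theorem c'_mem_signMatching_iff (hl : 2 ≤ γ.deg)
    (hp : T.Admissible (γ.loopCross b) (γ.len + γ.deg) p) :
    (γ.loopGraph b r).c' ∈ (γ.loopGraph b r).signMatching p ↔
      (T.Turns (γ.loopCross b) (γ.len - 1) ↔ p (γ.len - 1) = false) := by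
  have h0 := γ.len_pos
  have hlen : (γ.loopGraph b r).len = γ.len + γ.deg := rfl
  have hk : (γ.loopGraph b r).k = γ.len - 1 := rfl
  have h1 : (γ.loopGraph b r).diag (γ.len - 1) = γ.loopCross b (γ.len - 1) :=
    γ.hookedCross_eq_loopCross b (by omega)
  have hcut : (γ.loopGraph b r).cut' = .N ∨ (γ.loopGraph b r).cut' = .E := by
    rw [LoopGraph.cut']
    split_ifs <;> simp
  have h2 := (isTiled_loopGraph (γ := γ) hl b r).arr_eq_ne_iff p (i := γ.len - 1) (by omega)
  rw [LoopGraph.c', hk, IsTiled.edge_mem_signMatching_of_upper (T := T) (by omega) hcut, h1, h2,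
    ← (γ.isLoopWord hl b).upperSide_eq_iff]
  change T.tileSide (r * (-1) ^ (γ.len - 1)) _ _ = _ ∧
    (T.Turns (γ.hookedCross b) (γ.len - 1) ↔ _) ↔ _
  rw [γ.cut'_eq hl, eq_comm, γ.turns_hookedCross b (by omega)]
  refine and_iff_left_of_imp fun h => ?_
  rw [(γ.isLoopWord hl b).upperSide_eq_iff] at h
  refine (hp (γ.len - 1) (by omega)).resolve_left fun h' => ?_
  rw [h'] at h
  revert h
  cases p (γ.len - 1) <;> simp

theorem edgeWeight_c (hl : 2 ≤ γ.deg) :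
    T.edgeWeight (γ.loopGraph b r).toLabelledSnakeGraph (γ.loopGraph b r).c =
      T.x (γ.loopCross b γ.len) := by
  have hlen : (γ.loopGraph b r).len = γ.len + γ.deg := rfl
  rw [LoopGraph.c, (isTiled_loopGraph hl b r).edgeWeight_edge (by omega), hlen, ← γ.cut_eq hl b r,
    ← γ.hookedCross_eq_loopCross b (by omega)]
  rfl

theorem edgeWeight_c' (hl : 2 ≤ γ.deg) :
    T.edgeWeight (γ.loopGraph b r).toLabelledSnakeGraph (γ.loopGraph b r).c' =
      T.x (γ.loopCross b γ.len) := by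
  have h0 := γ.len_pos
  have hk : (γ.loopGraph b r).k = γ.len - 1 := rfl
  rw [LoopGraph.c', (isTiled_loopGraph hl b r).edgeWeight_edge
    (by change γ.len - 1 < γ.len + γ.deg; omega), hk, ← γ.cut'_eq hl b r,
    ← γ.hookedCross_eq_loopCross b (by omega)]
  rfl

/-- Both glued edges carry the side `w k` of the loop word. If `c` is matched, the first `k + l`
edges have the same weight as what remains; if not, `suffixWeight_mul` trades the last edge of the
hook for the edge `k`, which is `c'`. -/
theorem weightMonomial_reduce (hl : 2 ≤ γ.deg)
    (hp : T.IsLoopSign γ.len γ.deg (γ.loopCross b) p) :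
    T.weightMonomial (γ.loopGraph b r).toLabelledSnakeGraph
      ((γ.loopGraph b r).reduce ((γ.loopGraph b r).signMatching p)) =
      T.loopWeight γ.len γ.deg (γ.loopCross b) p := by
  have h0 := γ.len_pos
  have hw := γ.isLoopWord hl b
  have hlen : (γ.loopGraph b r).len = γ.len + γ.deg := rfl
  have hadm : T.Admissible (γ.loopCross b) (γ.len + γ.deg) p :=
    fun i hi => hp.admissible i (by omega)
  have hclose : (γ.loopGraph b r).c ∈ (γ.loopGraph b r).signMatching p ∨
      (γ.loopGraph b r).c' ∈ (γ.loopGraph b r).signMatching p := by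
    rw [c_mem_signMatching_iff hl, c'_mem_signMatching_iff hl hadm]
    exact hp.closes hw
  have hmul : T.weightMonomial (γ.loopGraph b r).toLabelledSnakeGraph
      ((γ.loopGraph b r).reduce ((γ.loopGraph b r).signMatching p)) * T.x (γ.loopCross b γ.len) =
      T.weightMonomial (γ.loopGraph b r).toLabelledSnakeGraph
        ((γ.loopGraph b r).signMatching p) := by
    rw [reduce, weightMonomial, weightMonomial]
    split_ifs with h
    · rw [← edgeWeight_c' (r := r) hl, Finset.prod_erase_mul _ _ h]
    · rw [← edgeWeight_c (r := r) hl, Finset.prod_erase_mul _ _ (hclose.resolve_right h)]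
  have htotal : T.weightMonomial (γ.loopGraph b r).toLabelledSnakeGraph
      ((γ.loopGraph b r).signMatching p) = T.prefixWeight γ.len γ.deg (γ.loopCross b) p *
        T.x (T.upperSide (γ.loopCross b (γ.len + γ.deg - 1)) (p (γ.len + γ.deg - 1))) := by
    rw [(isTiled_loopGraph hl b r).weightMonomial_signMatching (by omega)
      (admissible_hookedCross_iff.2 hadm), hlen, Finset.prod_range_succ, prefixWeight]
    congr 1
    · refine Finset.prod_congr rfl fun m hm => ?_
      congr 1
      exact carry_prefix p (fun i hi => γ.hookedCross_eq_loopCross b hi) (by omega)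
        (Finset.mem_range.1 hm)
    · rw [carry, if_neg (by omega), if_pos rfl, ← γ.hookedCross_eq_loopCross b (by omega)]
      rfl
  rw [htotal] at hmul
  refine mul_right_cancel₀ (x_ne_zero _) (hmul.trans ?_)
  by_cases h1 : T.Turns (γ.loopCross b) (γ.len + γ.deg - 1) ↔ p (γ.len + γ.deg - 1) = true
  · rw [IsLoopSign.loopWeight_of_lower h1, (hw.upperSide_last_eq_iff _).2 h1]
  · have h2 := (hp.restricts hw).resolve_right h1
    have h3 := (hp.closes hw).resolve_left h1
    have h4 := carry_of_upper (T := T) (n := 2 * γ.len + γ.deg) (p := p) (i := γ.len - 1)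
      (by omega) (hw.turn _ (by omega)) (by rwa [show γ.len - 1 + 1 = γ.len by omega])
    have h5 := carry_of_not_lower (T := T) (n := 2 * γ.len + γ.deg) (p := p)
      (i := γ.len + γ.deg - 1) (by omega) h1
    rw [show γ.len - 1 + 1 = γ.len by omega, (hw.upperSide_eq_iff _).2 h3] at h4
    rw [show γ.len + γ.deg - 1 + 1 = γ.len + γ.deg by omega] at h5
    rw [hp.loopWeight_of_upper hw h2, ← h5, ← hp.suffixWeight_mul hw, h4]

/-- Good matchings of the loop graph are given by symmetric signs. -/
noncomputable def goodSignEquiv (hl : 2 ≤ γ.deg) (b : Bool) (r : ℤˣ) :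
    {p // T.IsLoopSign γ.len γ.deg (γ.loopCross b) p} ≃
      {Q // (γ.loopGraph b r).IsGoodMatching Q} := by
  have h0 := γ.len_pos
  have hw := γ.isLoopWord hl b
  have hG := isTiled_loopGraph (γ := γ) hl b r
  have hlen : (γ.loopGraph b r).len = γ.len + γ.deg := rfl
  have hl' : (γ.loopGraph b r).k + 2 < (γ.loopGraph b r).len := by
    change γ.len - 1 + 2 < γ.len + γ.deg
    omega
  have hadm : ∀ {p}, T.IsLoopSign γ.len γ.deg (γ.loopCross b) p →
      T.Admissible (γ.loopCross b) (γ.len + γ.deg) p :=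
    fun hp i hi => hp.admissible i (by omega)
  have hP : ∀ {p}, T.IsLoopSign γ.len γ.deg (γ.loopCross b) p →
      (γ.loopGraph b r).toSnakeGraph.IsPerfectMatching ((γ.loopGraph b r).signMatching p) :=
    fun hp => (hG.isPerfectMatching_signMatching_iff (by omega) _).2
      (admissible_hookedCross_iff.2 (hadm hp))
  have hclose : ∀ {p}, T.IsLoopSign γ.len γ.deg (γ.loopCross b) p →
      ((γ.loopGraph b r).c ∈ (γ.loopGraph b r).signMatching p ∨
        (γ.loopGraph b r).c' ∈ (γ.loopGraph b r).signMatching p) := by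
    intro p hp
    rw [c_mem_signMatching_iff hl, c'_mem_signMatching_iff hl (hadm hp)]
    exact hp.closes hw
  refine Equiv.ofBijective
    (fun p => ⟨(γ.loopGraph b r).reduce ((γ.loopGraph b r).signMatching p.1),
      (isGoodMatching_iff hl').2 ⟨_, hP p.2, hclose p.2, rfl⟩⟩) ⟨?_, ?_⟩
  · rintro ⟨p, hp⟩ ⟨q, hq⟩ h
    have h1 := reduce_injective hl' (hP hp) (hP hq) (hclose hp) (hclose hq) (Subtype.ext_iff.1 h)
    refine Subtype.ext (hp.ext_of_lt hq fun i hi => ?_)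
    exact signMatching_injective _ (by omega) h1 (by omega)
  · rintro ⟨Q, hQ⟩
    obtain ⟨P, hP, hc, rfl⟩ := (isGoodMatching_iff hl').1 hQ
    obtain ⟨p, hp, -, rfl⟩ := hG.exists_signMatching (by omega) hP
    have hp' : T.Admissible (γ.loopCross b) (γ.len + γ.deg) p := admissible_hookedCross_iff.1 hp
    rw [c_mem_signMatching_iff hl, c'_mem_signMatching_iff hl hp'] at hc
    -- Containing `c` or `c'` is exactly the junction condition for the extension by reflection.
    obtain ⟨q, hq, hqp⟩ := hw.exists_isLoopSign hp' hc
    refine ⟨⟨q, hq⟩, Subtype.ext ?_⟩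
    change (γ.loopGraph b r).reduce ((γ.loopGraph b r).signMatching q) = _
    rw [signMatching_congr _ fun i hi => hqp i hi]

theorem coe_goodSignEquiv (hl : 2 ≤ γ.deg)
    (p : {p // T.IsLoopSign γ.len γ.deg (γ.loopCross b) p}) :
    (goodSignEquiv hl b r p).1 =
      (γ.loopGraph b r).reduce ((γ.loopGraph b r).signMatching p.1) := rfl

theorem coeffMonomialLoop_reduce (hl : 2 ≤ γ.deg)
    (hp : T.IsLoopSign γ.len γ.deg (γ.loopCross b) p)
    (hQ : (γ.loopGraph b r).IsGoodMatching
      ((γ.loopGraph b r).reduce ((γ.loopGraph b r).signMatching p))) :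
    T.coeffMonomialLoop (γ.loopGraph b r) _ hQ = T.loopCoeff γ.len γ.deg (γ.loopCross b) p := by
  have h0 := γ.len_pos
  have hlen : (γ.loopGraph b r).len = γ.len + γ.deg := rfl
  have hadm : T.Admissible (γ.loopCross b) (γ.len + γ.deg) p :=
    fun i hi => hp.admissible i (by omega)
  have hP := ((isTiled_loopGraph (γ := γ) hl b r).isPerfectMatching_signMatching_iff (by omega)
    p).2 (admissible_hookedCross_iff.2 hadm)
  have hclose : (γ.loopGraph b r).c ∈ (γ.loopGraph b r).signMatching p ∨
      (γ.loopGraph b r).c' ∈ (γ.loopGraph b r).signMatching p := by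
    rw [c_mem_signMatching_iff hl, c'_mem_signMatching_iff hl hadm]
    exact hp.closes (γ.isLoopWord hl b)
  rw [coeffMonomialLoop, choose_isGoodMatching
    (by change γ.len - 1 + 2 < γ.len + γ.deg; omega) hP hclose hQ,
    IsTiled.coeffMonomial_signMatching hP, loopCoeff]
  refine Finset.prod_congr rfl fun m hm => ?_
  rw [← γ.hookedCross_eq_loopCross b (Finset.mem_range.1 hm)]
  rfl

omit [Finite D] in
/-- The correspondence of symmetric signs for the two directions around the puncture. -/
theorem exists_loopSign_equiv (hl : 2 ≤ γ.deg) (b b' : Bool) :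
    ∃ e : {p // T.IsLoopSign γ.len γ.deg (γ.loopCross b) p} ≃
        {p // T.IsLoopSign γ.len γ.deg (γ.loopCross b') p},
      ∀ p, T.loopWeight γ.len γ.deg (γ.loopCross b') (e p).1 =
          T.loopWeight γ.len γ.deg (γ.loopCross b) p.1 ∧
        T.loopCoeff γ.len γ.deg (γ.loopCross b') (e p).1 =
          T.loopCoeff γ.len γ.deg (γ.loopCross b) p.1 := by
  by_cases h : b' = b
  · subst h
    exact ⟨Equiv.refl _, fun p => ⟨rfl, rfl⟩⟩
  · obtain rfl : b' = !b := by cases b <;> cases b' <;> simp_all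
    have hww : ∀ i < 2 * γ.len + γ.deg,
        γ.loopCross (!b) i = T.glue (γ.loopCross b (2 * γ.len + γ.deg - 1 - i)) :=
      fun i hi => γ.loopCross_not b hi
    exact ⟨loopSignReverse (γ.isLoopWord hl b) (γ.isLoopWord hl (!b)) hww,
      fun p => ⟨p.2.loopWeight_reverse (γ.isLoopWord hl b) hww,
        p.2.loopCoeff_reverse (γ.isLoopWord hl b) hww⟩⟩

end IdealTriangulation.SinglyNotchedArc

open IdealTriangulation.SinglyNotchedArc in
/-- The choices of a direction around the puncture (`ccw`, `ccw'`) and of the relative orientation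
of the first tile (`r`, `r'`) are arbitrary for both graphs. The last part says that the normalized
monomials are defined (some copy `i` can be used) and do not depend on the copy that is used, and
that the bijection preserves them. -/
theorem proposition6p1 {D : Type*} [Finite D] (T : IdealTriangulation D)
    (γ : IdealTriangulation.SinglyNotchedArc T)
    (hp : ¬ T.IsEnclosedBySelfFolded γ.endCorner)
    (ccw ccw' : Bool) (r r' : ℤˣ) :
    ∃ Φ : {P : Finset (Sym2 PlanePoint) // γ.IsSymmetricMatching ccw r P} ≃
        {Q : Finset (Sym2 PlanePoint) // (γ.loopGraph ccw' r').IsGoodMatching Q},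
      ∀ P, (∃ i, γ.RestrictsTo ccw r i P.1) ∧
        ∀ i, γ.RestrictsTo ccw r i P.1 →
          γ.xBar ccw r i P.1 =
              T.weightMonomial (γ.loopGraph ccw' r').toLabelledSnakeGraph (Φ P).1 ∧
          γ.yBar ccw r i P.1 =
              T.coeffMonomialLoop (γ.loopGraph ccw' r') (Φ P).1 (Φ P).2 := by
  have hl := γ.two_le_deg hp
  obtain ⟨e, he⟩ := exists_loopSign_equiv hl ccw ccw'
  refine ⟨(loopSignEquiv hl ccw r).symm.trans (e.trans (goodSignEquiv hl ccw' r')), fun P => ?_⟩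
  -- Expressing the matching through its signs lets both pairs of monomials be compared with
  -- `loopWeight` and `loopCoeff`.
  obtain ⟨p, rfl⟩ := (loopSignEquiv hl ccw r).surjective P
  simp only [Equiv.trans_apply, Equiv.symm_apply_apply]
  refine ⟨exists_restrictsTo hl p.2, fun i hi => ⟨?_, ?_⟩⟩
  · rw [coe_goodSignEquiv, weightMonomial_reduce hl (e p).2, (he p).1]
    exact xBar_eq hl p.2 i hi
  · refine (yBar_eq hl p.2 i hi).trans ((he p).2.symm.trans ?_)
    exact (coeffMonomialLoop_reduce hl (e p).2 _).symm
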